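/- **Theorem 3.1.** *Setting.* Let $k\le m$ and $M\ge 0$ be integers and consider $$x_{n+1}=\alpha_n x_n+b_nu_n+c_n\upsilon_n ,\qquad n=0,1,\dots,N-1,$$ with states $x_n\in\mathbb R^m$ ($x_0$ given), controls $u_n\in\mathbb R^m$, matrices $\alpha_n,b_n,c_n\in\mathbb R^{m\times m}$, and disturbances $\upsilon_n=(\upsilon_n^1,\dots,\upsilon_n^k,0,\dots,0)^T$. The horizon $N$ is independent of the disturbances and of $\lambda$, with $P(N=j)=p_j$ for $0\le j\le M$, $\sum_{j=0}^M p_j=1$, $p_M\ne0$; put $\varphi_n=\sum_{j=n}^Mp_j$ (so $\varphi_{M+1}=0$). Given $\lambda=(\lambda_1,\dots,\lambda_k,0,\dots,0)^T$, the $\upsilon_n^i$ are independent and uniform on $[0,\lambda_i]$. The $\lambda_i$ have independent Pareto priors with densities $\beta^i (r^i)^{\beta^i}\lambda^{-\beta^i-1}\mathbf 1_{[r^i,\infty)}(\lambda)$, where $r^i>0$, $\beta^i>2$. For each $n<M$ the disturbance $\upsilon_n$ is determined by $c_n\upsilon_n$. The loss is $$\sum_{i=0}^N\big(y_i^Ts_iy_i+u_i^Tk_iu_i\big),\qquad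 y_i=\begin{pmatrix}x_i\\ \lambda\end{pmatrix},$$ with nonnegative quadratic forms $s_i,k_i$, $k_i$ symmetric. A policy $U$ chooses $u_n$ as a measurable function of $X_n=(x_0,\dots,x_n)$ and $U_{n-1}=(u_0,\dots,u_{n-1})$; it is a *Bayes policy* if it minimizes the expected loss. For $0\le n\le M$ and a given history $(X_n,U_{n-1})$ (produced by some past disturbances with nonnegative coordinates), the *Bayes risk* is $$W_n=\inf_U E\Big[\sum_{i=n}^N(y_i^Ts_iy_i+u_i^Tk_iu_i)\,\Big|\,X_n,U_{n-1},\,N\ge n\Big] =\inf_U E\Big[\sum_{i=n}^M\tfrac{\varphi_i}{\varphi_n}(y_i^Ts_iy_i+u_i^Tk_iu_i)\,\Big|\,X_n,U_{n-1}\Big],$$ the conditional law of $\lambda$ being the posterior given by Bayes' formula; a policy attaining the infimum is a Bayes policy for the problem truncated at $n$. Let $r_0=(r^1,\dots,r^k,0,\dots,0)^T$, $r_{n+1}=r_n\vee\upsilon_n$ (coordinatewise), $\beta_n^i=\beta^i+n$, and let $Q^n,Q_2^n$ be the diagonal $m\times m$ matrices with $i$-th entries $$Q^{n,i}=\frac{\beta_n^i}{2(\beta_n^i-1)},\qquad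 Q_2^{n,i}=\frac{(\beta_n^i)^2}{(\beta_n^i)^2-1}\quad(i\le k),\qquad 0\quad(i>k).$$ *Conclusion.* 1. There are matrices $A_n=A_n^T$, $B_n$, $C_n\in\mathbb R^{m\times m}$ ($n\le M$), not depending on $x_0$, $r_0$ or the history, such that always $W_n=x_n^TA_nx_n+2x_n^TB_nr_n+2r_n^TC_nr_n$ (finite). 2. For $n<M$ and every history, $E(\upsilon_n\mid X_n,U_{n-1})=Q^nr_n$ and $E(r_{n+1}\mid X_n,U_{n-1})=Q_2^nr_n$. 3. For all matrices $A_n,B_n,C_n$ as in 1, put $$K_n=k_n+\frac{\varphi_{n+1}}{\varphi_n}\,b_n^TA_{n+1}b_n,\qquad L_n=-\frac{\varphi_{n+1}}{\varphi_n}\,b_n^T\big[A_{n+1}\alpha_nx_n+(A_{n+1}c_nQ^n+B_{n+1}Q_2^n)r_n\big]$$ (so $K_M=k_M$, $L_M=0$). Then a policy is a Bayes policy if and only if its controls $u_n^*$ satisfy $$K_nu_n^*=L_n$$ almost surely for all $n=0,\dots,M$. Likewise, for every $n\le M$ and every history $(X_n,U_{n-1})$, a policy is a Bayes policy for the problem truncated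 at $n$ if and only if $K_iu_i^*=L_i$ almost surely, under the conditional law given the history, for all $i=n,\dots,M$. Moreover, for given $r_0$, some policy satisfies $K_nu_n^*=L_n$ for all $n\le M$, all $x_0$ and all histories. If the horizon is deterministic, $N=M$, then $\varphi_{n+1}/\varphi_n=1$ for $n<M$ and $K_n=k_n+b_n^TA_{n+1}b_n$, $L_n=-b_n^T[A_{n+1}\alpha_nx_n+(A_{n+1}c_nQ^n+B_{n+1}Q_2^n)r_n]$. -/

import Mathlib

open MeasureTheory ProbabilityTheory Matrix
open scoped ENNReal

noncomputable section

/-- The data of the control problem: state and control space `ℝᵐ`, `k` scalar disturbances per step,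
maximal horizon `M`, dynamics `α, b, c`, loss matrices `s` (for `y = (x, λ)`) and `κ` (for `u`),
horizon probabilities `p j = P(N = j)`, and shape parameters `β` of the Pareto priors. -/
structure LinSystem (m k : ℕ) where
  M : ℕ
  α : ℕ → Matrix (Fin m) (Fin m) ℝ
  b : ℕ → Matrix (Fin m) (Fin m) ℝ
  c : ℕ → Matrix (Fin m) (Fin m) ℝ
  s : ℕ → Matrix (Fin m ⊕ Fin m) (Fin m ⊕ Fin m) ℝ
  κ : ℕ → Matrix (Fin m) (Fin m) ℝ
  p : ℕ → ℝ
  β : Fin k → ℝ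

/-- `(v¹, …, vᵏ)` padded with zeros to a vector of `ℝᵐ`. -/
def pad {k : ℕ} (m : ℕ) (v : Fin k → ℝ) : Fin m → ℝ :=
  fun i => if h : i.val < k then v ⟨i.val, h⟩ else 0

/-- The density of the uniform distribution on `[0, a]`. -/
def unifDensity (a v : ℝ) : ℝ :=
  Set.indicator (Set.Icc 0 a) (fun _ => 1 / a) v

/-- The uniform distribution on `[0, a]` (for `a > 0`). -/
def unifMeasure (a : ℝ) : Measure ℝ :=
  (volume : Measure ℝ).withDensity (fun v => ENNReal.ofReal (unifDensity a v))

/-- A control policy: `U n (X_n, U_{n-1})` is the control applied at time `n` after the states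
`X_n = (x_0, …, x_n)` and the earlier controls `U_{n-1} = (u_0, …, u_{n-1})` have been observed. -/
abbrev Policy (m : ℕ) : Type :=
  (n : ℕ) → (Fin (n + 1) → Fin m → ℝ) × (Fin n → Fin m → ℝ) → (Fin m → ℝ)

/-- The class of admissible policies. The loss is nonnegative, so the risk of every measurable policy
exists in `[0, ∞]`. -/
def Policy.IsAdmissible {m : ℕ} (U : Policy m) : Prop := ∀ n, Measurable (U n)

/-- The policy that plays the given controls `us 0, …, us (n-1)` before time `n`, and `U` from time
`n` on. -/
def Policy.withPast {m : ℕ} (U : Policy m) (n : ℕ) (us : ℕ → Fin m → ℝ) : Policy m :=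
  fun i h => if i < n then us i else U i h

/-- The policy that plays the given controls `us 0, us 1, …` whatever is observed. -/
def Policy.openLoop {m : ℕ} (us : ℕ → Fin m → ℝ) : Policy m := fun i _ => us i

/-- The parameters `r_n` of the posterior: `r_0 = r`, `r_{n+1} = r_n ∨ v_n`. -/
def scale {k : ℕ} (r : Fin k → ℝ) (v : ℕ → Fin k → ℝ) : ℕ → Fin k → ℝ
  | 0 => r
  | n + 1 => fun i => max (scale r v n i) (v n i)

namespace LinSystem

variable {m k : ℕ} (S : LinSystem m k)

/-- `(X_n, U_{n-1})` when policy `U` is used, the initial state is `x0` and the disturbances are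
`v 0, v 1, …`:  `x_{n+1} = α_n x_n + b_n u_n + c_n v_n`. -/
def path (U : Policy m) (x0 : Fin m → ℝ) (v : ℕ → Fin k → ℝ) :
    (n : ℕ) → (Fin (n + 1) → Fin m → ℝ) × (Fin n → Fin m → ℝ)
  | 0 => (fun _ => x0, Fin.elim0)
  | n + 1 =>
    (Fin.snoc (α := fun _ => Fin m → ℝ) (path U x0 v n).1
      (S.α n *ᵥ (path U x0 v n).1 (Fin.last n) + S.b n *ᵥ U n (path U x0 v n)
        + S.c n *ᵥ pad m (v n)),
     Fin.snoc (α := fun _ => Fin m → ℝ) (path U x0 v n).2 (U n (path U x0 v n)))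

/-- The state `x_n`. -/
def state (U : Policy m) (x0 : Fin m → ℝ) (v : ℕ → Fin k → ℝ) (n : ℕ) : Fin m → ℝ :=
  (S.path U x0 v n).1 (Fin.last n)

/-- The control `u_n`. -/
def control (U : Policy m) (x0 : Fin m → ℝ) (v : ℕ → Fin k → ℝ) (n : ℕ) : Fin m → ℝ :=
  U n (S.path U x0 v n)

/-- The cost `y_iᵀ s_i y_i + u_iᵀ κ_i u_i` at time `i`, where `y_i = (x_i, λ)`. -/
def stageCost (U : Policy m) (x0 : Fin m → ℝ) (lam : Fin k → ℝ) (v : ℕ → Fin k → ℝ) (i : ℕ) : ℝ :=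
  Sum.elim (S.state U x0 v i) (pad m lam) ⬝ᵥ
      (S.s i *ᵥ Sum.elim (S.state U x0 v i) (pad m lam))
    + S.control U x0 v i ⬝ᵥ (S.κ i *ᵥ S.control U x0 v i)

/-- The joint law of the disturbances `v_0, …, v_{M-1}` for the parameter `λ`: independent, with
`v_n^i` uniform on `[0, λ_i]`. -/
def disturbLaw (lam : Fin k → ℝ) : Measure (Fin S.M → Fin k → ℝ) :=
  Measure.pi fun _ => Measure.pi fun i => unifMeasure (lam i)

/-- The prior of `λ`: independent Pareto distributions with scales `r i` and shapes `β i`. -/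
def prior (r : Fin k → ℝ) : Measure (Fin k → ℝ) :=
  Measure.pi fun i => paretoMeasure (r i) (S.β i)

/-- The disturbance sequence that starts with the given `vs 0, …, vs (n-1)` and goes on with the
entries `n, …, M-1` of `w`. -/
def splice (n : ℕ) (vs : ℕ → Fin k → ℝ) (w : Fin S.M → Fin k → ℝ) : ℕ → Fin k → ℝ :=
  fun j => if j < n then vs j else if h : j < S.M then w ⟨j, h⟩ else 0

/-- The entries of `w` as a sequence. -/
def extend (w : Fin S.M → Fin k → ℝ) : ℕ → Fin k → ℝ :=
  fun j => if h : j < S.M then w ⟨j, h⟩ else 0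

/-- The likelihood of `λ` when the disturbances `vs 0, …, vs (n-1)` have been observed. -/
def likelihood (n : ℕ) (vs : ℕ → Fin k → ℝ) (lam : Fin k → ℝ) : ℝ≥0∞ :=
  ∏ j ∈ Finset.range n, ∏ i, ENNReal.ofReal (unifDensity (lam i) (vs j i))

/-- The posterior distribution of `λ` after the disturbances `vs 0, …, vs (n-1)` have been observed,
by Bayes' formula: the normalized product of prior and likelihood. -/
def posterior (r : Fin k → ℝ) (n : ℕ) (vs : ℕ → Fin k → ℝ) : Measure (Fin k → ℝ) :=
  (∫⁻ lam, likelihood n vs lam ∂(S.prior r))⁻¹ • (S.prior r).withDensity (likelihood n vs)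

/-- `φ_n = P(N ≥ n)`. -/
def φ (n : ℕ) : ℝ := ∑ j ∈ Finset.Icc n S.M, S.p j

/-- The expected risk `r(π, U) = E_π[E_N[E_λ[∑_{i=0}^N (y_iᵀ s_i y_i + u_iᵀ κ_i u_i)]]]`. -/
def risk (r : Fin k → ℝ) (x0 : Fin m → ℝ) (U : Policy m) : ℝ≥0∞ :=
  ∫⁻ lam, ∑ j ∈ Finset.range (S.M + 1), ENNReal.ofReal (S.p j) *
    ∫⁻ w, ENNReal.ofReal
      (∑ i ∈ Finset.range (j + 1), S.stageCost U x0 lam (S.extend w) i)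
      ∂(S.disturbLaw lam) ∂(S.prior r)

/-- `U` is a Bayes policy: it minimizes the expected risk. -/
def IsBayes (r : Fin k → ℝ) (x0 : Fin m → ℝ) (U : Policy m) : Prop :=
  S.risk r x0 U = ⨅ (U' : Policy m) (_ : U'.IsAdmissible), S.risk r x0 U'

/-- The expected risk from time `n` on, `E[∑_{i=n}^N (y_iᵀ s_i y_i + u_iᵀ κ_i u_i) | X_n, U_{n-1}]`,
given that the horizon has not ended before `n`. The history `X_n, U_{n-1}` is the one produced by
`x0`, the controls `us 0, …, us (n-1)` and the disturbances `vs 0, …, vs (n-1)`; given it, `λ` follows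
the posterior, the later disturbances have their law for the parameter `λ`, and `N = j` has
probability `p_j / φ_n`. -/
def condRisk (r : Fin k → ℝ) (x0 : Fin m → ℝ) (n : ℕ) (us : ℕ → Fin m → ℝ)
    (vs : ℕ → Fin k → ℝ) (U : Policy m) : ℝ≥0∞ :=
  ∑ j ∈ Finset.Icc n S.M, ENNReal.ofReal (S.p j / S.φ n) *
    ∫⁻ lam, ∫⁻ w, ENNReal.ofReal
      (∑ i ∈ Finset.Icc n j, S.stageCost (U.withPast n us) x0 lam (S.splice n vs w) i)
      ∂(S.disturbLaw lam) ∂(S.posterior r n vs)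

/-- The Bayes risk `W_n` of the problem truncated at `n`, as a function of the history. -/
def W (r : Fin k → ℝ) (x0 : Fin m → ℝ) (n : ℕ) (us : ℕ → Fin m → ℝ)
    (vs : ℕ → Fin k → ℝ) : ℝ≥0∞ :=
  ⨅ (U : Policy m) (_ : U.IsAdmissible), S.condRisk r x0 n us vs U

/-- `U` is a Bayes policy for the problem truncated at `n`. -/
def IsBayesFrom (r : Fin k → ℝ) (x0 : Fin m → ℝ) (n : ℕ) (us : ℕ → Fin m → ℝ)
    (vs : ℕ → Fin k → ℝ) (U : Policy m) : Prop :=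
  S.condRisk r x0 n us vs U = S.W r x0 n us vs

/-- `A_n, B_n, C_n` are the coefficients of the quadratic form of the Bayes risk: `A_n` is symmetric
and `W_n = x_nᵀ A_n x_n + 2 x_nᵀ B_n r_n + 2 r_nᵀ C_n r_n` for all priors with shapes `β`, all initial
states and all histories. -/
def IsRiskForm (A B C : ℕ → Matrix (Fin m) (Fin m) ℝ) : Prop :=
  ∀ n ≤ S.M, (A n).IsSymm ∧
    ∀ (r : Fin k → ℝ) (x0 : Fin m → ℝ) (us : ℕ → Fin m → ℝ) (vs : ℕ → Fin k → ℝ),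
      (∀ i, 0 < r i) → (∀ j i, 0 ≤ vs j i) →
      S.W r x0 n us vs ≠ ∞ ∧
      (S.W r x0 n us vs).toReal =
        S.state (.openLoop us) x0 vs n ⬝ᵥ (A n *ᵥ S.state (.openLoop us) x0 vs n)
        + 2 * (S.state (.openLoop us) x0 vs n ⬝ᵥ (B n *ᵥ pad m (scale r vs n)))
        + 2 * (pad m (scale r vs n) ⬝ᵥ (C n *ᵥ pad m (scale r vs n)))

/-- `Q^n`, the diagonal matrix of the factors `β_n / (2 (β_n - 1))`, where `β_n = β + n`. -/
def Q (n : ℕ) : Matrix (Fin m) (Fin m) ℝ :=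
  Matrix.diagonal (pad m fun i => (S.β i + n) / (2 * (S.β i + n - 1)))

/-- `Q_2^n`, the diagonal matrix of the factors `β_n² / (β_n² - 1)`, where `β_n = β + n`. -/
def Q₂ (n : ℕ) : Matrix (Fin m) (Fin m) ℝ :=
  Matrix.diagonal (pad m fun i => (S.β i + n) ^ 2 / ((S.β i + n) ^ 2 - 1))

/-- `K_n`; the factor `φ_{n+1} / φ_n` is the probability that the horizon goes on after `n`. -/
def K (A : ℕ → Matrix (Fin m) (Fin m) ℝ) (n : ℕ) : Matrix (Fin m) (Fin m) ℝ :=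
  S.κ n + (S.φ (n + 1) / S.φ n) • ((S.b n)ᵀ * A (n + 1) * S.b n)

/-- `L_n` for the state `x = x_n` and the posterior parameter `ρ = r_n`. -/
def L (A B : ℕ → Matrix (Fin m) (Fin m) ℝ) (n : ℕ) (x ρ : Fin m → ℝ) : Fin m → ℝ :=
  -((S.φ (n + 1) / S.φ n) • ((S.b n)ᵀ *ᵥ
    ((A (n + 1) * S.α n) *ᵥ x + (A (n + 1) * S.c n * S.Q n + B (n + 1) * S.Q₂ n) *ᵥ ρ)))

/-- The equation `K_n u_n = L_n` along the trajectory of `U` for the disturbances `v`. -/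
def Solves (A B : ℕ → Matrix (Fin m) (Fin m) ℝ) (r : Fin k → ℝ) (x0 : Fin m → ℝ)
    (U : Policy m) (v : ℕ → Fin k → ℝ) (n : ℕ) : Prop :=
  S.K A n *ᵥ S.control U x0 v n = S.L A B n (S.state U x0 v n) (pad m (scale r v n))

end LinSystem

end

/-! ### Products of densities -/

/-! Pareto priors are conjugate to uniform disturbances: after `n` observations the posterior of `λ`
is again a product of Pareto laws, with scales `r_n` and shapes `β + n` (`posterior_eq`). Hence the
history matters only through `x_n` and `r_n`. Moreover, given the history, `λ` and the later
disturbances are `r_n` times, coordinatewise, random vectors whose law depends on the shapes only.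
Expectations of quadratic functions of `λ`, `v_n` and `r_{n+1}` are therefore quadratic in `r_n`
with fixed coefficients; the second moments exist because the shapes exceed 2 (`expCost_self`,
`integral_next`).

The rest is dynamic programming. Disintegrating the joint law with respect to `v_n`
(`lintegral_joint_eq`) gives the recursion `condRisk_succ`. If `W_{n+1}` is a quadratic form, then
using `u` at time `n` and acting optimally afterwards costs `J(u) = uᵀ K_n u - 2 uᵀ L_n + const`
(`bellman`). The matrix `K_n` may be singular. But `J ≥ 0` for every `u`, as an expectation of
nonnegative losses, and a quadratic function that is bounded below has `K_n ≥ 0` and `L_n` in the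
range of `K_n` (`exists_critical_point`). So its minimizers are exactly the solutions of `K_n u =
L_n`.

A linear generalized inverse `G` of `K_n` selects one solution. It is a measurable function of the
history, since injectivity of `c_n` makes `r_n` one, and the minimum `const - L_nᵀ G L_n` is again a
quadratic form in `(x_n, r_n)`. Backward induction from `M + 1`, where all risks vanish, thus yields
the coefficients and an optimal policy together (`exists_riskForm_and_optimal`).

For the characterization, every policy satisfies `J(u*) ≤ J(u_n) ≤ risk`, where `u*` minimizes `J`.
Equality throughout forces `K_n u_n = L_n` and, since `φ_{n+1} > 0` for `n < M` and `W_{n+1}` has a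
finite integral, it forces the policy to be optimal from `n + 1` on for almost every `v_n`
(`isBayesFrom_iff_succ`). Iteration gives the almost sure equations, and `n = 0` is the original
problem. -/

lemma lintegral_pi_prod {α : Type*} [MeasurableSpace α] : ∀ {n : ℕ}
    (μ : Fin n → Measure α) [∀ i, SigmaFinite (μ i)] (f : Fin n → α → ℝ≥0∞),
    (∀ i, Measurable (f i)) →
    ∫⁻ x, ∏ i, f i (x i) ∂(Measure.pi μ) = ∏ i, ∫⁻ x, f i x ∂(μ i) := by
  intro n
  induction n with
  | zero => intro μ _ f hf; simp
  | succ n ih =>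
    intro μ _ f hf
    have h := (measurePreserving_piFinSuccAbove μ 0).symm
    rw [← h.lintegral_comp_emb (MeasurableEquiv.measurableEmbedding _)]
    have hg : Measurable fun y : Fin n → α => ∏ i, f i.succ (y i) :=
      Finset.measurable_fun_prod _ fun i _ => (hf i.succ).comp (measurable_pi_apply i)
    calc ∫⁻ z : α × (Fin n → α), ∏ i, f i ((MeasurableEquiv.piFinSuccAbove (fun _ => α) 0).symm z i)
          ∂((μ 0).prod (Measure.pi fun j => μ (Fin.succAbove 0 j)))
        = ∫⁻ z : α × (Fin n → α), f 0 z.1 * ∏ i, f i.succ (z.2 i)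
          ∂((μ 0).prod (Measure.pi fun j => μ (Fin.succAbove 0 j))) := by
          refine lintegral_congr fun z => ?_
          rw [Fin.prod_univ_succ]
          simp [MeasurableEquiv.piFinSuccAbove_symm_apply, Fin.insertNthEquiv]
      _ = _ := by
          rw [lintegral_prod_mul (hf 0).aemeasurable hg.aemeasurable, Fin.prod_univ_succ]
          congr 1
          exact ih (fun i => μ i.succ) (fun i => f i.succ) fun i => hf _

lemma pi_withDensity {n : ℕ} {α : Type*} [MeasurableSpace α]
    (μ : Fin n → Measure α) [∀ i, SigmaFinite (μ i)] (f : Fin n → α → ℝ≥0∞)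
    (hf : ∀ i, Measurable (f i)) [∀ i, SigmaFinite ((μ i).withDensity (f i))] :
    Measure.pi (fun i => (μ i).withDensity (f i))
      = (Measure.pi μ).withDensity (fun x => ∏ i, f i (x i)) := by
  refine (Measure.pi_eq fun s hs => ?_)
  rw [withDensity_apply _ (MeasurableSet.univ_pi hs), Measure.restrict_pi_pi,
    lintegral_pi_prod _ _ hf]
  simp [withDensity_apply _ (hs _)]

lemma pi_smul_prob {n : ℕ} {α : Type*} [MeasurableSpace α]
    (μ : Fin n → Measure α) [∀ i, IsProbabilityMeasure (μ i)] (c : Fin n → ℝ≥0∞)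
    (hc : ∀ i, c i ≠ ∞) :
    Measure.pi (fun i => c i • μ i) = (∏ i, c i) • Measure.pi μ := by
  have : ∀ i, IsFiniteMeasure (c i • μ i) := fun i => Measure.smul_finite _ (hc i)
  refine Measure.pi_eq fun s hs => ?_
  simp [Finset.prod_mul_distrib]

/-- Change of variables. It exhibits the uniform and Pareto laws as rescalings of the laws with
scale 1; the scale then sits in the integrand and no longer in the measure, which gives
measurability in the scale and the homogeneity of the moments. -/
lemma map_mul_withDensity {a : ℝ} (ha : 0 < a) {f g : ℝ → ℝ≥0∞} (hg : Measurable g)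
    (h : ∀ x, f x = ENNReal.ofReal a * g (a * x)) :
    Measure.map (fun x => a * x) ((volume : Measure ℝ).withDensity f)
      = (volume : Measure ℝ).withDensity g := by
  have hm : Measurable fun x : ℝ => a * x := measurable_const_mul a
  have hf : Measurable f := by
    rw [funext h]; exact (hg.comp hm).const_mul _
  refine Measure.ext_of_lintegral _ fun F hF => ?_
  rw [lintegral_map hF hm, lintegral_withDensity_eq_lintegral_mul _ hf
      (show Measurable fun x => F (a * x) from hF.comp hm),
    lintegral_withDensity_eq_lintegral_mul _ hg hF]
  -- Lebesgue measure is `a` times its image under `x ↦ a * x`; rewriting only the right side puts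
  -- both integrals in the same variable.
  have h1 : (volume : Measure ℝ) = ENNReal.ofReal a • Measure.map (fun x => a * x) volume := by
    rw [Real.map_volume_mul_left ha.ne', smul_smul, abs_of_pos (inv_pos.2 ha),
      ← ENNReal.ofReal_mul ha.le, mul_inv_cancel₀ ha.ne', ENNReal.ofReal_one, one_smul]
  conv_rhs => rw [h1]
  rw [lintegral_smul_measure, lintegral_map (hg.mul hF) hm, smul_eq_mul, ← lintegral_const_mul]
  · refine lintegral_congr fun x => ?_
    simp [h x, mul_assoc]
  · exact (hg.mul hF).comp hm

/-! ### The uniform distribution -/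

lemma measurable_unifDensity₂ : Measurable fun z : ℝ × ℝ => unifDensity z.1 z.2 := by
  have : (fun z : ℝ × ℝ => unifDensity z.1 z.2)
      = Set.indicator {z : ℝ × ℝ | 0 ≤ z.2 ∧ z.2 ≤ z.1} (fun z => 1 / z.1) := by
    ext z; simp [unifDensity, Set.indicator_apply, Set.mem_Icc]
  rw [this]
  exact (by fun_prop : Measurable fun z : ℝ × ℝ => 1 / z.1).indicator
    ((measurableSet_le measurable_const measurable_snd).inter
      (measurableSet_le measurable_snd measurable_fst))

lemma measurable_unifDensity (a : ℝ) : Measurable (unifDensity a) :=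
  measurable_unifDensity₂.comp (measurable_const.prodMk measurable_id)

instance sigmaFinite_unifMeasure (a : ℝ) : SigmaFinite (unifMeasure a) :=
  SigmaFinite.withDensity_ofReal _

instance sigmaFinite_paretoMeasure (a b : ℝ) : SigmaFinite (paretoMeasure a b) :=
  SigmaFinite.withDensity_ofReal _

lemma unifMeasure_eq_smul (a : ℝ) :
    unifMeasure a = ENNReal.ofReal (1 / a) • (volume : Measure ℝ).restrict (Set.Icc 0 a) := by
  have : (fun v => ENNReal.ofReal (unifDensity a v))
      = Set.indicator (Set.Icc 0 a) (fun _ => ENNReal.ofReal (1 / a)) := by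
    ext v
    by_cases h : v ∈ Set.Icc 0 a
    · rw [Set.indicator_of_mem h, unifDensity, Set.indicator_of_mem h]
    · rw [Set.indicator_of_notMem h, unifDensity, Set.indicator_of_notMem h, ENNReal.ofReal_zero]
  rw [unifMeasure, this, withDensity_indicator measurableSet_Icc, withDensity_const]

lemma isProbabilityMeasure_unifMeasure {a : ℝ} (ha : 0 < a) :
    IsProbabilityMeasure (unifMeasure a) := by
  constructor
  rw [unifMeasure_eq_smul]
  simp [← ENNReal.ofReal_mul, ha.ne', ha.le]

lemma ae_unifMeasure (a : ℝ) : ∀ᵐ v ∂(unifMeasure a), 0 ≤ v ∧ v ≤ a := by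
  rw [unifMeasure_eq_smul]
  exact Measure.ae_smul_measure (ae_restrict_mem measurableSet_Icc) _

lemma map_mul_unifMeasure {a : ℝ} (ha : 0 < a) :
    Measure.map (fun x => a * x) (unifMeasure 1) = unifMeasure a := by
  refine map_mul_withDensity ha (measurable_unifDensity a).ennreal_ofReal fun x => ?_
  rw [← ENNReal.ofReal_mul ha.le]
  congr 1
  by_cases h : x ∈ Set.Icc (0 : ℝ) 1
  · have h' : a * x ∈ Set.Icc 0 a := ⟨mul_nonneg ha.le h.1, by nlinarith [h.2]⟩
    simp [unifDensity, h, h', ha.ne']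
  · have h' : a * x ∉ Set.Icc 0 a := fun h' => h
      ⟨(mul_nonneg_iff_of_pos_left ha).1 h'.1, le_of_mul_le_mul_left (by simpa using h'.2) ha⟩
    simp [unifDensity, h, h']

lemma integral_unifMeasure {a : ℝ} (ha : 0 < a) (f : ℝ → ℝ) :
    ∫ v, f v ∂(unifMeasure a) = (1 / a) * ∫ v in (0 : ℝ)..a, f v := by
  rw [unifMeasure_eq_smul, integral_smul_measure, intervalIntegral.integral_of_le ha.le,
    integral_Icc_eq_integral_Ioc, ENNReal.toReal_ofReal (by positivity), smul_eq_mul]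

lemma integral_id_unifMeasure {a : ℝ} (ha : 0 < a) : ∫ v, v ∂(unifMeasure a) = a / 2 := by
  rw [integral_unifMeasure ha, integral_id]
  field_simp
  ring

/-- Split the integral at `ρ`. The result is written in terms of `a` and `a⁻¹` so that Pareto
moments of orders 1 and -1 can be applied to it. -/
lemma integral_max_unifMeasure {a ρ : ℝ} (hρ : 0 ≤ ρ) (h : ρ ≤ a) (ha : 0 < a) :
    ∫ v, max ρ v ∂(unifMeasure a) = a / 2 + ρ ^ 2 / 2 * a⁻¹ := by
  have hc : Continuous fun v : ℝ => max ρ v := by fun_prop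
  rw [integral_unifMeasure ha, ← intervalIntegral.integral_add_adjacent_intervals
    (hc.intervalIntegrable 0 ρ) (hc.intervalIntegrable ρ a)]
  have h1 : ∫ v in (0 : ℝ)..ρ, max ρ v = ∫ v in (0 : ℝ)..ρ, ρ :=
    intervalIntegral.integral_congr fun v hv => by
      rw [Set.uIcc_of_le hρ] at hv; simp [hv.2]
  have h2 : ∫ v in ρ..a, max ρ v = ∫ v in ρ..a, v :=
    intervalIntegral.integral_congr fun v hv => by
      rw [Set.uIcc_of_le h] at hv; simp [hv.1]
  rw [h1, h2, integral_id, intervalIntegral.integral_const, smul_eq_mul]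
  field_simp
  ring

/-! ### The Pareto distribution -/

lemma ae_paretoMeasure (t γ : ℝ) : ∀ᵐ x ∂(paretoMeasure t γ), t ≤ x := by
  rw [paretoMeasure, ae_withDensity_iff (by
    exact (measurable_paretoPDFReal t γ).ennreal_ofReal)]
  refine Filter.Eventually.of_forall fun x hx => ?_
  by_contra h
  exact hx (paretoPDF_of_lt (not_le.1 h))

lemma map_mul_paretoMeasure {t γ : ℝ} (ht : 0 < t) :
    Measure.map (fun x => t * x) (paretoMeasure 1 γ) = paretoMeasure t γ := by
  refine map_mul_withDensity ht (measurable_paretoPDFReal t γ).ennreal_ofReal fun x => ?_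
  rw [paretoPDF, paretoPDF, ← ENNReal.ofReal_mul ht.le]
  congr 1
  by_cases h : 1 ≤ x
  · have hx : 0 < x := by linarith
    rw [paretoPDFReal, paretoPDFReal, if_pos h, if_pos (by nlinarith),
      Real.mul_rpow ht.le hx.le, Real.one_rpow]
    have : t * (t ^ γ * t ^ (-(γ + 1))) = 1 := by
      rw [← Real.rpow_add ht]
      rw [show γ + -(γ + 1) = -1 by ring, Real.rpow_neg_one, mul_inv_cancel₀ ht.ne']
    linear_combination (-γ * x ^ (-(γ + 1))) * this
  · rw [paretoPDFReal, paretoPDFReal, if_neg h, if_neg (by nlinarith)]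
    simp

/-- A real exponent covers all the moments needed: orders 1 and -1 for the posterior means, and
order 2 for square integrability, which is where shapes above 2 are required. -/
lemma rpow_paretoMeasure {t γ s : ℝ} (ht : 0 < t) (hγ : 0 < γ) (hs : s < γ) :
    Integrable (fun x => x ^ s) (paretoMeasure t γ) ∧
      ∫ x, x ^ s ∂(paretoMeasure t γ) = γ / (γ - s) * t ^ s := by
  have hm : Measurable (paretoPDF t γ) := (measurable_paretoPDFReal t γ).ennreal_ofReal
  have hfin : ∀ᵐ x ∂(volume : Measure ℝ), paretoPDF t γ x < ∞ :=
    Filter.Eventually.of_forall fun x => ENNReal.ofReal_lt_top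
  have heq : (fun x => (paretoPDF t γ x).toReal • x ^ s)
      = Set.indicator (Set.Ici t) (fun x => γ * t ^ γ * x ^ (s - γ - 1)) := by
    ext x
    rw [paretoPDF, ENNReal.toReal_ofReal (paretoPDFReal_nonneg ht.le hγ.le x), paretoPDFReal]
    by_cases h : t ≤ x
    · have hx : 0 < x := by linarith
      rw [Set.indicator_of_mem (show x ∈ Set.Ici t from h), if_pos h, smul_eq_mul, mul_assoc,
        ← Real.rpow_add hx]
      ring_nf
    · rw [Set.indicator_of_notMem (show x ∉ Set.Ici t from h), if_neg h]; simp
  rw [paretoMeasure, integrable_withDensity_iff_integrable_smul' hm hfin,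
    integral_withDensity_eq_integral_toReal_smul hm hfin, heq,
    integrable_indicator_iff measurableSet_Ici, integral_indicator measurableSet_Ici,
    integrableOn_Ici_iff_integrableOn_Ioi, integral_Ici_eq_integral_Ioi]
  refine ⟨(integrableOn_Ioi_rpow_of_lt (by linarith) ht).const_mul _, ?_⟩
  rw [integral_const_mul, integral_Ioi_rpow_of_lt (by linarith) ht]
  have h1 : γ - s ≠ 0 := by linarith
  have h2 : s - γ - 1 + 1 = -(γ - s) := by ring
  have h3 : t ^ s = t ^ γ * t ^ (-(γ - s)) := by rw [← Real.rpow_add ht]; ring_nf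
  rw [h2, h3]
  field_simp

/-- The density of the predictive distribution of a disturbance that is uniform on `[0, λ]`, where
`λ` has the Pareto distribution with scale `ρ` and shape `γ`. -/
noncomputable def predPDF (ρ γ v : ℝ) : ℝ≥0∞ :=
  ENNReal.ofReal (if 0 ≤ v then γ * ρ ^ γ / ((γ + 1) * max ρ v ^ (γ + 1)) else 0)

lemma measurable_predPDF (ρ γ : ℝ) : Measurable (predPDF ρ γ) := by
  unfold predPDF
  refine (Measurable.ite measurableSet_Ici ?_ measurable_const).ennreal_ofReal
  exact measurable_const.div (((measurable_const.max measurable_id).pow_const _).const_mul _)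

/-- Bayes' formula for one Pareto distributed parameter. -/
lemma paretoPDF_mul_unifDensity {ρ γ : ℝ} (hρ : 0 < ρ) (hγ : 0 < γ) (l v : ℝ) :
    paretoPDF ρ γ l * ENNReal.ofReal (unifDensity l v)
      = predPDF ρ γ v * paretoPDF (max ρ v) (γ + 1) l := by
  have hmax : 0 < max ρ v := lt_max_of_lt_left hρ
  rw [paretoPDF, predPDF, paretoPDF, ← ENNReal.ofReal_mul (paretoPDFReal_nonneg hρ.le hγ.le l),
    ← ENNReal.ofReal_mul (by split_ifs <;> positivity)]
  congr 1
  have hu : unifDensity l v = if 0 ≤ v ∧ v ≤ l then 1 / l else 0 := by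
    simp [unifDensity, Set.indicator_apply]
  rw [paretoPDFReal, paretoPDFReal, hu]
  -- Both sides are supported on `0 ≤ v`, `max ρ v ≤ l`, where they equal `γ ρ^γ l^(-(γ+2))`.
  by_cases hv : 0 ≤ v
  · by_cases h1 : max ρ v ≤ l
    · obtain ⟨h2, h3⟩ := max_le_iff.1 h1
      have hl : 0 < l := by linarith
      rw [if_pos h2, if_pos ⟨hv, h3⟩, if_pos hv, if_pos h1]
      have h4 : l ^ (-(γ + 1 + 1)) = l ^ (-(γ + 1)) * (1 / l) := by
        rw [neg_add, Real.rpow_add hl, Real.rpow_neg_one, one_div]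
      rw [h4]
      field_simp
    · rw [if_neg h1, mul_zero]
      by_cases h2 : ρ ≤ l
      · rw [if_neg fun h3 : 0 ≤ v ∧ v ≤ l => h1 (max_le h2 h3.2), mul_zero]
      · rw [if_neg h2, zero_mul]
  · rw [if_neg (fun h : 0 ≤ v ∧ v ≤ l => hv h.1), if_neg hv, mul_zero, zero_mul]

/-- Keeps the normalizing constant in Bayes' formula invertible; this is why histories are
restricted to nonnegative disturbances. -/
lemma predPDF_ne_zero {ρ γ v : ℝ} (hρ : 0 < ρ) (hγ : 0 < γ) (hv : 0 ≤ v) : predPDF ρ γ v ≠ 0 := by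
  have hmax : 0 < max ρ v := lt_max_of_lt_left hρ
  rw [predPDF, if_pos hv]
  exact (ENNReal.ofReal_pos.2 (by positivity)).ne'

lemma predPDF_ne_top (ρ γ v : ℝ) : predPDF ρ γ v ≠ ∞ := ENNReal.ofReal_ne_top

lemma measurable_unifDensity_left (v : ℝ) :
    Measurable fun l => ENNReal.ofReal (unifDensity l v) :=
  (measurable_unifDensity₂.comp (measurable_id.prodMk measurable_const)).ennreal_ofReal

lemma measurable_paretoPDF (t γ : ℝ) : Measurable (paretoPDF t γ) :=
  (measurable_paretoPDFReal t γ).ennreal_ofReal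

lemma paretoMeasure_withDensity_unif {ρ γ : ℝ} (hρ : 0 < ρ) (hγ : 0 < γ) (v : ℝ) :
    (paretoMeasure ρ γ).withDensity (fun l => ENNReal.ofReal (unifDensity l v))
      = predPDF ρ γ v • paretoMeasure (max ρ v) (γ + 1) := by
  rw [paretoMeasure, ← withDensity_mul _ (measurable_paretoPDF ρ γ)
      (measurable_unifDensity_left v), paretoMeasure,
    ← withDensity_smul _ (measurable_paretoPDF _ _)]
  congr 1
  ext l
  exact paretoPDF_mul_unifDensity hρ hγ l v

noncomputable section

/-! ### Product laws of the parameter and of the disturbances -/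

/-- Independent Pareto distributions with scales `ρ i` and shapes `γ i`. -/
def paretoPi {k : ℕ} (γ ρ : Fin k → ℝ) : Measure (Fin k → ℝ) :=
  Measure.pi fun i => paretoMeasure (ρ i) (γ i)

/-- Independent uniform distributions on `[0, a i]`. -/
def unifPi {k : ℕ} (a : Fin k → ℝ) : Measure (Fin k → ℝ) :=
  Measure.pi fun i => unifMeasure (a i)

lemma isProbabilityMeasure_paretoPi {k : ℕ} {γ ρ : Fin k → ℝ} (hγ : ∀ i, 0 < γ i)
    (hρ : ∀ i, 0 < ρ i) : IsProbabilityMeasure (paretoPi γ ρ) := by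
  have : ∀ i, IsProbabilityMeasure (paretoMeasure (ρ i) (γ i)) := fun i =>
    isProbabilityMeasure_paretoMeasure (hρ i) (hγ i)
  unfold paretoPi; infer_instance

lemma isProbabilityMeasure_unifPi {k : ℕ} {a : Fin k → ℝ} (ha : ∀ i, 0 < a i) :
    IsProbabilityMeasure (unifPi a) := by
  have : ∀ i, IsProbabilityMeasure (unifMeasure (a i)) := fun i =>
    isProbabilityMeasure_unifMeasure (ha i)
  unfold unifPi; infer_instance

instance {k : ℕ} (γ ρ : Fin k → ℝ) : SigmaFinite (paretoPi γ ρ) := by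
  unfold paretoPi; infer_instance

instance {k : ℕ} (a : Fin k → ℝ) : SigmaFinite (unifPi a) := by
  unfold unifPi; infer_instance

instance {k : ℕ} : IsProbabilityMeasure (unifPi (1 : Fin k → ℝ)) :=
  isProbabilityMeasure_unifPi fun _ => one_pos

lemma ae_pi_of_ae {ι : Type*} [Fintype ι] {α : Type*} [MeasurableSpace α] (μ : ι → Measure α)
    [∀ i, SigmaFinite (μ i)] {p : ι → α → Prop} (h : ∀ i, ∀ᵐ x ∂(μ i), p i x) :
    ∀ᵐ x ∂(Measure.pi μ), ∀ i, p i (x i) := by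
  rw [ae_all_iff]
  exact fun i => Measure.tendsto_eval_ae_ae.eventually (h i)

lemma ae_paretoPi {k : ℕ} (γ ρ : Fin k → ℝ) : ∀ᵐ l ∂(paretoPi γ ρ), ∀ i, ρ i ≤ l i :=
  ae_pi_of_ae _ fun _ => ae_paretoMeasure _ _

lemma ae_unifPi {k : ℕ} (a : Fin k → ℝ) : ∀ᵐ v ∂(unifPi a), ∀ i, 0 ≤ v i ∧ v i ≤ a i :=
  ae_pi_of_ae _ fun _ => ae_unifMeasure _

lemma map_mul_paretoPi {k : ℕ} {γ ρ : Fin k → ℝ} (hρ : ∀ i, 0 < ρ i) :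
    Measure.map (fun x => ρ * x) (paretoPi γ 1) = paretoPi γ ρ := by
  have hσ : ∀ i, SigmaFinite (Measure.map (fun x => ρ i * x) (paretoMeasure 1 (γ i))) := fun i => by
    rw [map_mul_paretoMeasure (hρ i)]; infer_instance
  have := Measure.pi_map_pi (μ := fun i => paretoMeasure 1 (γ i)) (f := fun i x => ρ i * x)
    fun i => (measurable_const_mul _).aemeasurable
  simp only [map_mul_paretoMeasure (hρ _)] at this
  exact this

lemma map_mul_unifPi {k : ℕ} {a : Fin k → ℝ} (ha : ∀ i, 0 < a i) :
    Measure.map (fun x => a * x) (unifPi 1) = unifPi a := by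
  have hσ : ∀ i, SigmaFinite (Measure.map (fun x => a i * x) (unifMeasure 1)) := fun i => by
    rw [map_mul_unifMeasure (ha i)]; infer_instance
  have := Measure.pi_map_pi (μ := fun _ : Fin k => unifMeasure 1) (f := fun i x => a i * x)
    fun i => (measurable_const_mul _).aemeasurable
  simp only [map_mul_unifMeasure (ha _)] at this
  exact this

lemma paretoPi_eq_withDensity {k : ℕ} (γ ρ : Fin k → ℝ) :
    paretoPi γ ρ = (volume : Measure (Fin k → ℝ)).withDensity
      (fun l => ∏ i, paretoPDF (ρ i) (γ i) (l i)) := by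
  have : ∀ i, SigmaFinite ((volume : Measure ℝ).withDensity (paretoPDF (ρ i) (γ i))) := fun i =>
    sigmaFinite_paretoMeasure (ρ i) (γ i)
  exact pi_withDensity _ _ fun i => measurable_paretoPDF _ _

lemma unifPi_eq_withDensity {k : ℕ} (a : Fin k → ℝ) :
    unifPi a = (volume : Measure (Fin k → ℝ)).withDensity
      (fun v => ∏ i, ENNReal.ofReal (unifDensity (a i) (v i))) := by
  have : ∀ i, SigmaFinite ((volume : Measure ℝ).withDensity
      (fun v => ENNReal.ofReal (unifDensity (a i) v))) := fun i => sigmaFinite_unifMeasure (a i)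
  exact pi_withDensity _ _ fun i => (measurable_unifDensity _).ennreal_ofReal

/-- The law of a disturbance when its parameter follows `paretoPi γ ρ`. -/
def pred {k : ℕ} (γ ρ : Fin k → ℝ) : Measure (Fin k → ℝ) :=
  Measure.map (fun z : (Fin k → ℝ) × (Fin k → ℝ) => ρ * z.1 * z.2) ((paretoPi γ 1).prod (unifPi 1))

lemma measurable_pred_fun {k : ℕ} (ρ : Fin k → ℝ) :
    Measurable fun z : (Fin k → ℝ) × (Fin k → ℝ) => ρ * z.1 * z.2 := by fun_prop

lemma measurable_sup_pi {k : ℕ} (ρ : Fin k → ℝ) : Measurable fun v : Fin k → ℝ => ρ ⊔ v :=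
  measurable_pi_iff.2 fun i => measurable_const.max (measurable_pi_apply i)

/-- The parameter is `ρ * z.1`, and multiplying it by standard uniforms `z.2` gives uniforms on the
boxes with that parameter. The rescaling needs a positive parameter, which holds almost surely
because `ρ ≤ l`. -/
lemma lintegral_pred {k : ℕ} {γ ρ : Fin k → ℝ} (hρ : ∀ i, 0 < ρ i)
    {h : (Fin k → ℝ) → ℝ≥0∞} (hh : Measurable h) :
    ∫⁻ v, h v ∂(pred γ ρ) = ∫⁻ l, ∫⁻ v, h v ∂(unifPi l) ∂(paretoPi γ ρ) := by
  rw [pred, lintegral_map hh (measurable_pred_fun ρ), lintegral_prod _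
    (hh.fun_comp (measurable_pred_fun ρ)).aemeasurable]
  have h1 : Measurable fun l : Fin k → ℝ => ∫⁻ ξ, h (l * ξ) ∂(unifPi 1) :=
    Measurable.lintegral_prod_right' (f := fun z : (Fin k → ℝ) × (Fin k → ℝ) => h (z.1 * z.2))
      (hh.comp (by fun_prop))
  have h2 : ∫⁻ l, ∫⁻ v, h v ∂(unifPi l) ∂(paretoPi γ ρ)
      = ∫⁻ l, ∫⁻ ξ, h (l * ξ) ∂(unifPi 1) ∂(paretoPi γ ρ) := by
    refine lintegral_congr_ae ?_
    filter_upwards [ae_paretoPi γ ρ] with l hl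
    rw [← map_mul_unifPi fun i => (hρ i).trans_le (hl i), lintegral_map hh (by fun_prop)]
  rw [h2, ← map_mul_paretoPi hρ, lintegral_map h1 (by fun_prop)]

/-- Disintegration of the joint law of the parameter and a disturbance: the disturbance has law
`pred`, and given its value the parameter again has independent Pareto distributions. -/
lemma lintegral_paretoPi_unifPi {k : ℕ} {γ ρ : Fin k → ℝ} (hγ : ∀ i, 0 < γ i) (hρ : ∀ i, 0 < ρ i)
    {g : (Fin k → ℝ) × (Fin k → ℝ) → ℝ≥0∞} (hg : Measurable g) :
    ∫⁻ l, ∫⁻ v, g (l, v) ∂(unifPi l) ∂(paretoPi γ ρ)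
      = ∫⁻ v, ∫⁻ l, g (l, v) ∂(paretoPi (γ + 1) (ρ ⊔ v)) ∂(pred γ ρ) := by
  let p : (Fin k → ℝ) → ℝ≥0∞ := fun l => ∏ i, paretoPDF (ρ i) (γ i) (l i)
  let u : (Fin k → ℝ) × (Fin k → ℝ) → ℝ≥0∞ :=
    fun z => ∏ i, ENNReal.ofReal (unifDensity (z.1 i) (z.2 i))
  let d : (Fin k → ℝ) → ℝ≥0∞ := fun v => ∏ i, predPDF (ρ i) (γ i) (v i)
  let p' : (Fin k → ℝ) → (Fin k → ℝ) → ℝ≥0∞ :=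
    fun v l => ∏ i, paretoPDF ((ρ ⊔ v) i) ((γ + 1) i) (l i)
  have hp : Measurable p := Finset.measurable_fun_prod _ fun i _ =>
    (measurable_paretoPDF _ _).comp (measurable_pi_apply i)
  have hp' : ∀ v, Measurable (p' v) := fun v => Finset.measurable_fun_prod _ fun i _ =>
    (measurable_paretoPDF _ _).comp (measurable_pi_apply i)
  have hd : Measurable d := Finset.measurable_fun_prod _ fun i _ =>
    (measurable_predPDF _ _).comp (measurable_pi_apply i)
  have hu : Measurable u := Finset.measurable_fun_prod _ fun i _ => by
    have : Measurable fun z : (Fin k → ℝ) × (Fin k → ℝ) => (z.1 i, z.2 i) := by fun_prop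
    exact (measurable_unifDensity₂.comp this).ennreal_ofReal
  have hu' : ∀ l, Measurable fun v => u (l, v) := fun l => hu.comp measurable_prodMk_left
  have hpu : ∀ l v, p l * u (l, v) = d v * p' v l := fun l v => by
    simp only [p, u, d, p', ← Finset.prod_mul_distrib]
    exact Finset.prod_congr rfl fun i _ => paretoPDF_mul_unifDensity (hρ i) (hγ i) _ _
  -- The statement is first proved with the density `d` in place of `pred`, by exchanging the
  -- integrals. Applied to functions of `v` alone it then identifies `pred` as the law with density
  -- `d`.
  have key : ∀ g : (Fin k → ℝ) × (Fin k → ℝ) → ℝ≥0∞, Measurable g →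
      ∫⁻ l, ∫⁻ v, g (l, v) ∂(unifPi l) ∂(paretoPi γ ρ)
      = ∫⁻ v, ∫⁻ l, g (l, v) ∂(paretoPi (γ + 1) (ρ ⊔ v)) ∂(volume.withDensity d) := by
    intro g hg
    have hgl : ∀ l, Measurable fun v => g (l, v) := fun l => hg.comp measurable_prodMk_left
    have hgv : ∀ v, Measurable fun l => g (l, v) := fun l => hg.comp measurable_prodMk_right
    have e1 : ∀ l, ∫⁻ v, g (l, v) ∂(unifPi l) = ∫⁻ v, u (l, v) * g (l, v) := fun l => by
      rw [unifPi_eq_withDensity, lintegral_withDensity_eq_lintegral_mul _ (hu' l) (hgl l)]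
      rfl
    have e2 : ∀ v, ∫⁻ l, g (l, v) ∂(paretoPi (γ + 1) (ρ ⊔ v)) = ∫⁻ l, p' v l * g (l, v) :=
      fun v => by
        rw [paretoPi_eq_withDensity, lintegral_withDensity_eq_lintegral_mul _ (hp' v) (hgv v)]
        rfl
    have m1 : Measurable fun l => ∫⁻ v, u (l, v) * g (l, v) :=
      Measurable.lintegral_prod_right' (f := fun z => u z * g z) (hu.mul hg)
    have m2 : Measurable fun v => ∫⁻ l, g (l, v) ∂(paretoPi (γ + 1) (ρ ⊔ v)) := by
      -- The measure varies with `v`; moving the scale `ρ ⊔ v` into the integrand leaves a fixed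
      -- measure, so measurability of parametric integrals applies.
      have : (fun v => ∫⁻ l, g (l, v) ∂(paretoPi (γ + 1) (ρ ⊔ v)))
          = fun v => ∫⁻ l, g ((ρ ⊔ v) * l, v) ∂(paretoPi (γ + 1) 1) := by
        ext v
        rw [← map_mul_paretoPi (ρ := ρ ⊔ v) fun i => lt_max_of_lt_left (hρ i),
          lintegral_map (hgv v) (by fun_prop)]
      rw [this]
      refine Measurable.lintegral_prod_right'
        (f := fun z : (Fin k → ℝ) × (Fin k → ℝ) => g ((ρ ⊔ z.1) * z.2, z.1)) (hg.comp ?_)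
      have : Measurable fun z : (Fin k → ℝ) × (Fin k → ℝ) => ρ ⊔ z.1 :=
        measurable_sup_pi ρ |>.comp measurable_fst
      exact (this.mul measurable_snd).prodMk measurable_fst
    rw [paretoPi_eq_withDensity γ ρ]
    simp only [e1]
    rw [lintegral_withDensity_eq_lintegral_mul _ hp m1,
      lintegral_withDensity_eq_lintegral_mul _ hd m2]
    calc ∫⁻ l, p l * ∫⁻ v, u (l, v) * g (l, v)
        = ∫⁻ l, ∫⁻ v, p l * u (l, v) * g (l, v) := by
          refine lintegral_congr fun l => ?_
          rw [← lintegral_const_mul _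
            (show Measurable fun v => u (l, v) * g (l, v) from (hu' l).mul (hgl l))]
          simp only [mul_assoc]
      _ = ∫⁻ v, ∫⁻ l, p l * u (l, v) * g (l, v) :=
          lintegral_lintegral_swap (((hp.comp measurable_fst).mul hu).mul hg).aemeasurable
      _ = ∫⁻ v, d v * ∫⁻ l, g (l, v) ∂(paretoPi (γ + 1) (ρ ⊔ v)) := by
          refine lintegral_congr fun v => ?_
          rw [e2, ← lintegral_const_mul _
            (show Measurable fun l => p' v l * g (l, v) from (hp' v).mul (hgv v))]
          simp only [hpu, mul_assoc]
  have hpred : pred γ ρ = volume.withDensity d := by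
    refine Measure.ext_of_lintegral _ fun h hh => ?_
    rw [lintegral_pred hρ hh]
    refine (key (fun z => h z.2) (hh.comp measurable_snd)).trans (lintegral_congr fun v => ?_)
    have : IsProbabilityMeasure (paretoPi (γ + 1) (ρ ⊔ v)) := isProbabilityMeasure_paretoPi
      (fun i => add_pos (hγ i) one_pos) fun i => lt_max_of_lt_left (hρ i)
    simp
  rw [hpred, key g hg]

lemma ae_pred {k : ℕ} {γ ρ : Fin k → ℝ} (hρ : ∀ i, 0 < ρ i) :
    ∀ᵐ v ∂(pred γ ρ), ∀ i, 0 ≤ v i := by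
  rw [pred, ae_map_iff (measurable_pred_fun ρ).aemeasurable
    (by
      simp only [Set.ofPred_forall]
      exact MeasurableSet.iInter fun i => measurableSet_le measurable_const (measurable_pi_apply i))]
  rw [Measure.ae_prod_iff_ae_ae (by
      simp only [Set.ofPred_forall]
      exact MeasurableSet.iInter fun i => measurableSet_le measurable_const
        ((measurable_pi_apply i).comp (measurable_pred_fun ρ)))]
  filter_upwards [ae_paretoPi γ 1] with l hl
  filter_upwards [ae_unifPi 1] with v hv i
  exact mul_nonneg (mul_nonneg (hρ i).le (zero_le_one.trans (hl i))) (hv i).1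

/-! ### The posterior -/

lemma scale_pos {k : ℕ} {r : Fin k → ℝ} (hr : ∀ i, 0 < r i) (v : ℕ → Fin k → ℝ) :
    ∀ n i, 0 < scale r v n i
  | 0, i => hr i
  | n + 1, i => lt_max_of_lt_left (scale_pos hr v n i)

lemma scale_succ {k : ℕ} (r : Fin k → ℝ) (v : ℕ → Fin k → ℝ) (n : ℕ) :
    scale r v (n + 1) = scale r v n ⊔ v n := rfl

lemma scale_congr {k : ℕ} (r : Fin k → ℝ) {v v' : ℕ → Fin k → ℝ} :
    ∀ {n : ℕ}, (∀ j < n, v j = v' j) → scale r v n = scale r v' n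
  | 0, _ => rfl
  | n + 1, h => by
    rw [scale_succ, scale_succ, scale_congr r fun j hj => h j (hj.trans n.lt_succ_self),
      h n n.lt_succ_self]

/-- Each observation multiplies the law by a predictive density, raises the scale to the maximum and
adds one to the shape. Only finiteness and nonvanishing of the constant matter, since it cancels on
normalization. -/
lemma paretoMeasure_withDensity_prod {k : ℕ} {r : Fin k → ℝ} (hr : ∀ i, 0 < r i)
    {β : Fin k → ℝ} (hβ : ∀ i, 0 < β i) {vs : ℕ → Fin k → ℝ} (hvs : ∀ j i, 0 ≤ vs j i) (n : ℕ)
    (i : Fin k) :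
    ∃ c : ℝ≥0∞, c ≠ 0 ∧ c ≠ ∞ ∧
      (paretoMeasure (r i) (β i)).withDensity
        (fun l => ∏ j ∈ Finset.range n, ENNReal.ofReal (unifDensity l (vs j i)))
        = c • paretoMeasure (scale r vs n i) (β i + n) := by
  induction n with
  | zero => exact ⟨1, one_ne_zero, ENNReal.one_ne_top, by simp [scale, withDensity_const]⟩
  | succ n ih =>
    obtain ⟨c, h0, h1, h2⟩ := ih
    have hpos : 0 < β i + n := by have := hβ i; positivity
    refine ⟨c * predPDF (scale r vs n i) (β i + n) (vs n i),
      mul_ne_zero h0 (predPDF_ne_zero (scale_pos hr vs n i) hpos (hvs n i)),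
      ENNReal.mul_ne_top h1 (predPDF_ne_top _ _ _), ?_⟩
    have hm : Measurable fun l => ∏ j ∈ Finset.range n, ENNReal.ofReal (unifDensity l (vs j i)) :=
      Finset.measurable_fun_prod _ fun j _ => measurable_unifDensity_left _
    simp only [Finset.prod_range_succ]
    have := withDensity_mul (paretoMeasure (r i) (β i)) hm (measurable_unifDensity_left (vs n i))
    refine this.trans ?_
    rw [h2, withDensity_smul_measure, paretoMeasure_withDensity_unif (scale_pos hr vs n i) hpos,
      smul_smul, Nat.cast_succ, ← add_assoc]
    rfl

namespace LinSystem

variable {m k : ℕ} (S : LinSystem m k)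

/-- The shape parameters `β_n = β + n` of the posterior. -/
def shape (n : ℕ) : Fin k → ℝ := fun i => S.β i + n

lemma shape_succ (n : ℕ) : S.shape (n + 1) = S.shape n + 1 := by
  ext i; simp [shape, add_assoc]

lemma shape_gt (hβ : ∀ i, 2 < S.β i) (n : ℕ) (i : Fin k) : 2 < S.shape n i := by
  have := hβ i
  have h : (0 : ℝ) ≤ n := n.cast_nonneg
  unfold shape; linarith

/-- Prior and likelihood both factor over the coordinates once the two products in the likelihood
are exchanged, so the one-dimensional computation applies; the total mass is the product of the
constants, which normalization removes. -/
lemma posterior_eq (hβ : ∀ i, 2 < S.β i) {r : Fin k → ℝ} (hr : ∀ i, 0 < r i) (n : ℕ)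
    {vs : ℕ → Fin k → ℝ} (hvs : ∀ j i, 0 ≤ vs j i) :
    S.posterior r n vs = paretoPi (S.shape n) (scale r vs n) := by
  have hβ0 : ∀ i, 0 < S.β i := fun i => two_pos.trans (hβ i)
  choose c h0 h1 h2 using paretoMeasure_withDensity_prod hr hβ0 hvs n
  have hp : ∀ i, IsProbabilityMeasure (paretoMeasure (scale r vs n i) (S.β i + n)) := fun i =>
    isProbabilityMeasure_paretoMeasure (scale_pos hr vs n i)
      (two_pos.trans (S.shape_gt hβ n i))
  have hfin : ∀ i, IsFiniteMeasure (c i • paretoMeasure (scale r vs n i) (S.β i + n)) :=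
    fun i => Measure.smul_finite _ (h1 i)
  have hσ : ∀ i, SigmaFinite ((paretoMeasure (r i) (S.β i)).withDensity
      (fun l => ∏ j ∈ Finset.range n, ENNReal.ofReal (unifDensity l (vs j i)))) := fun i => by
    rw [h2]; infer_instance
  have hwd : (S.prior r).withDensity (likelihood n vs)
      = (∏ i, c i) • paretoPi (S.shape n) (scale r vs n) := by
    have e : likelihood n vs = fun l : Fin k → ℝ => ∏ i, ∏ j ∈ Finset.range n,
        ENNReal.ofReal (unifDensity (l i) (vs j i)) := by
      ext l; exact Finset.prod_comm
    rw [prior, e, ← pi_withDensity (fun i => paretoMeasure (r i) (S.β i))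
      (fun i l => ∏ j ∈ Finset.range n, ENNReal.ofReal (unifDensity l (vs j i)))
      fun i => Finset.measurable_fun_prod _ fun j _ => measurable_unifDensity_left _]
    simp only [h2]
    exact pi_smul_prob _ c h1
  have hprob := isProbabilityMeasure_paretoPi (fun i => two_pos.trans (S.shape_gt hβ n i))
    (scale_pos hr vs n)
  have hZ : ∫⁻ l, likelihood n vs l ∂(S.prior r) = ∏ i, c i := by
    rw [← setLIntegral_univ, ← withDensity_apply _ MeasurableSet.univ, hwd]
    simp
  rw [posterior, hZ, hwd, smul_smul, ENNReal.inv_mul_cancel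
    (Finset.prod_ne_zero_iff.2 fun i _ => h0 i) (ENNReal.prod_ne_top fun i _ => h1 i), one_smul]

/-! ### The joint law of the parameter and all disturbances -/

lemma disturbLaw_eq (l : Fin k → ℝ) : S.disturbLaw l = Measure.pi fun _ => unifPi l := rfl

lemma isProbabilityMeasure_disturbLaw {l : Fin k → ℝ} (hl : ∀ i, 0 < l i) :
    IsProbabilityMeasure (S.disturbLaw l) := by
  have := isProbabilityMeasure_unifPi hl
  rw [disturbLaw_eq]; infer_instance

instance : IsProbabilityMeasure (S.disturbLaw 1) :=
  S.isProbabilityMeasure_disturbLaw fun _ => one_pos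

lemma map_mul_disturbLaw {l : Fin k → ℝ} (hl : ∀ i, 0 < l i) :
    Measure.map (fun (ξ : Fin S.M → Fin k → ℝ) j => l * ξ j) (S.disturbLaw 1)
      = S.disturbLaw l := by
  have hσ : ∀ _ : Fin S.M, SigmaFinite (Measure.map (fun x => l * x) (unifPi 1)) := fun i => by
    rw [map_mul_unifPi hl]; infer_instance
  have := Measure.pi_map_pi (μ := fun _ : Fin S.M => unifPi (1 : Fin k → ℝ))
    (f := fun _ x => l * x) fun i => (measurable_const_mul _).aemeasurable
  simp only [map_mul_unifPi hl] at this
  exact this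

/-- The joint law of the parameter, which follows `paretoPi γ ρ`, and the disturbances. -/
def joint (γ ρ : Fin k → ℝ) : Measure ((Fin k → ℝ) × (Fin S.M → Fin k → ℝ)) :=
  Measure.map (fun z => (ρ * z.1, fun j => ρ * z.1 * z.2 j))
    ((paretoPi γ 1).prod (S.disturbLaw 1))

lemma measurable_joint_fun : Measurable fun z : (Fin k → ℝ) ×
    ((Fin k → ℝ) × (Fin S.M → Fin k → ℝ)) => (z.1 * z.2.1, fun j => z.1 * z.2.1 * z.2.2 j) := by
  fun_prop

lemma measurable_joint_fun' (ρ : Fin k → ℝ) :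
    Measurable fun z : (Fin k → ℝ) × (Fin S.M → Fin k → ℝ) =>
      (ρ * z.1, fun j => ρ * z.1 * z.2 j) := by
  fun_prop

/-- Writing the disturbances as `l` times standard uniforms turns the iterated integral, whose inner
measure varies with `l`, into an integral over one fixed product measure, where Tonelli's theorem
holds. -/
lemma lintegral_joint {γ ρ : Fin k → ℝ} (hρ : ∀ i, 0 < ρ i)
    {F : (Fin k → ℝ) × (Fin S.M → Fin k → ℝ) → ℝ≥0∞} (hF : Measurable F) :
    ∫⁻ z, F z ∂(S.joint γ ρ) = ∫⁻ l, ∫⁻ w, F (l, w) ∂(S.disturbLaw l) ∂(paretoPi γ ρ) := by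
  rw [joint, lintegral_map hF (S.measurable_joint_fun' ρ), lintegral_prod _
    (hF.fun_comp (S.measurable_joint_fun' ρ)).aemeasurable]
  have h1 : Measurable fun l : Fin k → ℝ => ∫⁻ ξ, F (l, fun j => l * ξ j) ∂(S.disturbLaw 1) :=
    Measurable.lintegral_prod_right' (f := fun z : (Fin k → ℝ) × (Fin S.M → Fin k → ℝ) =>
      F (z.1, fun j => z.1 * z.2 j)) (hF.comp (by fun_prop))
  have h2 : ∫⁻ l, ∫⁻ w, F (l, w) ∂(S.disturbLaw l) ∂(paretoPi γ ρ)
      = ∫⁻ l, ∫⁻ ξ, F (l, fun j => l * ξ j) ∂(S.disturbLaw 1) ∂(paretoPi γ ρ) := by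
    refine lintegral_congr_ae ?_
    filter_upwards [ae_paretoPi γ ρ] with l hl
    rw [← S.map_mul_disturbLaw fun i => (hρ i).trans_le (hl i),
      lintegral_map (hF.fun_comp measurable_prodMk_left) (by fun_prop)]
  rw [h2, ← map_mul_paretoPi hρ, lintegral_map h1 (by fun_prop)]

lemma ae_joint_iff {γ ρ : Fin k → ℝ} (hρ : ∀ i, 0 < ρ i)
    {p : (Fin k → ℝ) × (Fin S.M → Fin k → ℝ) → Prop} (hp : MeasurableSet {z | p z}) :
    (∀ᵐ z ∂(S.joint γ ρ), p z) ↔ ∀ᵐ l ∂(paretoPi γ ρ), ∀ᵐ w ∂(S.disturbLaw l), p (l, w) := by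
  rw [joint, ae_map_iff (S.measurable_joint_fun' ρ).aemeasurable hp,
    Measure.ae_prod_iff_ae_ae (p := fun z : (Fin k → ℝ) × (Fin S.M → Fin k → ℝ) =>
      p (ρ * z.1, fun j => ρ * z.1 * z.2 j))
      (S.measurable_joint_fun' ρ hp)]
  have h2 : (∀ᵐ l ∂(paretoPi γ ρ), ∀ᵐ w ∂(S.disturbLaw l), p (l, w))
      ↔ ∀ᵐ l ∂(paretoPi γ ρ), ∀ᵐ ξ ∂(S.disturbLaw 1), p (l, fun j => l * ξ j) := by
    refine Filter.eventually_congr ?_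
    filter_upwards [ae_paretoPi γ ρ] with l hl
    rw [← S.map_mul_disturbLaw fun i => (hρ i).trans_le (hl i),
      ae_map_iff (p := fun w => p (l, w)) (by fun_prop : Measurable _).aemeasurable
        (measurable_prodMk_left hp)]
  have hm : Measurable fun z : (Fin k → ℝ) × (Fin S.M → Fin k → ℝ) =>
      (z.1, fun j => z.1 * z.2 j) := by fun_prop
  have h3 : MeasurableSet {l : Fin k → ℝ | ∀ᵐ ξ ∂(S.disturbLaw 1), p (l, fun j => l * ξ j)} := by
    have := measurable_measure_prodMk_left (ν := S.disturbLaw 1) (hm hp).compl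
    exact this (measurableSet_singleton 0)
  rw [h2, ← map_mul_paretoPi hρ, ae_map_iff (by fun_prop : Measurable _).aemeasurable h3]

/-- Pulled back to the product law with scale 1, the dependence on `ρ x` is only in the integrand.
-/
lemma measurable_lintegral_joint {X : Type*} [MeasurableSpace X] (γ : Fin k → ℝ)
    {ρ : X → Fin k → ℝ} (hρ : Measurable ρ)
    {F : X × ((Fin k → ℝ) × (Fin S.M → Fin k → ℝ)) → ℝ≥0∞} (hF : Measurable F) :
    Measurable fun x => ∫⁻ z, F (x, z) ∂(S.joint γ (ρ x)) := by
  have : (fun x => ∫⁻ z, F (x, z) ∂(S.joint γ (ρ x)))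
      = fun x => ∫⁻ z, F (x, (ρ x * z.1, fun j => ρ x * z.1 * z.2 j))
        ∂((paretoPi γ 1).prod (S.disturbLaw 1)) := by
    ext x
    rw [joint, lintegral_map (hF.fun_comp measurable_prodMk_left) (S.measurable_joint_fun' _)]
  rw [this]
  refine Measurable.lintegral_prod_right'
    (f := fun y : X × ((Fin k → ℝ) × (Fin S.M → Fin k → ℝ)) =>
      F (y.1, (ρ y.1 * y.2.1, fun j => ρ y.1 * y.2.1 * y.2.2 j))) (hF.comp ?_)
  exact measurable_fst.prodMk (S.measurable_joint_fun.comp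
    ((hρ.comp measurable_fst).prodMk measurable_snd))

lemma isProbabilityMeasure_joint {γ : Fin k → ℝ} (hγ : ∀ i, 0 < γ i) (ρ : Fin k → ℝ) :
    IsProbabilityMeasure (S.joint γ ρ) := by
  have := isProbabilityMeasure_paretoPi hγ (ρ := 1) fun _ => one_pos
  exact Measure.isProbabilityMeasure_map (S.measurable_joint_fun' ρ).aemeasurable

lemma measurable_update_prod (n : Fin S.M) :
    Measurable fun z : (Fin k → ℝ) × (Fin S.M → Fin k → ℝ) => Function.update z.2 n z.1 := by
  refine measurable_pi_iff.2 fun j => ?_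
  by_cases h : j = n
  · subst h; simpa using measurable_fst
  · simp only [Function.update_of_ne h]
    exact (measurable_pi_apply j).comp measurable_snd

/-- The disturbance at time `n` is independent of the others. -/
lemma lintegral_disturbLaw_update {l : Fin k → ℝ} (hl : ∀ i, 0 < l i) (n : Fin S.M)
    {F : (Fin S.M → Fin k → ℝ) → ℝ≥0∞} (hF : Measurable F) :
    ∫⁻ w, F w ∂(S.disturbLaw l)
      = ∫⁻ v, ∫⁻ w, F (Function.update w n v) ∂(S.disturbLaw l) ∂(unifPi l) := by
  have hu := isProbabilityMeasure_unifPi hl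
  have hd := S.isProbabilityMeasure_disturbLaw hl
  have hm := S.measurable_update_prod n
  have e : S.disturbLaw l = Measure.map (fun z : (Fin k → ℝ) × (Fin S.M → Fin k → ℝ) =>
      Function.update z.2 n z.1) ((unifPi l).prod (S.disturbLaw l)) := by
    rw [disturbLaw_eq]
    refine Measure.pi_eq fun s hs => ?_
    rw [Measure.map_apply hm (MeasurableSet.univ_pi hs)]
    -- The overwritten coordinate of `z.2` is unconstrained, so it contributes a factor `Set.univ`
    -- of mass one.
    have : (fun z : (Fin k → ℝ) × (Fin S.M → Fin k → ℝ) => Function.update z.2 n z.1) ⁻¹'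
        (Set.univ.pi s) = s n ×ˢ (Set.univ.pi (Function.update s n Set.univ)) := by
      ext z
      simp only [Set.mem_preimage, Set.mem_univ_pi, Set.mem_prod]
      constructor
      · intro h
        refine ⟨by simpa using h n, fun i => ?_⟩
        by_cases hi : i = n
        · subst hi; simp
        · simpa [Function.update_of_ne hi] using h i
      · rintro ⟨h1, h2⟩ i
        by_cases hi : i = n
        · subst hi; simpa using h1
        · simpa [Function.update_of_ne hi] using h2 i
    rw [this, Measure.prod_prod, Measure.pi_pi, ← Finset.mul_prod_erase _ _ (Finset.mem_univ n),
      ← Finset.mul_prod_erase Finset.univ (fun i => unifPi l (s i)) (Finset.mem_univ n)]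
    simp only [Function.update_self, measure_univ, one_mul]
    congr 1
    refine Finset.prod_congr rfl fun i hi => ?_
    rw [Function.update_of_ne (Finset.ne_of_mem_erase hi)]
  conv_lhs => rw [e]
  rw [lintegral_map hF hm, lintegral_prod _ (hF.fun_comp hm).aemeasurable]

/-- The joint law of the parameter and the disturbances, disintegrated with respect to the
disturbance at time `n`. -/
lemma lintegral_joint_eq {γ ρ : Fin k → ℝ} (hγ : ∀ i, 0 < γ i) (hρ : ∀ i, 0 < ρ i) (n : Fin S.M)
    {F : (Fin k → ℝ) × (Fin S.M → Fin k → ℝ) → ℝ≥0∞} (hF : Measurable F) :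
    ∫⁻ z, F z ∂(S.joint γ ρ) = ∫⁻ v, ∫⁻ z, F (z.1, Function.update z.2 n v)
      ∂(S.joint (γ + 1) (ρ ⊔ v)) ∂(pred γ ρ) := by
  have hm := S.measurable_update_prod (k := k) n
  have hFu : ∀ v : Fin k → ℝ, Measurable fun z : (Fin k → ℝ) × (Fin S.M → Fin k → ℝ) =>
      F (z.1, Function.update z.2 n v) := fun v => hF.comp
    (measurable_fst.prodMk (hm.comp (measurable_const.prodMk measurable_snd)))
  -- The average over the other disturbances, in rescaled form so that it is jointly measurable in
  -- the parameter and the disturbance at time `n`.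
  let g : (Fin k → ℝ) × (Fin k → ℝ) → ℝ≥0∞ := fun z =>
    ∫⁻ ξ, F (z.1, Function.update (fun j => z.1 * ξ j) n z.2) ∂(S.disturbLaw 1)
  have hg : Measurable g := by
    refine Measurable.lintegral_prod_right'
      (f := fun y : ((Fin k → ℝ) × (Fin k → ℝ)) × (Fin S.M → Fin k → ℝ) =>
        F (y.1.1, Function.update (fun j => y.1.1 * y.2 j) n y.1.2)) (hF.comp ?_)
    refine (by fun_prop : Measurable _).prodMk (hm.comp ((by fun_prop : Measurable _).prodMk ?_))
    fun_prop
  have hgl : ∀ l v : Fin k → ℝ, (∀ i, 0 < l i) →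
      ∫⁻ w, F (l, Function.update w n v) ∂(S.disturbLaw l) = g (l, v) := fun l v hl => by
    rw [← S.map_mul_disturbLaw hl, lintegral_map ((hFu v).fun_comp measurable_prodMk_left)
      (by fun_prop)]
  rw [S.lintegral_joint hρ hF]
  calc ∫⁻ l, ∫⁻ w, F (l, w) ∂(S.disturbLaw l) ∂(paretoPi γ ρ)
      = ∫⁻ l, ∫⁻ v, g (l, v) ∂(unifPi l) ∂(paretoPi γ ρ) := by
        refine lintegral_congr_ae ?_
        filter_upwards [ae_paretoPi γ ρ] with l hl
        have hl' : ∀ i, 0 < l i := fun i => (hρ i).trans_le (hl i)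
        rw [S.lintegral_disturbLaw_update hl' n (hF.fun_comp measurable_prodMk_left)]
        exact lintegral_congr fun v => hgl l v hl'
    _ = ∫⁻ v, ∫⁻ l, g (l, v) ∂(paretoPi (γ + 1) (ρ ⊔ v)) ∂(pred γ ρ) :=
        lintegral_paretoPi_unifPi hγ hρ hg
    _ = _ := by
        refine lintegral_congr fun v => ?_
        have hρ' : ∀ i, 0 < (ρ ⊔ v) i := fun i => lt_max_of_lt_left (hρ i)
        rw [S.lintegral_joint hρ' (hFu v)]
        refine lintegral_congr_ae ?_
        filter_upwards [ae_paretoPi (γ + 1) (ρ ⊔ v)] with l hl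
        exact (hgl l v fun i => (hρ' i).trans_le (hl i)).symm

/-- The disintegration of integrals is applied to the indicator of the exceptional set: a
nonnegative function vanishes almost everywhere exactly when its integral is zero. -/
lemma ae_joint_iff_ae_pred {γ ρ : Fin k → ℝ} (hγ : ∀ i, 0 < γ i) (hρ : ∀ i, 0 < ρ i)
    (n : Fin S.M) {p : (Fin k → ℝ) × (Fin S.M → Fin k → ℝ) → Prop} (hp : MeasurableSet {z | p z}) :
    (∀ᵐ z ∂(S.joint γ ρ), p z) ↔ ∀ᵐ v ∂(pred γ ρ), ∀ᵐ z ∂(S.joint (γ + 1) (ρ ⊔ v)),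
      p (z.1, Function.update z.2 n v) := by
  have hm : Measurable fun y : (Fin k → ℝ) × ((Fin k → ℝ) × (Fin S.M → Fin k → ℝ)) =>
      (y.2.1, Function.update y.2.2 n y.1) :=
    (measurable_fst.comp measurable_snd).prodMk ((S.measurable_update_prod n).comp
      (measurable_fst.prodMk (measurable_snd.comp measurable_snd)))
  let F : (Fin k → ℝ) × (Fin S.M → Fin k → ℝ) → ℝ≥0∞ := {z | ¬ p z}.indicator 1
  have hF : Measurable F := measurable_one.indicator hp.compl
  have h0 : ∀ z, F z = 0 ↔ p z := fun z => by simp [F]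
  have h1 : (∀ᵐ z ∂(S.joint γ ρ), p z) ↔ ∫⁻ z, F z ∂(S.joint γ ρ) = 0 := by
    rw [lintegral_eq_zero_iff hF]
    exact Filter.eventually_congr (Filter.Eventually.of_forall fun z => (h0 z).symm)
  have hmeas : Measurable fun v => ∫⁻ z, F (z.1, Function.update z.2 n v)
      ∂(S.joint (γ + 1) (ρ ⊔ v)) :=
    S.measurable_lintegral_joint (γ + 1) (measurable_sup_pi ρ) (hF.comp hm)
  rw [h1, S.lintegral_joint_eq hγ hρ n hF, lintegral_eq_zero_iff hmeas]
  refine Filter.eventually_congr (Filter.Eventually.of_forall fun v => ?_)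
  simp only [Pi.zero_apply]
  rw [lintegral_eq_zero_iff (hF.fun_comp (hm.fun_comp measurable_prodMk_left))]
  exact Filter.eventually_congr (Filter.Eventually.of_forall fun z => h0 _)

end LinSystem
end

/-! ### Trajectories -/

lemma pad_add {k : ℕ} (m : ℕ) (v w : Fin k → ℝ) : pad m (v + w) = pad m v + pad m w := by
  ext i; unfold pad; by_cases h : i.val < k <;> simp [h]

lemma pad_smul {k : ℕ} (m : ℕ) (c : ℝ) (v : Fin k → ℝ) : pad m (c • v) = c • pad m v := by
  ext i; unfold pad; by_cases h : i.val < k <;> simp [h]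

lemma pad_mul {k : ℕ} (m : ℕ) (v w : Fin k → ℝ) (i : Fin m) :
    pad m (v * w) i = pad m v i * pad m w i := by
  unfold pad; by_cases h : i.val < k <;> simp [h]

lemma diagonal_pad_mulVec {k : ℕ} (m : ℕ) (q v : Fin k → ℝ) :
    Matrix.diagonal (pad m q) *ᵥ pad m v = pad m (q * v) := by
  ext i; rw [mulVec_diagonal, pad_mul]

lemma measurable_pad {k : ℕ} (m : ℕ) : Measurable (pad m : (Fin k → ℝ) → Fin m → ℝ) := by
  refine measurable_pi_iff.2 fun i => ?_
  unfold pad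
  by_cases h : i.val < k
  · simpa [h] using measurable_pi_apply _
  · simp [h]

lemma measurable_mulVec {ι κ : Type*} [Fintype ι] [Fintype κ] (A : Matrix ι κ ℝ) :
    Measurable fun x : κ → ℝ => A *ᵥ x :=
  (Continuous.matrix_mulVec continuous_const continuous_id).measurable

lemma measurable_dotProduct {ι X : Type*} [Fintype ι] [MeasurableSpace X] {f g : X → ι → ℝ}
    (hf : Measurable f) (hg : Measurable g) : Measurable fun x => f x ⬝ᵥ g x :=
  Finset.measurable_fun_sum _ fun i _ =>
    ((measurable_pi_apply i).comp hf).mul ((measurable_pi_apply i).comp hg)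

lemma measurable_snoc {n : ℕ} {X α : Type*} [MeasurableSpace X] [MeasurableSpace α]
    {f : X → Fin n → α} {g : X → α} (hf : Measurable f) (hg : Measurable g) :
    Measurable fun x => (Fin.snoc (α := fun _ => α) (f x) (g x) : Fin (n + 1) → α) := by
  refine measurable_pi_iff.2 fun i => ?_
  refine Fin.lastCases ?_ (fun j => ?_) i
  · simpa using hg
  · simpa using (measurable_pi_apply j).fun_comp hf

lemma Policy.IsAdmissible.withPast {m : ℕ} {U : Policy m} (hU : U.IsAdmissible) (n : ℕ)
    (us : ℕ → Fin m → ℝ) : (U.withPast n us).IsAdmissible := by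
  intro i
  unfold Policy.withPast
  by_cases h : i < n
  · simp [h]
  · simpa [h] using hU i

lemma measurable_scale {k : ℕ} (r : Fin k → ℝ) (n : ℕ) :
    Measurable fun v : ℕ → Fin k → ℝ => scale r v n := by
  induction n with
  | zero => exact measurable_const
  | succ n ih =>
    refine measurable_pi_iff.2 fun i => ?_
    exact ((measurable_pi_apply i).comp ih).max
      ((measurable_pi_apply i).comp (measurable_pi_apply n))

namespace LinSystem

variable {m k : ℕ} (S : LinSystem m k)

lemma measurable_path {U : Policy m} (hU : U.IsAdmissible) (x0 : Fin m → ℝ) (n : ℕ) :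
    Measurable fun v : ℕ → Fin k → ℝ => S.path U x0 v n := by
  induction n with
  | zero => exact measurable_const
  | succ n ih =>
    have h1 : Measurable fun v : ℕ → Fin k → ℝ => U n (S.path U x0 v n) := (hU n).comp ih
    have h2 : Measurable fun v : ℕ → Fin k → ℝ => (S.path U x0 v n).1 (Fin.last n) :=
      (measurable_pi_apply _).comp (measurable_fst.comp ih)
    refine (measurable_snoc (measurable_fst.comp ih) ?_).prodMk
      (measurable_snoc (measurable_snd.comp ih) h1)
    exact (((measurable_mulVec (S.α n)).comp h2).add ((measurable_mulVec (S.b n)).comp h1)).add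
      ((measurable_mulVec (S.c n)).comp ((measurable_pad m).comp (measurable_pi_apply n)))

lemma measurable_state {U : Policy m} (hU : U.IsAdmissible) (x0 : Fin m → ℝ) (n : ℕ) :
    Measurable fun v : ℕ → Fin k → ℝ => S.state U x0 v n :=
  (measurable_pi_apply _).comp (measurable_fst.comp (S.measurable_path hU x0 n))

lemma measurable_control {U : Policy m} (hU : U.IsAdmissible) (x0 : Fin m → ℝ) (n : ℕ) :
    Measurable fun v : ℕ → Fin k → ℝ => S.control U x0 v n :=
  (hU n).comp (S.measurable_path hU x0 n)

lemma measurable_stageCost {U : Policy m} (hU : U.IsAdmissible) (x0 : Fin m → ℝ) (n : ℕ) :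
    Measurable fun z : (Fin k → ℝ) × (ℕ → Fin k → ℝ) => S.stageCost U x0 z.1 z.2 n := by
  have hx := (S.measurable_state hU x0 n).comp
    (measurable_snd : Measurable fun z : (Fin k → ℝ) × (ℕ → Fin k → ℝ) => z.2)
  have hu := (S.measurable_control hU x0 n).comp
    (measurable_snd : Measurable fun z : (Fin k → ℝ) × (ℕ → Fin k → ℝ) => z.2)
  have hl := (measurable_pad (k := k) m).comp
    (measurable_fst : Measurable fun z : (Fin k → ℝ) × (ℕ → Fin k → ℝ) => z.1)
  have hy : Measurable fun z : (Fin k → ℝ) × (ℕ → Fin k → ℝ) =>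
      (Sum.elim (S.state U x0 z.2 n) (pad m z.1) : Fin m ⊕ Fin m → ℝ) := by
    refine measurable_pi_iff.2 fun i => ?_
    rcases i with i | i
    · exact (measurable_pi_apply i).comp hx
    · exact (measurable_pi_apply i).comp hl
  exact (measurable_dotProduct hy ((measurable_mulVec _).comp hy)).add
    (measurable_dotProduct hu ((measurable_mulVec _).comp hu))

lemma measurable_splice (n : ℕ) (vs : ℕ → Fin k → ℝ) :
    Measurable fun w : Fin S.M → Fin k → ℝ => S.splice n vs w := by
  refine measurable_pi_iff.2 fun j => ?_
  unfold splice
  by_cases h : j < n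
  · simp [h]
  · by_cases h' : j < S.M
    · simpa [h, h'] using measurable_pi_apply _
    · simp [h, h']

lemma measurableSet_solves (A B : ℕ → Matrix (Fin m) (Fin m) ℝ) (r : Fin k → ℝ) (x0 : Fin m → ℝ)
    {U : Policy m} (hU : U.IsAdmissible) (n : ℕ) :
    MeasurableSet {v : ℕ → Fin k → ℝ | S.Solves A B r x0 U v n} := by
  refine measurableSet_eq_fun ((measurable_mulVec _).comp (S.measurable_control hU x0 n)) ?_
  have h1 := (measurable_mulVec (A (n + 1) * S.α n)).comp (S.measurable_state hU x0 n)
  have h2 := (measurable_mulVec (A (n + 1) * S.c n * S.Q n + B (n + 1) * S.Q₂ n)).comp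
    ((measurable_pad m).comp (measurable_scale r n))
  have h3 : Measurable fun v : ℕ → Fin k → ℝ => (S.b n)ᵀ *ᵥ
      ((A (n + 1) * S.α n) *ᵥ S.state U x0 v n
        + (A (n + 1) * S.c n * S.Q n + B (n + 1) * S.Q₂ n) *ᵥ pad m (scale r v n)) :=
    (measurable_mulVec (S.b n)ᵀ).comp (h1.add h2)
  exact (h3.const_smul (S.φ (n + 1) / S.φ n)).neg

/-! ### Recursion for trajectories and restarting one step later. -/

lemma path_succ (U : Policy m) (x0 : Fin m → ℝ) (v : ℕ → Fin k → ℝ) (n : ℕ) :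
    S.path U x0 v (n + 1) =
      (Fin.snoc (α := fun _ => Fin m → ℝ) (S.path U x0 v n).1
        (S.α n *ᵥ S.state U x0 v n + S.b n *ᵥ S.control U x0 v n + S.c n *ᵥ pad m (v n)),
       Fin.snoc (α := fun _ => Fin m → ℝ) (S.path U x0 v n).2 (S.control U x0 v n)) := rfl

lemma state_succ (U : Policy m) (x0 : Fin m → ℝ) (v : ℕ → Fin k → ℝ) (n : ℕ) :
    S.state U x0 v (n + 1) =
      S.α n *ᵥ S.state U x0 v n + S.b n *ᵥ S.control U x0 v n + S.c n *ᵥ pad m (v n) := by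
  conv_lhs => rw [state, path_succ]
  simp

/-- The policies are compared only along the two trajectories, and only where the histories already
coincide; this suffices for the induction and lets fixed past controls be exchanged between
policies. -/
lemma path_congr {U U' : Policy m} (x0 : Fin m → ℝ) {v v' : ℕ → Fin k → ℝ} {n : ℕ}
    (hv : ∀ i < n, v i = v' i)
    (hU : ∀ i < n, S.path U x0 v i = S.path U' x0 v' i →
      U i (S.path U x0 v i) = U' i (S.path U' x0 v' i)) :
    S.path U x0 v n = S.path U' x0 v' n := by
  induction n with
  | zero => rfl
  | succ n ih =>
    have ih : S.path U x0 v n = S.path U' x0 v' n :=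
      ih (fun i hi => hv i (hi.trans n.lt_succ_self)) fun i hi => hU i (hi.trans n.lt_succ_self)
    have hc : S.control U x0 v n = S.control U' x0 v' n := hU n n.lt_succ_self ih
    have hs : S.state U x0 v n = S.state U' x0 v' n := by rw [state, state, ih]
    rw [path_succ, path_succ, hc, hs, ih, hv n n.lt_succ_self]

lemma path_withPast_splice (U : Policy m) (x0 : Fin m → ℝ) (n : ℕ) (us : ℕ → Fin m → ℝ)
    (vs : ℕ → Fin k → ℝ) (w : Fin S.M → Fin k → ℝ) :
    S.path (U.withPast n us) x0 (S.splice n vs w) n = S.path (.openLoop us) x0 vs n :=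
  S.path_congr x0 (fun i hi => by simp [splice, hi]) fun i hi _ => by
    simp [Policy.withPast, Policy.openLoop, hi]

/-- The control that `U` chooses at time `n` after the history given by `us` and `vs`. -/
def nextControl (U : Policy m) (x0 : Fin m → ℝ) (n : ℕ) (us : ℕ → Fin m → ℝ)
    (vs : ℕ → Fin k → ℝ) : Fin m → ℝ :=
  U n (S.path (.openLoop us) x0 vs n)

/-- Revealing the disturbance at time `n` moves it from the random future into the fixed past. -/
lemma splice_update {n : ℕ} (hn : n < S.M) (vs : ℕ → Fin k → ℝ) (w : Fin S.M → Fin k → ℝ)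
    (v : Fin k → ℝ) :
    S.splice n vs (Function.update w ⟨n, hn⟩ v) = S.splice (n + 1) (Function.update vs n v) w := by
  ext1 j
  unfold splice
  rcases lt_trichotomy j n with h | h | h
  · rw [if_pos h, if_pos (by omega), Function.update_of_ne h.ne]
  · subst h
    simp [hn]
  · rw [if_neg (by omega), if_neg (by omega)]
    by_cases hj : j < S.M
    · rw [dif_pos hj, dif_pos hj, Function.update_of_ne]
      exact fun e => h.ne' (congrArg Fin.val e)
    · rw [dif_neg hj, dif_neg hj]

/-- Dynamic programming at the level of trajectories: once `u_n` and `v_n` are known, the problem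
truncated at `n` becomes the one truncated at `n + 1` with the history prolonged by them. -/
lemma path_withPast_succ (U : Policy m) (x0 : Fin m → ℝ) {n : ℕ} (hn : n < S.M)
    (us : ℕ → Fin m → ℝ) (vs : ℕ → Fin k → ℝ) (w : Fin S.M → Fin k → ℝ) (v : Fin k → ℝ) (i : ℕ) :
    S.path (U.withPast n us) x0 (S.splice n vs (Function.update w ⟨n, hn⟩ v)) i
      = S.path (U.withPast (n + 1) (Function.update us n (S.nextControl U x0 n us vs))) x0
        (S.splice (n + 1) (Function.update vs n v) w) i := by
  refine S.path_congr x0 (fun j _ => by rw [splice_update]) fun j _ hj => ?_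
  rw [← hj]
  unfold Policy.withPast
  rcases lt_trichotomy j n with h | h | h
  · rw [if_pos h, if_pos (by omega), Function.update_of_ne h.ne]
  · subst h
    rw [if_neg (lt_irrefl _), if_pos (Nat.lt_succ_self _), Function.update_self, nextControl]
    exact congrArg _ (S.path_withPast_splice U x0 j us vs _)
  · rw [if_neg (by omega), if_neg (by omega)]

lemma control_withPast_succ (U : Policy m) (x0 : Fin m → ℝ) {n : ℕ} (hn : n < S.M)
    (us : ℕ → Fin m → ℝ) (vs : ℕ → Fin k → ℝ) (w : Fin S.M → Fin k → ℝ) (v : Fin k → ℝ) {i : ℕ}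
    (hi : n < i) :
    S.control (U.withPast n us) x0 (S.splice n vs (Function.update w ⟨n, hn⟩ v)) i
      = S.control (U.withPast (n + 1) (Function.update us n (S.nextControl U x0 n us vs))) x0
        (S.splice (n + 1) (Function.update vs n v) w) i := by
  unfold control
  rw [path_withPast_succ]
  unfold Policy.withPast
  rw [if_neg (by omega), if_neg (by omega)]

lemma state_withPast_succ (U : Policy m) (x0 : Fin m → ℝ) {n : ℕ} (hn : n < S.M)
    (us : ℕ → Fin m → ℝ) (vs : ℕ → Fin k → ℝ) (w : Fin S.M → Fin k → ℝ) (v : Fin k → ℝ) (i : ℕ) :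
    S.state (U.withPast n us) x0 (S.splice n vs (Function.update w ⟨n, hn⟩ v)) i
      = S.state (U.withPast (n + 1) (Function.update us n (S.nextControl U x0 n us vs))) x0
        (S.splice (n + 1) (Function.update vs n v) w) i := by
  unfold state
  rw [path_withPast_succ]

lemma state_openLoop_update (x0 : Fin m → ℝ) (n : ℕ) (us : ℕ → Fin m → ℝ) (vs : ℕ → Fin k → ℝ)
    (u : Fin m → ℝ) (v : Fin k → ℝ) :
    S.state (.openLoop (Function.update us n u)) x0 (Function.update vs n v) (n + 1)
      = S.α n *ᵥ S.state (.openLoop us) x0 vs n + S.b n *ᵥ u + S.c n *ᵥ pad m v := by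
  have h : S.path (.openLoop (Function.update us n u)) x0 (Function.update vs n v) n
      = S.path (.openLoop us) x0 vs n :=
    S.path_congr x0 (fun i hi => Function.update_of_ne hi.ne _ _) fun i hi _ =>
      Function.update_of_ne hi.ne _ _
  rw [state_succ, control, Policy.openLoop, Function.update_self, Function.update_self]
  congr 3
  exact congrArg (fun p => p.1 (Fin.last n)) h

lemma scale_update (r : Fin k → ℝ) (n : ℕ) (vs : ℕ → Fin k → ℝ) (v : Fin k → ℝ) :
    scale r (Function.update vs n v) (n + 1) = scale r vs n ⊔ v := by
  rw [scale_succ, Function.update_self,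
    scale_congr r fun j hj => Function.update_of_ne (Nat.ne_of_lt hj) _ _]

/-- The disturbances, and hence the posterior parameters `r_n`, are functions of the history. -/
lemma exists_scale_of_history (hc : ∀ n < S.M, Function.Injective fun v : Fin k → ℝ =>
    S.c n *ᵥ pad m v) (r : Fin k → ℝ) :
    ∃ R : (n : ℕ) → (Fin (n + 1) → Fin m → ℝ) × (Fin n → Fin m → ℝ) → Fin k → ℝ,
      (∀ n, Measurable (R n)) ∧
      ∀ n ≤ S.M, ∀ (U : Policy m) (x0 : Fin m → ℝ) (v : ℕ → Fin k → ℝ),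
        R n (S.path U x0 v n) = scale r v n := by
  suffices h : ∀ n, ∃ R : (Fin (n + 1) → Fin m → ℝ) × (Fin n → Fin m → ℝ) → Fin k → ℝ,
      Measurable R ∧ (n ≤ S.M → ∀ (U : Policy m) (x0 : Fin m → ℝ) (v : ℕ → Fin k → ℝ),
        R (S.path U x0 v n) = scale r v n) by
    choose R h1 h2 using h
    exact ⟨R, h1, h2⟩
  intro n
  induction n with
  | zero => exact ⟨fun _ => r, measurable_const, fun _ _ _ _ => rfl⟩
  | succ n ih =>
    obtain ⟨R, hR, hR'⟩ := ih
    by_cases hn : n < S.M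
    -- An injective linear map has a linear, hence measurable, left inverse `g`; it recovers `v_n`
    -- from `x_{n+1} - α_n x_n - b_n u_n`.
    · let f : (Fin k → ℝ) →ₗ[ℝ] (Fin m → ℝ) := (S.c n).mulVecLin ∘ₗ
        { toFun := pad m, map_add' := pad_add m, map_smul' := pad_smul m }
      obtain ⟨g, hg⟩ := f.exists_leftInverse_of_injective (LinearMap.ker_eq_bot.2 (hc n hn))
      have hg' : ∀ v, g (S.c n *ᵥ pad m v) = v := fun v => LinearMap.congr_fun hg v
      have hgm : Measurable g := (LinearMap.continuous_of_finiteDimensional g).measurable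
      refine ⟨fun h => R (Fin.init h.1, Fin.init h.2) ⊔ g (h.1 (Fin.last (n + 1))
        - S.α n *ᵥ h.1 (Fin.last n).castSucc - S.b n *ᵥ h.2 (Fin.last n)), ?_, ?_⟩
      · have h1 : Measurable fun h : (Fin (n + 1 + 1) → Fin m → ℝ) × (Fin (n + 1) → Fin m → ℝ) =>
            R (Fin.init h.1, Fin.init h.2) := by
          refine hR.comp (Measurable.prodMk ?_ ?_) <;> refine measurable_pi_iff.2 fun i => ?_
          · exact (measurable_pi_apply i.castSucc).comp measurable_fst
          · exact (measurable_pi_apply i.castSucc).comp measurable_snd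
        have h2 : Measurable fun h : (Fin (n + 1 + 1) → Fin m → ℝ) × (Fin (n + 1) → Fin m → ℝ) =>
            g (h.1 (Fin.last (n + 1)) - S.α n *ᵥ h.1 (Fin.last n).castSucc
              - S.b n *ᵥ h.2 (Fin.last n)) := by
          refine hgm.comp (Measurable.sub (Measurable.sub ?_ ?_) ?_)
          · exact (measurable_pi_apply _).comp measurable_fst
          · exact (measurable_mulVec _).comp ((measurable_pi_apply _).comp measurable_fst)
          · exact (measurable_mulVec _).comp ((measurable_pi_apply _).comp measurable_snd)
        exact measurable_pi_iff.2 fun i =>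
          ((measurable_pi_apply i).comp h1).max ((measurable_pi_apply i).comp h2)
      · intro _ U x0 v
        rw [path_succ, scale_succ]
        simp only [Fin.init_snoc, Fin.snoc_last, Fin.snoc_castSucc]
        congr 1
        · exact hR' hn.le U x0 v
        · rw [← state, sub_sub, add_sub_cancel_left, hg']
    · exact ⟨fun _ => r, measurable_const, fun h => absurd h (by omega)⟩

end LinSystem

/-! ### Linear algebra -/

section LinearAlgebra

variable {ι : Type*} [Fintype ι]

lemma dotProduct_mulVec_transpose (x y : ι → ℝ) (A : Matrix ι ι ℝ) :
    x ⬝ᵥ (Aᵀ *ᵥ y) = y ⬝ᵥ (A *ᵥ x) := by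
  rw [mulVec_transpose, dotProduct_comm, ← dotProduct_mulVec]

lemma Matrix.IsSymm.dotProduct_mulVec_comm {A : Matrix ι ι ℝ} (hA : A.IsSymm) (x y : ι → ℝ) :
    x ⬝ᵥ (A *ᵥ y) = y ⬝ᵥ (A *ᵥ x) := by
  rw [← dotProduct_mulVec_transpose y x A, hA.eq]

lemma nonneg_of_affine_nonneg {a b c : ℝ} (h : ∀ t : ℝ, 0 ≤ a * t ^ 2 + b * t + c) : 0 ≤ a := by
  by_contra ha
  push Not at ha
  -- At this `t ≥ 1` one has `a * t ^ 2 ≤ -(|b| + |c| + 1) * t`, which outweighs `b * t + c`.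
  have h1 := h ((|b| + |c| + 1) / (-a) + 1)
  have h2 : 0 < -a := by linarith
  set s := (|b| + |c| + 1) / (-a) with hs
  have h3 : a * s = -(|b| + |c| + 1) := by
    rw [hs, mul_div_assoc', div_eq_iff h2.ne']; ring
  have h4 : 0 ≤ s := by rw [hs]; positivity
  have h5 : a * (s + 1) ^ 2 ≤ -(|b| + |c| + 1) * (s + 1) := by nlinarith
  have h6 : b * (s + 1) ≤ |b| * (s + 1) := by gcongr; exact le_abs_self b
  nlinarith [le_abs_self c, abs_nonneg b, abs_nonneg c, mul_nonneg (abs_nonneg c) h4]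

lemma eq_zero_of_affine_nonneg {b c : ℝ} (h : ∀ t : ℝ, 0 ≤ b * t + c) : b = 0 := by
  by_contra hb
  have := h ((-c - 1) / b)
  rw [mul_div_cancel₀ _ hb] at this
  linarith

/-- A quadratic function that is bounded below has a nonnegative quadratic part. -/
lemma quadratic_part_nonneg {K : Matrix ι ι ℝ} {L : ι → ℝ} {e : ℝ}
    (h : ∀ u, 0 ≤ u ⬝ᵥ (K *ᵥ u) - 2 * (u ⬝ᵥ L) + e) (w : ι → ℝ) : 0 ≤ w ⬝ᵥ (K *ᵥ w) := by
  refine nonneg_of_affine_nonneg (b := -2 * (w ⬝ᵥ L)) (c := e) fun t => ?_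
  have := h (t • w)
  simp only [mulVec_smul, dotProduct_smul, smul_dotProduct, smul_eq_mul] at this
  linarith

/-- A quadratic function that is bounded below has a critical point. -/
lemma exists_critical_point {K : Matrix ι ι ℝ} (hK : K.IsSymm) {L : ι → ℝ} {e : ℝ}
    (h : ∀ u, 0 ≤ u ⬝ᵥ (K *ᵥ u) - 2 * (u ⬝ᵥ L) + e) : ∃ u, K *ᵥ u = L := by
  classical
  by_contra hL
  have hL' : L ∉ LinearMap.range K.mulVecLin := fun ⟨u, hu⟩ => hL ⟨u, hu⟩
  -- If `L` were outside the range, some `z` would annihilate the range but not `L`. Symmetry gives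
  -- `K z = 0`, so along `t • z` the function is affine with slope `-2 (z ⬝ᵥ L) ≠ 0` and cannot stay
  -- nonnegative.
  obtain ⟨f, hfL, hf⟩ := Submodule.exists_dual_map_eq_bot_of_notMem hL' inferInstance
  obtain ⟨z, rfl⟩ := (dotProductEquiv ℝ ι).surjective f
  have hf' : ∀ u, z ⬝ᵥ (K *ᵥ u) = 0 := fun u => by
    have : dotProductEquiv ℝ ι z (K *ᵥ u) ∈ Submodule.map (dotProductEquiv ℝ ι z)
      (LinearMap.range K.mulVecLin) := ⟨_, ⟨u, rfl⟩, rfl⟩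
    rw [hf] at this
    simpa using this
  have hz : K *ᵥ z = 0 := dotProduct_eq_zero _ fun u => by
    rw [dotProduct_comm, hK.dotProduct_mulVec_comm, hf']
  refine hfL ?_
  have := eq_zero_of_affine_nonneg (b := -2 * (z ⬝ᵥ L)) (c := e) fun t => by
    have := h (t • z)
    simp only [mulVec_smul, hz, dotProduct_smul, smul_dotProduct, smul_eq_mul,
      dotProduct_zero, mul_zero] at this
    linarith
  simpa using this

/-- Completing the square around a solution of the linear system, so that no inverse of `K` is
needed. -/
lemma quadratic_eq_add_sq {K : Matrix ι ι ℝ} (hK : K.IsSymm) {L u' : ι → ℝ} (h : K *ᵥ u' = L)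
    (u : ι → ℝ) (e : ℝ) :
    u ⬝ᵥ (K *ᵥ u) - 2 * (u ⬝ᵥ L) + e
      = (e - u' ⬝ᵥ L) + (u - u') ⬝ᵥ (K *ᵥ (u - u')) := by
  have h1 : u' ⬝ᵥ (K *ᵥ u) = u ⬝ᵥ L := by rw [hK.dotProduct_mulVec_comm, h]
  simp only [mulVec_sub, dotProduct_sub, sub_dotProduct, h, h1]
  ring

lemma mulVec_eq_zero_of_dotProduct_eq_zero {K : Matrix ι ι ℝ} (hK : K.IsSymm)
    (hpos : ∀ w, 0 ≤ w ⬝ᵥ (K *ᵥ w)) {w : ι → ℝ} (hw : w ⬝ᵥ (K *ᵥ w) = 0) : K *ᵥ w = 0 := by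
  have hH : K.IsHermitian := by rw [IsHermitian, conjTranspose_eq_transpose_of_trivial]; exact hK
  have hP : K.PosSemidef := .of_dotProduct_mulVec_nonneg hH fun x => by simpa using hpos x
  exact (hP.dotProduct_mulVec_zero_iff w).1 (by simpa using hw)

/-- A solution chosen linearly in the right side makes the optimal control measurable and the
minimal value a quadratic form. -/
lemma exists_generalized_inverse (K : Matrix ι ι ℝ) :
    ∃ G : Matrix ι ι ℝ, ∀ y, (∃ u, K *ᵥ u = y) → K *ᵥ (G *ᵥ y) = y := by
  classical
  obtain ⟨g, hg⟩ := K.mulVecLin.rangeRestrict.exists_rightInverse_of_surjective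
    (LinearMap.range_eq_top.2 K.mulVecLin.surjective_rangeRestrict)
  obtain ⟨f, hf⟩ := LinearMap.exists_extend g
  refine ⟨LinearMap.toMatrix' f, ?_⟩
  rintro y ⟨u, rfl⟩
  rw [LinearMap.toMatrix'_mulVec]
  have h1 := LinearMap.congr_fun hf ⟨K *ᵥ u, u, rfl⟩
  have h2 := congrArg Subtype.val (LinearMap.congr_fun hg ⟨K *ᵥ u, u, rfl⟩)
  simp only [LinearMap.comp_apply, Submodule.subtype_apply] at h1
  rw [h1]
  exact h2

/-- Quadratic forms in `(x, ρ)`. -/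
def IsQuadForm (f : (ι → ℝ) → (ι → ℝ) → ℝ) : Prop :=
  ∃ A B C : Matrix ι ι ℝ, A.IsSymm ∧
    ∀ x ρ, f x ρ = x ⬝ᵥ (A *ᵥ x) + 2 * (x ⬝ᵥ (B *ᵥ ρ)) + 2 * (ρ ⬝ᵥ (C *ᵥ ρ))

lemma IsQuadForm.add {f g : (ι → ℝ) → (ι → ℝ) → ℝ} (hf : IsQuadForm f) (hg : IsQuadForm g) :
    IsQuadForm fun x ρ => f x ρ + g x ρ := by
  obtain ⟨A, B, C, hA, h⟩ := hf
  obtain ⟨A', B', C', hA', h'⟩ := hg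
  refine ⟨A + A', B + B', C + C', hA.add hA', fun x ρ => ?_⟩
  simp only [h, h', add_mulVec, dotProduct_add]
  ring

lemma IsQuadForm.const_mul {f : (ι → ℝ) → (ι → ℝ) → ℝ} (hf : IsQuadForm f) (c : ℝ) :
    IsQuadForm fun x ρ => c * f x ρ := by
  obtain ⟨A, B, C, hA, h⟩ := hf
  refine ⟨c • A, c • B, c • C, hA.smul c, fun x ρ => ?_⟩
  simp only [h, smul_mulVec, dotProduct_smul, smul_eq_mul]
  ring

/-- The common building block of all quadratic forms below, obtained by specializing the matrices to
0, 1 or products. Only the `x`-block has to be symmetrized; the factors 1/2 compensate for the 2s in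
the definition and for the symmetrization. -/
lemma isQuadForm_bilin (T N T' N' P : Matrix ι ι ℝ) :
    IsQuadForm fun x ρ => (T *ᵥ x + N *ᵥ ρ) ⬝ᵥ (P *ᵥ (T' *ᵥ x + N' *ᵥ ρ)) := by
  have hx : ∀ (D E : Matrix ι ι ℝ) (x y : ι → ℝ),
      (D *ᵥ x) ⬝ᵥ (P *ᵥ (E *ᵥ y)) = x ⬝ᵥ ((Dᵀ * P * E) *ᵥ y) := fun D E x y => by
    rw [← mulVec_mulVec, ← mulVec_mulVec, dotProduct_mulVec_transpose, dotProduct_comm]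
  let W := Tᵀ * P * T'
  refine ⟨(1 / 2 : ℝ) • (W + Wᵀ), (1 / 2 : ℝ) • (Tᵀ * P * N' + (Nᵀ * P * T')ᵀ),
    (1 / 2 : ℝ) • (Nᵀ * P * N'), ?_, fun x ρ => ?_⟩
  · rw [IsSymm, transpose_smul, transpose_add, transpose_transpose, add_comm]
  · simp only [mulVec_add, dotProduct_add, add_dotProduct, hx, smul_mulVec, add_mulVec,
      dotProduct_smul, smul_eq_mul, dotProduct_mulVec_transpose, W]
    ring

end LinearAlgebra

/-! ### Moments -/

section Moments

variable {Ω : Type*} [MeasurableSpace Ω] {μ : Measure Ω} {k : ℕ}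

lemma integrable_pad_mul (m : ℕ) {X Y : Ω → Fin k → ℝ} (hX : ∀ i, MemLp (fun ω => X ω i) 2 μ)
    (hY : ∀ i, MemLp (fun ω => Y ω i) 2 μ) (i j : Fin m) :
    Integrable (fun ω => pad m (X ω) i * pad m (Y ω) j) μ := by
  unfold pad
  by_cases hi : i.val < k
  · by_cases hj : j.val < k
    · simp only [hi, hj, dif_pos]
      exact (hX ⟨i, hi⟩).integrable_mul (hY ⟨j, hj⟩)
    · simp [hj]
  · simp [hi]

lemma dotProduct_pad_mul (m : ℕ) (ρ X Y : Fin k → ℝ) (N : Matrix (Fin m) (Fin m) ℝ) :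
    pad m (ρ * X) ⬝ᵥ (N *ᵥ pad m (ρ * Y))
      = ∑ i, ∑ j, pad m ρ i * N i j * pad m ρ j * (pad m X i * pad m Y j) := by
  simp only [dotProduct, mulVec, Finset.mul_sum, pad_mul]
  exact Finset.sum_congr rfl fun i _ => Finset.sum_congr rfl fun j _ => by ring

lemma integrable_dotProduct_pad (m : ℕ) {X Y : Ω → Fin k → ℝ}
    (hX : ∀ i, MemLp (fun ω => X ω i) 2 μ) (hY : ∀ i, MemLp (fun ω => Y ω i) 2 μ)
    (ρ : Fin k → ℝ) (N : Matrix (Fin m) (Fin m) ℝ) :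
    Integrable (fun ω => pad m (ρ * X ω) ⬝ᵥ (N *ᵥ pad m (ρ * Y ω))) μ := by
  simp only [dotProduct_pad_mul]
  exact integrable_finsetSum _ fun i _ => integrable_finsetSum _ fun j _ =>
    (integrable_pad_mul m hX hY i j).const_mul _

/-- The second moment matrix of the padded vectors `X`, `Y`, multiplied entrywise by `N`. -/
noncomputable def momentMatrix {m : ℕ} (μ : Measure Ω) (X Y : Ω → Fin k → ℝ)
    (N : Matrix (Fin m) (Fin m) ℝ) : Matrix (Fin m) (Fin m) ℝ :=
  Matrix.of fun i j => N i j * ∫ ω, pad m (X ω) i * pad m (Y ω) j ∂μ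

/-- Entrywise the factors of `ρ` come out of the integral, so the scale dependence is a quadratic
form whose matrix involves only the law at scale 1. -/
lemma integral_dotProduct_pad (m : ℕ) {X Y : Ω → Fin k → ℝ}
    (hX : ∀ i, MemLp (fun ω => X ω i) 2 μ) (hY : ∀ i, MemLp (fun ω => Y ω i) 2 μ)
    (ρ : Fin k → ℝ) (N : Matrix (Fin m) (Fin m) ℝ) :
    ∫ ω, pad m (ρ * X ω) ⬝ᵥ (N *ᵥ pad m (ρ * Y ω)) ∂μ
      = pad m ρ ⬝ᵥ (momentMatrix μ X Y N *ᵥ pad m ρ) := by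
  simp only [dotProduct_pad_mul]
  rw [integral_finsetSum _ fun i _ => integrable_finsetSum _ fun j _ =>
    (integrable_pad_mul m hX hY i j).const_mul _]
  simp only [dotProduct, mulVec, Finset.mul_sum, momentMatrix, Matrix.of_apply]
  refine Finset.sum_congr rfl fun i _ => ?_
  rw [integral_finsetSum _ fun j _ => (integrable_pad_mul m hX hY i j).const_mul _]
  refine Finset.sum_congr rfl fun j _ => ?_
  rw [integral_const_mul]
  ring

lemma dotProduct_pad_linear (m : ℕ) (z : Fin m → ℝ) (ρ X : Fin k → ℝ) :
    z ⬝ᵥ pad m (ρ * X) = ∑ i, z i * pad m ρ i * pad m X i := by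
  simp only [dotProduct, pad_mul, mul_assoc]

lemma integrable_pad (m : ℕ) {X : Ω → Fin k → ℝ} (hX : ∀ i, Integrable (fun ω => X ω i) μ)
    (i : Fin m) : Integrable (fun ω => pad m (X ω) i) μ := by
  unfold pad
  by_cases hi : i.val < k
  · simpa [hi] using hX ⟨i, hi⟩
  · simp [hi]

lemma integral_pad (m : ℕ) {X : Ω → Fin k → ℝ} (i : Fin m) :
    ∫ ω, pad m (X ω) i ∂μ = pad m (fun i => ∫ ω, X ω i ∂μ) i := by
  unfold pad
  by_cases hi : i.val < k <;> simp [hi]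

lemma integrable_dotProduct_pad_linear (m : ℕ) {X : Ω → Fin k → ℝ}
    (hX : ∀ i, Integrable (fun ω => X ω i) μ) (z : Fin m → ℝ) (ρ : Fin k → ℝ) :
    Integrable (fun ω => z ⬝ᵥ pad m (ρ * X ω)) μ := by
  simp only [dotProduct_pad_linear]
  exact integrable_finsetSum _ fun i _ => (integrable_pad m hX i).const_mul _

lemma integral_dotProduct_pad_linear (m : ℕ) {X : Ω → Fin k → ℝ}
    (hX : ∀ i, Integrable (fun ω => X ω i) μ) (z : Fin m → ℝ) (ρ : Fin k → ℝ) :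
    ∫ ω, z ⬝ᵥ pad m (ρ * X ω) ∂μ = z ⬝ᵥ pad m (ρ * fun i => ∫ ω, X ω i ∂μ) := by
  simp only [dotProduct_pad_linear]
  rw [integral_finsetSum _ fun i _ => (integrable_pad m hX i).const_mul _]
  simp only [integral_const_mul, integral_pad]

end Moments

/-! ### Moments of the Pareto law and of the rescaled disturbance. -/

section ParetoMoments

variable {k : ℕ} {γ : Fin k → ℝ}

lemma integral_comp_eval_paretoPi {ρ : Fin k → ℝ} (hγ : ∀ i, 2 < γ i) (hρ : ∀ i, 0 < ρ i)
    (i : Fin k) {f : ℝ → ℝ} (hf : Measurable f) :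
    ∫ l, f (l i) ∂(paretoPi γ ρ) = ∫ x, f x ∂(paretoMeasure (ρ i) (γ i)) := by
  have : ∀ i, IsProbabilityMeasure (paretoMeasure (ρ i) (γ i)) := fun i =>
    isProbabilityMeasure_paretoMeasure (hρ i) (two_pos.trans (hγ i))
  exact integral_comp_eval hf.aestronglyMeasurable

lemma integral_comp_eval_unifPi {a : Fin k → ℝ} (ha : ∀ i, 0 < a i) (i : Fin k) {f : ℝ → ℝ}
    (hf : Measurable f) : ∫ v, f (v i) ∂(unifPi a) = ∫ x, f x ∂(unifMeasure (a i)) := by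
  have : ∀ i, IsProbabilityMeasure (unifMeasure (a i)) := fun i =>
    isProbabilityMeasure_unifMeasure (ha i)
  exact integral_comp_eval hf.aestronglyMeasurable

/-- The integrand is the mean of a uniform variable on `[0, l i]`, so this is the factor in `Q`. -/
lemma integral_half_paretoPi {ρ : Fin k → ℝ} (hγ : ∀ i, 2 < γ i) (hρ : ∀ i, 0 < ρ i) (i : Fin k) :
    ∫ l, l i / 2 ∂(paretoPi γ ρ) = γ i / (2 * (γ i - 1)) * ρ i := by
  have h := (rpow_paretoMeasure (hρ i) (two_pos.trans (hγ i)) (s := 1) (by linarith [hγ i])).2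
  simp only [Real.rpow_one] at h
  have h1 : γ i - 1 ≠ 0 := by linarith [hγ i]
  rw [integral_comp_eval_paretoPi hγ hρ i (f := fun x => x / 2) (by fun_prop),
    integral_div, h]
  field_simp

/-- The integrand is the mean of `max (ρ i) v` for `v` uniform on `[0, l i]`, and `γ/(2(γ-1)) +
γ/(2(γ+1)) = γ²/(γ²-1)`, the factor in `Q₂`. -/
lemma integral_half_add_inv_paretoPi {ρ : Fin k → ℝ} (hγ : ∀ i, 2 < γ i) (hρ : ∀ i, 0 < ρ i)
    (i : Fin k) :
    ∫ l, (l i / 2 + ρ i ^ 2 / 2 * (l i)⁻¹) ∂(paretoPi γ ρ)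
      = γ i ^ 2 / (γ i ^ 2 - 1) * ρ i := by
  have h := rpow_paretoMeasure (hρ i) (two_pos.trans (hγ i)) (s := 1) (by linarith [hγ i])
  have h' := rpow_paretoMeasure (hρ i) (two_pos.trans (hγ i)) (s := -1) (by linarith [hγ i])
  simp only [Real.rpow_one] at h
  simp only [Real.rpow_neg_one] at h'
  have h1 : γ i - 1 ≠ 0 := by linarith [hγ i]
  have h2 : γ i + 1 ≠ 0 := by linarith [hγ i]
  have h3 : γ i ^ 2 - 1 ≠ 0 := by
    rw [show γ i ^ 2 - 1 = (γ i - 1) * (γ i + 1) by ring]; exact mul_ne_zero h1 h2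
  have h4 := (hρ i).ne'
  rw [integral_comp_eval_paretoPi hγ hρ i (f := fun x => x / 2 + ρ i ^ 2 / 2 * x⁻¹) (by fun_prop),
    integral_add (h.1.div_const 2) (h'.1.const_mul _), integral_div, integral_const_mul, h.2, h'.2,
    sub_neg_eq_add]
  field_simp
  ring

/-- The law of the parameter and of the rescaled disturbance for the scale `1`. -/
noncomputable def base (γ : Fin k → ℝ) : Measure ((Fin k → ℝ) × (Fin k → ℝ)) :=
  (paretoPi γ 1).prod (unifPi 1)

lemma isProbabilityMeasure_base (hγ : ∀ i, 2 < γ i) : IsProbabilityMeasure (base γ) := by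
  have := isProbabilityMeasure_paretoPi (fun i => two_pos.trans (hγ i)) (ρ := 1) fun _ => one_pos
  unfold base; infer_instance

lemma memLp_eval_paretoPi (hγ : ∀ i, 2 < γ i) (i : Fin k) :
    MemLp (fun l : Fin k → ℝ => l i) 2 (paretoPi γ 1) := by
  have : ∀ i, IsProbabilityMeasure (paretoMeasure 1 (γ i)) := fun i =>
    isProbabilityMeasure_paretoMeasure one_pos (two_pos.trans (hγ i))
  have h := (rpow_paretoMeasure one_pos (two_pos.trans (hγ i)) (hγ i)).1
  refine (memLp_two_iff_integrable_sq (measurable_pi_apply i).aestronglyMeasurable).2 ?_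
  refine integrable_comp_eval (f := fun x : ℝ => x ^ 2) (i := i)
    (μ := fun i => paretoMeasure 1 (γ i)) ?_
  simpa using h

lemma memLp_fst_base (hγ : ∀ i, 2 < γ i) (i : Fin k) :
    MemLp (fun z : (Fin k → ℝ) × (Fin k → ℝ) => z.1 i) 2 (base γ) :=
  (memLp_eval_paretoPi hγ i).comp_measurePreserving measurePreserving_fst

lemma ae_base (γ : Fin k → ℝ) :
    ∀ᵐ z ∂(base γ), ∀ i, 1 ≤ z.1 i ∧ 0 ≤ z.2 i ∧ z.2 i ≤ 1 := by
  have h1 : ∀ᵐ z ∂(base γ), ∀ i, 1 ≤ z.1 i :=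
    (Measure.quasiMeasurePreserving_fst.ae (ae_paretoPi γ 1))
  have h2 : ∀ᵐ z ∂(base γ), ∀ i, 0 ≤ z.2 i ∧ z.2 i ≤ 1 :=
    (Measure.quasiMeasurePreserving_snd.ae (ae_unifPi 1))
  filter_upwards [h1, h2] with z a b i using ⟨a i, b i⟩

lemma memLp_mul_base (hγ : ∀ i, 2 < γ i) (i : Fin k) :
    MemLp (fun z : (Fin k → ℝ) × (Fin k → ℝ) => (z.1 * z.2) i) 2 (base γ) := by
  refine (memLp_fst_base hγ i).of_le
    (by fun_prop : Measurable _).aestronglyMeasurable ?_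
  filter_upwards [ae_base γ] with z hz
  obtain ⟨h1, h2, h3⟩ := hz i
  rw [Pi.mul_apply, norm_mul]
  refine mul_le_of_le_one_right (norm_nonneg _) ?_
  rwa [Real.norm_of_nonneg h2]

/-- Since `1 ≤ z.1 i` and `z.2 i ≤ 1`, the maximum is dominated by `z.1 i`, whose second moment is
finite. -/
lemma memLp_max_base (hγ : ∀ i, 2 < γ i) (i : Fin k) :
    MemLp (fun z : (Fin k → ℝ) × (Fin k → ℝ) => (1 ⊔ z.1 * z.2) i) 2 (base γ) := by
  refine (memLp_fst_base hγ i).of_le (Measurable.aestronglyMeasurable ?_) ?_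
  · exact (measurable_pi_apply i).comp ((measurable_sup_pi 1).comp (by fun_prop))
  filter_upwards [ae_base γ] with z hz
  obtain ⟨h1, h2, h3⟩ := hz i
  have h4 : (1 ⊔ z.1 * z.2) i = max 1 (z.1 i * z.2 i) := rfl
  rw [h4, Real.norm_of_nonneg (by positivity), Real.norm_of_nonneg (by linarith)]
  exact max_le h1 (mul_le_of_le_one_right (by linarith) h3)

lemma integral_mul_base (hγ : ∀ i, 2 < γ i) (i : Fin k) :
    ∫ z, (z.1 * z.2) i ∂(base γ) = γ i / (2 * (γ i - 1)) := by
  have h := integral_half_paretoPi hγ (ρ := 1) (fun _ => one_pos) i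
  rw [integral_div, Pi.one_apply, mul_one] at h
  rw [base]
  simp only [Pi.mul_apply]
  have := isProbabilityMeasure_paretoPi (fun i => two_pos.trans (hγ i)) (ρ := 1) fun _ => one_pos
  rw [integral_prod_mul (fun l : Fin k → ℝ => l i) (fun v : Fin k → ℝ => v i),
    integral_comp_eval_unifPi (a := 1) (fun _ => one_pos) i (f := fun x => x) measurable_id,
    Pi.one_apply, integral_id_unifMeasure one_pos, ← h]
  ring

lemma integral_max_base (hγ : ∀ i, 2 < γ i) (i : Fin k) :
    ∫ z, (1 ⊔ z.1 * z.2) i ∂(base γ) = γ i ^ 2 / (γ i ^ 2 - 1) := by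
  have hprob := isProbabilityMeasure_base hγ
  have hint : Integrable (fun z : (Fin k → ℝ) × (Fin k → ℝ) => (1 ⊔ z.1 * z.2) i) (base γ) :=
    (memLp_max_base hγ i).integrable one_le_two
  have h := integral_half_add_inv_paretoPi hγ (ρ := 1) (fun _ => one_pos) i
  rw [base] at hint ⊢
  rw [integral_prod _ hint]
  simp only [Pi.one_apply, mul_one] at h
  rw [← h]
  refine integral_congr_ae ?_
  filter_upwards [ae_paretoPi γ 1] with l hl
  have hl1 : 1 ≤ l i := hl i
  have hl0 : 0 < l i := by linarith
  have e : ∀ v : Fin k → ℝ, (1 ⊔ l * v) i = max 1 (l i * v i) := fun v => rfl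
  simp only [e]
  rw [integral_comp_eval_unifPi (a := 1) (fun _ => one_pos) i (f := fun x => max 1 (l i * x))
    (by fun_prop), Pi.one_apply, ← integral_max_unifMeasure zero_le_one hl1 hl0,
    ← map_mul_unifMeasure hl0, integral_map (by fun_prop) (by fun_prop)]

end ParetoMoments

/-! ### Standing assumptions and their first consequences. -/

noncomputable section

namespace LinSystem

variable {m k : ℕ} (S : LinSystem m k)

/-- The standing assumptions on the data. -/
structure IsValid : Prop where
  shape_gt_two : ∀ i, 2 < S.β i
  p_nonneg : ∀ j ≤ S.M, 0 ≤ S.p j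
  p_last : S.p S.M ≠ 0
  κ_symm : ∀ n ≤ S.M, (S.κ n).IsSymm
  κ_nonneg : ∀ n ≤ S.M, ∀ u, 0 ≤ u ⬝ᵥ (S.κ n *ᵥ u)
  s_nonneg : ∀ n ≤ S.M, ∀ y, 0 ≤ y ⬝ᵥ (S.s n *ᵥ y)

variable {S}

lemma IsValid.φ_nonneg (hS : S.IsValid) (n : ℕ) : 0 ≤ S.φ n :=
  Finset.sum_nonneg fun j hj => hS.p_nonneg j (Finset.mem_Icc.1 hj).2

lemma IsValid.φ_pos (hS : S.IsValid) {n : ℕ} (hn : n ≤ S.M) : 0 < S.φ n := by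
  have h : 0 < S.p S.M := lt_of_le_of_ne (hS.p_nonneg _ le_rfl) hS.p_last.symm
  exact h.trans_le (Finset.single_le_sum (f := S.p)
    (fun j hj => hS.p_nonneg j (Finset.mem_Icc.1 hj).2) (Finset.mem_Icc.2 ⟨hn, le_rfl⟩))

lemma φ_succ_last (S : LinSystem m k) : S.φ (S.M + 1) = 0 := by
  simp [φ]

lemma IsValid.stageCost_nonneg (hS : S.IsValid) (U : Policy m) (x0 : Fin m → ℝ) (l : Fin k → ℝ)
    (v : ℕ → Fin k → ℝ) {i : ℕ} (hi : i ≤ S.M) : 0 ≤ S.stageCost U x0 l v i :=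
  add_nonneg (hS.s_nonneg i hi _) (hS.κ_nonneg i hi _)

lemma IsValid.shape_gt (hS : S.IsValid) (n : ℕ) (i : Fin k) : 2 < S.shape n i :=
  S.shape_gt hS.shape_gt_two n i

lemma IsValid.shape_pos (hS : S.IsValid) (n : ℕ) (i : Fin k) : 0 < S.shape n i :=
  two_pos.trans (hS.shape_gt n i)

variable (S)

/-! ### The conditional risk as a sum of expected stage costs -/

/-- The expected cost at time `i`, given the history up to time `n`. -/
def expCost (r : Fin k → ℝ) (x0 : Fin m → ℝ) (n : ℕ) (us : ℕ → Fin m → ℝ)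
    (vs : ℕ → Fin k → ℝ) (U : Policy m) (i : ℕ) : ℝ≥0∞ :=
  ∫⁻ z, ENNReal.ofReal (S.stageCost (U.withPast n us) x0 z.1 (S.splice n vs z.2) i)
    ∂(S.joint (S.shape n) (scale r vs n))

lemma measurable_stageCost_splice {U : Policy m} (hU : U.IsAdmissible) (x0 : Fin m → ℝ) (n : ℕ)
    (vs : ℕ → Fin k → ℝ) (i : ℕ) :
    Measurable fun z : (Fin k → ℝ) × (Fin S.M → Fin k → ℝ) =>
      ENNReal.ofReal (S.stageCost U x0 z.1 (S.splice n vs z.2) i) :=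
  ((S.measurable_stageCost hU x0 i).comp
    (measurable_fst.prodMk ((S.measurable_splice n vs).comp measurable_snd))).ennreal_ofReal

variable {S}

/-- Exchanging the sums over the horizon `j` and the time `i ≤ j` collects the probabilities `p_j /
φ_n`, `j ≥ i`, into `φ_i / φ_n`. Nonnegativity of the costs lets `ENNReal.ofReal` pass through the
sums. -/
lemma IsValid.condRisk_eq (hS : S.IsValid) {r : Fin k → ℝ} (hr : ∀ i, 0 < r i) (x0 : Fin m → ℝ)
    {n : ℕ} (hn : n ≤ S.M) (us : ℕ → Fin m → ℝ) {vs : ℕ → Fin k → ℝ} (hvs : ∀ j i, 0 ≤ vs j i)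
    {U : Policy m} (hU : U.IsAdmissible) :
    S.condRisk r x0 n us vs U = ∑ i ∈ Finset.Icc n S.M,
      ENNReal.ofReal (S.φ i / S.φ n) * S.expCost r x0 n us vs U i := by
  have hφ := hS.φ_pos hn
  have hU' := hU.withPast n us
  have h1 : ∀ j ∈ Finset.Icc n S.M, ∫⁻ lam, ∫⁻ w, ENNReal.ofReal
      (∑ i ∈ Finset.Icc n j, S.stageCost (U.withPast n us) x0 lam (S.splice n vs w) i)
      ∂(S.disturbLaw lam) ∂(S.posterior r n vs)
      = ∑ i ∈ Finset.Icc n j, S.expCost r x0 n us vs U i := fun j hj => by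
    have hm : ∀ i, Measurable fun z : (Fin k → ℝ) × (Fin S.M → Fin k → ℝ) => ENNReal.ofReal
        (S.stageCost (U.withPast n us) x0 z.1 (S.splice n vs z.2) i) := fun i =>
      S.measurable_stageCost_splice hU' x0 n vs i
    have e : ∀ z : (Fin k → ℝ) × (Fin S.M → Fin k → ℝ), ENNReal.ofReal
        (∑ i ∈ Finset.Icc n j, S.stageCost (U.withPast n us) x0 z.1 (S.splice n vs z.2) i)
        = ∑ i ∈ Finset.Icc n j, ENNReal.ofReal
          (S.stageCost (U.withPast n us) x0 z.1 (S.splice n vs z.2) i) := fun z =>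
      ENNReal.ofReal_sum_of_nonneg fun i hi => hS.stageCost_nonneg _ _ _ _
        ((Finset.mem_Icc.1 hi).2.trans (Finset.mem_Icc.1 hj).2)
    have hF : Measurable fun z : (Fin k → ℝ) × (Fin S.M → Fin k → ℝ) => ENNReal.ofReal
        (∑ i ∈ Finset.Icc n j, S.stageCost (U.withPast n us) x0 z.1 (S.splice n vs z.2) i) := by
      simp only [e]
      exact Finset.measurable_fun_sum _ fun i _ => hm i
    rw [S.posterior_eq hS.shape_gt_two hr n hvs, ← S.lintegral_joint (scale_pos hr vs n) hF]
    simp only [e]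
    rw [lintegral_finsetSum _ fun i _ => hm i]
    rfl
  have h2 : ∀ i ∈ Finset.Icc n S.M, ENNReal.ofReal (S.φ i / S.φ n)
      = ∑ j ∈ Finset.Icc i S.M, ENNReal.ofReal (S.p j / S.φ n) := fun i _ => by
    rw [← ENNReal.ofReal_sum_of_nonneg fun j hj => div_nonneg
      (hS.p_nonneg j (Finset.mem_Icc.1 hj).2) hφ.le, φ, Finset.sum_div]
  calc S.condRisk r x0 n us vs U
      = ∑ j ∈ Finset.Icc n S.M, ∑ i ∈ Finset.Icc n j,
          ENNReal.ofReal (S.p j / S.φ n) * S.expCost r x0 n us vs U i :=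
        Finset.sum_congr rfl fun j hj => by rw [h1 j hj, Finset.mul_sum]
    _ = ∑ i ∈ Finset.Icc n S.M, ∑ j ∈ Finset.Icc i S.M,
          ENNReal.ofReal (S.p j / S.φ n) * S.expCost r x0 n us vs U i :=
        Finset.sum_comm' fun i j => by simp only [Finset.mem_Icc]; omega
    _ = _ := Finset.sum_congr rfl fun i hi => by rw [h2 i hi, Finset.sum_mul]

variable (S)

/-- The expected cost at time `i`, given the history up to time `n` and the disturbance `v` at
time `n`. -/
def expCostNext (r : Fin k → ℝ) (x0 : Fin m → ℝ) {n : ℕ} (hn : n < S.M) (us : ℕ → Fin m → ℝ)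
    (vs : ℕ → Fin k → ℝ) (U : Policy m) (i : ℕ) (v : Fin k → ℝ) : ℝ≥0∞ :=
  ∫⁻ z, ENNReal.ofReal (S.stageCost (U.withPast n us) x0 z.1
    (S.splice n vs (Function.update z.2 ⟨n, hn⟩ v)) i)
    ∂(S.joint (S.shape (n + 1)) (scale r vs n ⊔ v))

lemma measurable_expCostNext (r : Fin k → ℝ) (x0 : Fin m → ℝ) {n : ℕ} (hn : n < S.M)
    (us : ℕ → Fin m → ℝ) (vs : ℕ → Fin k → ℝ) {U : Policy m} (hU : U.IsAdmissible) (i : ℕ) :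
    Measurable (S.expCostNext r x0 hn us vs U i) := by
  have hm : Measurable fun y : (Fin k → ℝ) × ((Fin k → ℝ) × (Fin S.M → Fin k → ℝ)) =>
      (y.2.1, Function.update y.2.2 ⟨n, hn⟩ y.1) :=
    (measurable_fst.comp measurable_snd).prodMk ((S.measurable_update_prod _).comp
      (measurable_fst.prodMk (measurable_snd.comp measurable_snd)))
  exact S.measurable_lintegral_joint (S.shape (n + 1)) (measurable_sup_pi (scale r vs n))
    ((S.measurable_stageCost_splice (hU.withPast n us) x0 n vs i).comp hm)

lemma expCost_next (r : Fin k → ℝ) (x0 : Fin m → ℝ) {n : ℕ} (hn : n < S.M)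
    (us : ℕ → Fin m → ℝ) (vs : ℕ → Fin k → ℝ) (U : Policy m) {i : ℕ} (hi : n < i)
    (v : Fin k → ℝ) :
    S.expCost r x0 (n + 1) (Function.update us n (S.nextControl U x0 n us vs))
      (Function.update vs n v) U i = S.expCostNext r x0 hn us vs U i v := by
  rw [expCost, expCostNext, scale_update]
  refine lintegral_congr fun z => ?_
  rw [stageCost, stageCost, S.control_withPast_succ U x0 hn us vs z.2 v hi,
    S.state_withPast_succ U x0 hn us vs z.2 v i]

lemma update_nonneg {vs : ℕ → Fin k → ℝ} (hvs : ∀ j i, 0 ≤ vs j i) (n : ℕ) {v : Fin k → ℝ}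
    (hv : ∀ i, 0 ≤ v i) (j : ℕ) (i : Fin k) : 0 ≤ Function.update vs n v j i := by
  by_cases h : j = n
  · subst h; simpa using hv i
  · simpa [Function.update_of_ne h] using hvs j i

variable {S}

lemma IsValid.expCost_eq_lintegral (hS : S.IsValid) {r : Fin k → ℝ} (hr : ∀ i, 0 < r i)
    (x0 : Fin m → ℝ) {n : ℕ} (hn : n < S.M) (us : ℕ → Fin m → ℝ) (vs : ℕ → Fin k → ℝ)
    {U : Policy m} (hU : U.IsAdmissible) (i : ℕ) :
    S.expCost r x0 n us vs U i
      = ∫⁻ v, S.expCostNext r x0 hn us vs U i v ∂(pred (S.shape n) (scale r vs n)) := by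
  rw [expCost, S.lintegral_joint_eq (hS.shape_pos n) (scale_pos hr vs n) ⟨n, hn⟩
    (S.measurable_stageCost_splice (hU.withPast n us) x0 n vs i)]
  simp only [← shape_succ]
  rfl

lemma IsValid.condRisk_next (hS : S.IsValid) {r : Fin k → ℝ} (hr : ∀ i, 0 < r i)
    (x0 : Fin m → ℝ) {n : ℕ} (hn : n < S.M) (us : ℕ → Fin m → ℝ) {vs : ℕ → Fin k → ℝ}
    (hvs : ∀ j i, 0 ≤ vs j i) {U : Policy m} (hU : U.IsAdmissible) {v : Fin k → ℝ}
    (hv : ∀ i, 0 ≤ v i) :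
    S.condRisk r x0 (n + 1) (Function.update us n (S.nextControl U x0 n us vs))
      (Function.update vs n v) U
      = ∑ i ∈ Finset.Icc (n + 1) S.M,
        ENNReal.ofReal (S.φ i / S.φ (n + 1)) * S.expCostNext r x0 hn us vs U i v := by
  rw [hS.condRisk_eq hr x0 hn _ (update_nonneg hvs n hv) hU]
  refine Finset.sum_congr rfl fun i hi => ?_
  rw [S.expCost_next r x0 hn us vs U (Finset.mem_Icc.1 hi).1 v]

/-- The formula in terms of `expCostNext` is measurable in `v` but represents the risk only for
nonnegative `v`, hence almost everywhere. -/
lemma IsValid.aemeasurable_condRisk_next (hS : S.IsValid) {r : Fin k → ℝ} (hr : ∀ i, 0 < r i)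
    (x0 : Fin m → ℝ) {n : ℕ} (hn : n < S.M) (us : ℕ → Fin m → ℝ) {vs : ℕ → Fin k → ℝ}
    (hvs : ∀ j i, 0 ≤ vs j i) {U : Policy m} (hU : U.IsAdmissible) :
    AEMeasurable (fun v => S.condRisk r x0 (n + 1)
      (Function.update us n (S.nextControl U x0 n us vs)) (Function.update vs n v) U)
      (pred (S.shape n) (scale r vs n)) := by
  refine ⟨fun v => ∑ i ∈ Finset.Icc (n + 1) S.M,
        ENNReal.ofReal (S.φ i / S.φ (n + 1)) * S.expCostNext r x0 hn us vs U i v, ?_, ?_⟩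
  · exact Finset.measurable_fun_sum _ fun i _ =>
      (S.measurable_expCostNext r x0 hn us vs hU i).const_mul _
  · filter_upwards [ae_pred (γ := S.shape n) (scale_pos hr vs n)] with v hv
    exact hS.condRisk_next hr x0 hn us hvs hU hv

/-- The recursion for the conditional risk of a policy. -/
lemma IsValid.condRisk_succ (hS : S.IsValid) {r : Fin k → ℝ} (hr : ∀ i, 0 < r i)
    (x0 : Fin m → ℝ) {n : ℕ} (hn : n ≤ S.M) (us : ℕ → Fin m → ℝ) {vs : ℕ → Fin k → ℝ}
    (hvs : ∀ j i, 0 ≤ vs j i) {U : Policy m} (hU : U.IsAdmissible) :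
    S.condRisk r x0 n us vs U = S.expCost r x0 n us vs U n
      + ENNReal.ofReal (S.φ (n + 1) / S.φ n) * ∫⁻ v, S.condRisk r x0 (n + 1)
        (Function.update us n (S.nextControl U x0 n us vs)) (Function.update vs n v) U
        ∂(pred (S.shape n) (scale r vs n)) := by
  have hφ := hS.φ_pos hn
  rw [hS.condRisk_eq hr x0 hn us hvs hU, ← Finset.add_sum_Ioc_eq_sum_Icc hn, div_self hφ.ne',
    ENNReal.ofReal_one, one_mul]
  congr 1
  -- At `n = M` the factor `φ_{M+1} = 0` removes the integral; otherwise the weights multiply to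
  -- `φ_i / φ_n`.
  rcases hn.lt_or_eq with hn | rfl
  · have hφ' : 0 < S.φ (n + 1) := hS.φ_pos hn
    have e : ∫⁻ v, S.condRisk r x0 (n + 1)
        (Function.update us n (S.nextControl U x0 n us vs)) (Function.update vs n v) U
        ∂(pred (S.shape n) (scale r vs n))
        = ∑ i ∈ Finset.Icc (n + 1) S.M, ENNReal.ofReal (S.φ i / S.φ (n + 1))
          * S.expCost r x0 n us vs U i := by
      have : ∀ᵐ v ∂(pred (S.shape n) (scale r vs n)), S.condRisk r x0 (n + 1)
          (Function.update us n (S.nextControl U x0 n us vs)) (Function.update vs n v) U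
          = ∑ i ∈ Finset.Icc (n + 1) S.M,
            ENNReal.ofReal (S.φ i / S.φ (n + 1)) * S.expCostNext r x0 hn us vs U i v := by
        filter_upwards [ae_pred (γ := S.shape n) (scale_pos hr vs n)] with v hv
        exact hS.condRisk_next hr x0 hn us hvs hU hv
      rw [lintegral_congr_ae this, lintegral_finsetSum _ fun i _ =>
        (S.measurable_expCostNext r x0 hn us vs hU i).const_mul _]
      refine Finset.sum_congr rfl fun i _ => ?_
      rw [lintegral_const_mul _ (S.measurable_expCostNext r x0 hn us vs hU i),
        hS.expCost_eq_lintegral hr x0 hn us vs hU i]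
    rw [e, Finset.mul_sum]
    refine Finset.sum_congr (by ext; simp) fun i _ => ?_
    rw [← mul_assoc, ← ENNReal.ofReal_mul (div_nonneg hφ'.le hφ.le)]
    congr 2
    field_simp
  · simp [φ_succ_last]

/-! ### The expected cost of one stage -/

variable (S)

/-- The expected value of `yᵀ s y`, where `y = (x, λ)` and `λ` has Pareto scales `ρ`. -/
def stageForm (n : ℕ) (x ρ : Fin m → ℝ) : ℝ :=
  x ⬝ᵥ ((S.s n).toBlocks₁₁ *ᵥ x)
    + (x ᵥ* (S.s n).toBlocks₁₂ + (S.s n).toBlocks₂₁ *ᵥ x) ⬝ᵥ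
      (Matrix.diagonal (pad m fun i => ∫ l, l i ∂(paretoPi (S.shape n) 1)) *ᵥ ρ)
    + ρ ⬝ᵥ (momentMatrix (paretoPi (S.shape n) 1) id id (S.s n).toBlocks₂₂ *ᵥ ρ)

lemma isQuadForm_stageForm (n : ℕ) : IsQuadForm (S.stageForm n) := by
  let D := Matrix.diagonal (pad m fun i => ∫ l, l i ∂(paretoPi (S.shape n) 1))
  have h := (((isQuadForm_bilin 1 0 1 0 (S.s n).toBlocks₁₁).add
    (isQuadForm_bilin 1 0 0 D (S.s n).toBlocks₁₂)).add
    (isQuadForm_bilin (S.s n).toBlocks₂₁ 0 0 D 1)).add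
    (isQuadForm_bilin 0 1 0 1 (momentMatrix (paretoPi (S.shape n) 1) id id (S.s n).toBlocks₂₂))
  convert h using 3 with x ρ
  simp only [stageForm, one_mulVec, zero_mulVec, add_zero, zero_add, add_dotProduct,
    ← dotProduct_mulVec, D]
  ring

/-- The matrix `s` is not assumed symmetric, so both off-diagonal blocks enter the part linear in
`l`. -/
lemma sumElim_dotProduct_mulVec (s : Matrix (Fin m ⊕ Fin m) (Fin m ⊕ Fin m) ℝ)
    (x l : Fin m → ℝ) :
    Sum.elim x l ⬝ᵥ (s *ᵥ Sum.elim x l) = x ⬝ᵥ (s.toBlocks₁₁ *ᵥ x)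
      + (x ᵥ* s.toBlocks₁₂ + s.toBlocks₂₁ *ᵥ x) ⬝ᵥ l + l ⬝ᵥ (s.toBlocks₂₂ *ᵥ l) := by
  conv_lhs => rw [← fromBlocks_toBlocks s, fromBlocks_mulVec]
  simp only [Sum.elim_comp_inl, Sum.elim_comp_inr, sumElim_dotProduct_sumElim, dotProduct_add,
    add_dotProduct, ← dotProduct_mulVec]
  rw [dotProduct_comm l (s.toBlocks₂₁ *ᵥ x)]
  ring

lemma lintegral_joint_fst (γ ρ : Fin k → ℝ) {f : (Fin k → ℝ) → ℝ≥0∞} (hf : Measurable f) :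
    ∫⁻ z, f z.1 ∂(S.joint γ ρ) = ∫⁻ l, f (ρ * l) ∂(paretoPi γ 1) := by
  have hg : Measurable fun l : Fin k → ℝ => f (ρ * l) := hf.comp (by fun_prop)
  rw [joint, lintegral_map (hf.fun_comp measurable_fst) (S.measurable_joint_fun' ρ)]
  refine (lintegral_prod _ (hg.comp measurable_fst).aemeasurable).trans ?_
  simp

variable {S}

/-- At time `n` the history fixes state and control, and only `λ` is random. Substituting `λ = ρ *
l` with `l` of Pareto scale 1 leaves first and second moments of `l`. -/
lemma IsValid.expCost_self (hS : S.IsValid) (r : Fin k → ℝ)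
    (x0 : Fin m → ℝ) {n : ℕ} (hn : n ≤ S.M) (us : ℕ → Fin m → ℝ) (vs : ℕ → Fin k → ℝ)
    (U : Policy m) :
    let u := S.nextControl U x0 n us vs
    let c := S.stageForm n (S.state (.openLoop us) x0 vs n) (pad m (scale r vs n))
      + u ⬝ᵥ (S.κ n *ᵥ u)
    S.expCost r x0 n us vs U n = ENNReal.ofReal c ∧ 0 ≤ c := by
  intro u c
  let x := S.state (.openLoop us) x0 vs n
  let ρ := scale r vs n
  let F : (Fin k → ℝ) → ℝ := fun l => Sum.elim x (pad m l) ⬝ᵥ (S.s n *ᵥ Sum.elim x (pad m l))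
    + u ⬝ᵥ (S.κ n *ᵥ u)
  have hF0 : ∀ l, 0 ≤ F l := fun l => add_nonneg (hS.s_nonneg n hn _) (hS.κ_nonneg n hn _)
  have hcost : ∀ z : (Fin k → ℝ) × (Fin S.M → Fin k → ℝ),
      S.stageCost (U.withPast n us) x0 z.1 (S.splice n vs z.2) n = F z.1 := fun z => by
    have h1 := S.path_withPast_splice U x0 n us vs z.2
    have h2 : S.state (U.withPast n us) x0 (S.splice n vs z.2) n = x := by
      simp only [state, h1, x]
    have h3 : S.control (U.withPast n us) x0 (S.splice n vs z.2) n = u := by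
      simp only [control, h1, Policy.withPast, lt_irrefl, if_false, u, nextControl]
    rw [stageCost, h2, h3]
  have hFeq : ∀ l, F l = x ⬝ᵥ ((S.s n).toBlocks₁₁ *ᵥ x)
      + (x ᵥ* (S.s n).toBlocks₁₂ + (S.s n).toBlocks₂₁ *ᵥ x) ⬝ᵥ pad m l
      + pad m l ⬝ᵥ ((S.s n).toBlocks₂₂ *ᵥ pad m l) + u ⬝ᵥ (S.κ n *ᵥ u) := fun l => by
    simp only [F, sumElim_dotProduct_mulVec]
  have hFm : Measurable F := by
    have hp := measurable_pad (k := k) m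
    rw [funext hFeq]
    exact ((measurable_const.add (measurable_dotProduct measurable_const hp)).add
      (measurable_dotProduct hp ((measurable_mulVec _).comp hp))).add measurable_const
  have hprob := isProbabilityMeasure_paretoPi (hS.shape_pos n) (ρ := 1) fun _ => one_pos
  have hL2 := memLp_eval_paretoPi (hS.shape_gt n)
  have hL1 : ∀ i, Integrable (fun l : Fin k → ℝ => l i) (paretoPi (S.shape n) 1) := fun i =>
    (hL2 i).integrable one_le_two
  have i1 := integrable_dotProduct_pad_linear m hL1
    (x ᵥ* (S.s n).toBlocks₁₂ + (S.s n).toBlocks₂₁ *ᵥ x) ρ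
  have i2 := integrable_dotProduct_pad (X := id) (Y := id) m hL2 hL2 ρ (S.s n).toBlocks₂₂
  have i3 := ((integrable_const (x ⬝ᵥ ((S.s n).toBlocks₁₁ *ᵥ x))).add i1).add i2
  have hint : Integrable (fun l => F (ρ * l)) (paretoPi (S.shape n) 1) := by
    simp only [hFeq]
    exact i3.add (integrable_const _)
  have hc : ∫ l, F (ρ * l) ∂(paretoPi (S.shape n) 1) = c := by
    simp only [hFeq]
    refine (integral_add' i3 (integrable_const _)).trans ?_
    rw [integral_add' ((integrable_const _).add i1) i2,
      integral_add' (integrable_const _) i1, integral_dotProduct_pad_linear m hL1]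
    have := integral_dotProduct_pad (X := id) (Y := id) m hL2 hL2 ρ (S.s n).toBlocks₂₂
    rw [this]
    simp only [integral_const, probReal_univ, one_smul]
    simp only [c, stageForm, diagonal_pad_mulVec]
    rw [mul_comm ρ]
  refine ⟨?_, hc ▸ integral_nonneg fun l => hF0 _⟩
  rw [expCost]
  simp only [hcost]
  rw [S.lintegral_joint_fst _ _ hFm.ennreal_ofReal,
    ← ofReal_integral_eq_lintegral_ofReal hint (Filter.Eventually.of_forall fun l => hF0 _), hc]

/-! ### The expected Bayes risk of the next stage -/

variable (S)

/-- `A`, `B`, `C` are the coefficients of the Bayes risk at time `n`. -/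
def IsRiskFormAt (n : ℕ) (A B C : Matrix (Fin m) (Fin m) ℝ) : Prop :=
  A.IsSymm ∧
    ∀ (r : Fin k → ℝ) (x0 : Fin m → ℝ) (us : ℕ → Fin m → ℝ) (vs : ℕ → Fin k → ℝ),
      (∀ i, 0 < r i) → (∀ j i, 0 ≤ vs j i) →
      S.W r x0 n us vs ≠ ∞ ∧
      (S.W r x0 n us vs).toReal =
        S.state (.openLoop us) x0 vs n ⬝ᵥ (A *ᵥ S.state (.openLoop us) x0 vs n)
        + 2 * (S.state (.openLoop us) x0 vs n ⬝ᵥ (B *ᵥ pad m (scale r vs n)))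
        + 2 * (pad m (scale r vs n) ⬝ᵥ (C *ᵥ pad m (scale r vs n)))

/-- The matrix of the quadratic form in `r_n` that arises from the second moments of the disturbance
and of the next posterior parameter. -/
def nextMoments (n : ℕ) (A B C : Matrix (Fin m) (Fin m) ℝ) : Matrix (Fin m) (Fin m) ℝ :=
  momentMatrix (base (S.shape n)) (fun z => z.1 * z.2) (fun z => z.1 * z.2)
      ((S.c n)ᵀ * A * S.c n)
    + (2 : ℝ) • momentMatrix (base (S.shape n)) (fun z => z.1 * z.2) (fun z => 1 ⊔ z.1 * z.2)
      ((S.c n)ᵀ * B)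
    + (2 : ℝ) • momentMatrix (base (S.shape n)) (fun z => 1 ⊔ z.1 * z.2)
      (fun z => 1 ⊔ z.1 * z.2) C

/-- The expected Bayes risk at time `n + 1`, where `y = α_n x_n + b_n u_n`. -/
def nextForm (n : ℕ) (A B C : Matrix (Fin m) (Fin m) ℝ) (y ρ : Fin m → ℝ) : ℝ :=
  y ⬝ᵥ (A *ᵥ y) + 2 * (y ⬝ᵥ ((A * S.c n * S.Q n + B * S.Q₂ n) *ᵥ ρ))
    + ρ ⬝ᵥ (S.nextMoments n A B C *ᵥ ρ)

variable {S}

/-- With `X = z.1 * z.2` and `Y = 1 ⊔ X`, the disturbance is `ρ * X` and the next scale is `ρ * Y`.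
In the expansion of `q`, the terms linear in `X` and `Y` produce `Q` and `Q₂`, and the quadratic
ones form `nextMoments`. -/
lemma IsValid.integral_next (hS : S.IsValid) (n : ℕ) {A : Matrix (Fin m) (Fin m) ℝ}
    (hA : A.IsSymm) (B C : Matrix (Fin m) (Fin m) ℝ) (y : Fin m → ℝ) (ρ : Fin k → ℝ)
    (q : (Fin m → ℝ) → (Fin m → ℝ) → ℝ)
    (hq : ∀ x ρ, q x ρ = x ⬝ᵥ (A *ᵥ x) + 2 * (x ⬝ᵥ (B *ᵥ ρ)) + 2 * (ρ ⬝ᵥ (C *ᵥ ρ))) :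
    let F := fun z : (Fin k → ℝ) × (Fin k → ℝ) =>
      q (y + S.c n *ᵥ pad m (ρ * (z.1 * z.2))) (pad m (ρ * (1 ⊔ z.1 * z.2)))
    Integrable F (base (S.shape n)) ∧
      ∫ z, F z ∂(base (S.shape n)) = S.nextForm n A B C y (pad m ρ) := by
  intro F
  have hprob := isProbabilityMeasure_base (hS.shape_gt n)
  let X : (Fin k → ℝ) × (Fin k → ℝ) → Fin k → ℝ := fun z => z.1 * z.2
  let Y : (Fin k → ℝ) × (Fin k → ℝ) → Fin k → ℝ := fun z => 1 ⊔ z.1 * z.2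
  have hX := memLp_mul_base (hS.shape_gt n)
  have hY := memLp_max_base (hS.shape_gt n)
  have hX1 : ∀ i, Integrable (fun z => X z i) (base (S.shape n)) := fun i =>
    (hX i).integrable one_le_two
  have hY1 : ∀ i, Integrable (fun z => Y z i) (base (S.shape n)) := fun i =>
    (hY i).integrable one_le_two
  let c := S.c n
  have hcc : ∀ (v w : Fin m → ℝ) (D : Matrix (Fin m) (Fin m) ℝ),
      (c *ᵥ v) ⬝ᵥ (D *ᵥ w) = v ⬝ᵥ ((cᵀ * D) *ᵥ w) := fun v w D => by
    rw [← mulVec_mulVec, dotProduct_mulVec_transpose, dotProduct_comm]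
  have hF : ∀ z, F z = y ⬝ᵥ (A *ᵥ y) + 2 * ((y ᵥ* (A * c)) ⬝ᵥ pad m (ρ * X z))
      + 2 * ((y ᵥ* B) ⬝ᵥ pad m (ρ * Y z))
      + pad m (ρ * X z) ⬝ᵥ ((cᵀ * A * c) *ᵥ pad m (ρ * X z))
      + 2 * (pad m (ρ * X z) ⬝ᵥ ((cᵀ * B) *ᵥ pad m (ρ * Y z)))
      + 2 * (pad m (ρ * Y z) ⬝ᵥ (C *ᵥ pad m (ρ * Y z))) := fun z => by
    have e : (c *ᵥ pad m (ρ * X z)) ⬝ᵥ (A *ᵥ y) = y ⬝ᵥ (A *ᵥ (c *ᵥ pad m (ρ * X z))) :=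
      hA.dotProduct_mulVec_comm _ _
    simp only [F, hq]
    change (y + c *ᵥ pad m (ρ * X z)) ⬝ᵥ (A *ᵥ (y + c *ᵥ pad m (ρ * X z)))
      + 2 * ((y + c *ᵥ pad m (ρ * X z)) ⬝ᵥ (B *ᵥ pad m (ρ * Y z)))
      + 2 * (pad m (ρ * Y z) ⬝ᵥ (C *ᵥ pad m (ρ * Y z))) = _
    simp only [mulVec_add, dotProduct_add, add_dotProduct, e]
    simp only [← dotProduct_mulVec, hcc, mulVec_mulVec, Matrix.mul_assoc]
    ring
  have iX := (integrable_dotProduct_pad_linear m hX1 (y ᵥ* (A * c)) ρ).const_mul 2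
  have iY := (integrable_dotProduct_pad_linear m hY1 (y ᵥ* B) ρ).const_mul 2
  have iXX := integrable_dotProduct_pad (X := X) (Y := X) m hX hX ρ (cᵀ * A * c)
  have iXY := (integrable_dotProduct_pad (X := X) (Y := Y) m hX hY ρ (cᵀ * B)).const_mul 2
  have iYY := (integrable_dotProduct_pad (X := Y) (Y := Y) m hY hY ρ C).const_mul 2
  have i0 : Integrable (fun _ : (Fin k → ℝ) × (Fin k → ℝ) => y ⬝ᵥ (A *ᵥ y))
    (base (S.shape n)) := integrable_const _
  refine ⟨by
    rw [funext hF]; exact ((((i0.add iX).add iY).add iXX).add iXY).add iYY, ?_⟩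
  rw [funext hF]
  refine (integral_add' ((((i0.add iX).add iY).add iXX).add iXY) iYY).trans ?_
  rw [integral_add' (((i0.add iX).add iY).add iXX) iXY,
    integral_add' ((i0.add iX).add iY) iXX, integral_add' (i0.add iX) iY, integral_add' i0 iX]
  simp only [integral_const_mul]
  rw [integral_dotProduct_pad_linear m hX1, integral_dotProduct_pad_linear m hY1,
    integral_dotProduct_pad (X := X) (Y := X) m hX hX ρ,
    integral_dotProduct_pad (X := X) (Y := Y) m hX hY ρ,
    integral_dotProduct_pad (X := Y) (Y := Y) m hY hY ρ]
  have eX : pad m (ρ * fun i => ∫ z, X z i ∂(base (S.shape n))) = S.Q n *ᵥ pad m ρ := by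
    rw [Q, diagonal_pad_mulVec, mul_comm]
    congr 2; ext i
    exact integral_mul_base (hS.shape_gt n) i
  have eY : pad m (ρ * fun i => ∫ z, Y z i ∂(base (S.shape n))) = S.Q₂ n *ᵥ pad m ρ := by
    rw [Q₂, diagonal_pad_mulVec, mul_comm]
    congr 2; ext i
    exact integral_max_base (hS.shape_gt n) i
  rw [eX, eY]
  simp only [integral_const, probReal_univ, nextForm, nextMoments, add_mulVec,
    dotProduct_add, smul_mulVec, dotProduct_smul, smul_eq_mul, ← dotProduct_mulVec,
    ← mulVec_mulVec, c, X, Y]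
  ring

/-- The quadratic formula for the Bayes risk holds for nonnegative disturbances, hence almost surely
under `pred`; its values are nonnegative because they are values of a risk. -/
lemma IsValid.lintegral_W_next (hS : S.IsValid) {n : ℕ} {A B C : Matrix (Fin m) (Fin m) ℝ}
    (hABC : S.IsRiskFormAt (n + 1) A B C) {r : Fin k → ℝ} (hr : ∀ i, 0 < r i) (x0 : Fin m → ℝ)
    (us : ℕ → Fin m → ℝ) {vs : ℕ → Fin k → ℝ} (hvs : ∀ j i, 0 ≤ vs j i) (u : Fin m → ℝ) :
    let c := S.nextForm n A B C (S.α n *ᵥ S.state (.openLoop us) x0 vs n + S.b n *ᵥ u)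
      (pad m (scale r vs n))
    ∫⁻ v, S.W r x0 (n + 1) (Function.update us n u) (Function.update vs n v)
      ∂(pred (S.shape n) (scale r vs n)) = ENNReal.ofReal c ∧ 0 ≤ c := by
  intro c
  set y := S.α n *ᵥ S.state (.openLoop us) x0 vs n + S.b n *ᵥ u with hy
  set ρ := scale r vs n with hρ
  have hρ0 : ∀ i, 0 < ρ i := scale_pos hr vs n
  let q : (Fin m → ℝ) → (Fin m → ℝ) → ℝ := fun x ρ =>
    x ⬝ᵥ (A *ᵥ x) + 2 * (x ⬝ᵥ (B *ᵥ ρ)) + 2 * (ρ ⬝ᵥ (C *ᵥ ρ))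
  have hW : ∀ v : Fin k → ℝ, (∀ i, 0 ≤ v i) →
      S.W r x0 (n + 1) (Function.update us n u) (Function.update vs n v)
        = ENNReal.ofReal (q (y + S.c n *ᵥ pad m v) (pad m (ρ ⊔ v))) ∧
      0 ≤ q (y + S.c n *ᵥ pad m v) (pad m (ρ ⊔ v)) := fun v hv => by
    obtain ⟨h1, h2⟩ := hABC.2 r x0 (Function.update us n u) (Function.update vs n v) hr
      (update_nonneg hvs n hv)
    rw [state_openLoop_update, scale_update, ← hy, ← hρ] at h2
    change _ = q _ _ at h2
    rw [← h2]
    exact ⟨(ENNReal.ofReal_toReal h1).symm, ENNReal.toReal_nonneg⟩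
  obtain ⟨hint, hval⟩ := hS.integral_next n hABC.1 B C y ρ q fun _ _ => rfl
  -- Homogeneity of the scale update, from positivity of `ρ`.
  have hmul : ∀ z : (Fin k → ℝ) × (Fin k → ℝ),
      ρ ⊔ ρ * z.1 * z.2 = ρ * (1 ⊔ z.1 * z.2) := fun z => by
    ext i
    change max (ρ i) (ρ i * z.1 i * z.2 i) = ρ i * max 1 (z.1 i * z.2 i)
    rw [mul_max_of_nonneg _ _ (hρ0 i).le, mul_one, mul_assoc]
  have hqm : Measurable fun v : Fin k → ℝ =>
      ENNReal.ofReal (q (y + S.c n *ᵥ pad m v) (pad m (ρ ⊔ v))) := by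
    have h1 : Measurable fun v : Fin k → ℝ => y + S.c n *ᵥ pad m v :=
      measurable_const.add ((measurable_mulVec _).comp (measurable_pad m))
    have h2 : Measurable fun v : Fin k → ℝ => pad m (ρ ⊔ v) :=
      (measurable_pad m).comp (measurable_sup_pi ρ)
    exact (((measurable_dotProduct h1 ((measurable_mulVec _).comp h1)).add
      ((measurable_dotProduct h1 ((measurable_mulVec _).comp h2)).const_mul 2)).add
      ((measurable_dotProduct h2 ((measurable_mulVec _).comp h2)).const_mul 2)).ennreal_ofReal
  have hnn : ∀ᵐ z ∂(base (S.shape n)), 0 ≤ q (y + S.c n *ᵥ pad m (ρ * (z.1 * z.2)))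
      (pad m (ρ * (1 ⊔ z.1 * z.2))) := by
    filter_upwards [ae_base (S.shape n)] with z hz
    have := (hW (ρ * z.1 * z.2) fun i => mul_nonneg (mul_nonneg (hρ0 i).le
      (zero_le_one.trans (hz i).1)) (hz i).2.1).2
    rwa [hmul, mul_assoc] at this
  refine ⟨?_, ?_⟩
  · have h1 : ∀ᵐ v ∂(pred (S.shape n) ρ),
        S.W r x0 (n + 1) (Function.update us n u) (Function.update vs n v)
        = ENNReal.ofReal (q (y + S.c n *ᵥ pad m v) (pad m (ρ ⊔ v))) := by
      filter_upwards [ae_pred (γ := S.shape n) hρ0] with v hv using (hW v hv).1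
    rw [lintegral_congr_ae h1, pred, lintegral_map hqm (measurable_pred_fun ρ)]
    simp only [hmul]
    simp only [mul_assoc]
    change ∫⁻ z, _ ∂(base (S.shape n)) = _
    rw [← ofReal_integral_eq_lintegral_ofReal hint hnn, hval]
  · change 0 ≤ S.nextForm n A B C y (pad m ρ)
    rw [← hval]
    exact integral_nonneg_of_ae hnn

end LinSystem
end

noncomputable section

namespace LinSystem

variable {m k : ℕ} (S : LinSystem m k)

/-! ### The Bellman equation -/

/-- The part of the right-hand side of the Bellman equation that does not depend on the control. -/
def bellmanConst (A B C : ℕ → Matrix (Fin m) (Fin m) ℝ) (n : ℕ) (x ρ : Fin m → ℝ) : ℝ :=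
  S.stageForm n x ρ + S.φ (n + 1) / S.φ n *
    S.nextForm n (A (n + 1)) (B (n + 1)) (C (n + 1)) (S.α n *ᵥ x) ρ

/-- The right-hand side of the Bellman equation as a function of the control `u`. -/
def bellmanForm (A B C : ℕ → Matrix (Fin m) (Fin m) ℝ) (n : ℕ) (x ρ u : Fin m → ℝ) : ℝ :=
  u ⬝ᵥ (S.K A n *ᵥ u) - 2 * (u ⬝ᵥ S.L A B n x ρ) + S.bellmanConst A B C n x ρ

lemma isQuadForm_bellmanConst (A B C : ℕ → Matrix (Fin m) (Fin m) ℝ) (n : ℕ) :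
    IsQuadForm (S.bellmanConst A B C n) := by
  let D := A (n + 1) * S.c n * S.Q n + B (n + 1) * S.Q₂ n
  have h := (S.isQuadForm_stageForm n).add
    ((((isQuadForm_bilin (S.α n) 0 (S.α n) 0 (A (n + 1))).add
      ((isQuadForm_bilin (S.α n) 0 0 D 1).const_mul 2)).add
      (isQuadForm_bilin 0 1 0 1 (S.nextMoments n (A (n + 1)) (B (n + 1)) (C (n + 1))))).const_mul
      (S.φ (n + 1) / S.φ n))
  convert h using 3 with x ρ
  simp only [bellmanConst, nextForm, one_mulVec, zero_mulVec, add_zero, zero_add, D]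

lemma isQuadForm_dotProduct_L (A B : ℕ → Matrix (Fin m) (Fin m) ℝ) (n : ℕ)
    (G : Matrix (Fin m) (Fin m) ℝ) :
    IsQuadForm fun x ρ => S.L A B n x ρ ⬝ᵥ (G *ᵥ S.L A B n x ρ) := by
  let q := S.φ (n + 1) / S.φ n
  have h := isQuadForm_bilin (-(q • ((S.b n)ᵀ * (A (n + 1) * S.α n))))
    (-(q • ((S.b n)ᵀ * (A (n + 1) * S.c n * S.Q n + B (n + 1) * S.Q₂ n))))
    (-(q • ((S.b n)ᵀ * (A (n + 1) * S.α n))))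
    (-(q • ((S.b n)ᵀ * (A (n + 1) * S.c n * S.Q n + B (n + 1) * S.Q₂ n)))) G
  have e : ∀ x ρ, S.L A B n x ρ = -(q • ((S.b n)ᵀ * (A (n + 1) * S.α n))) *ᵥ x
      + -(q • ((S.b n)ᵀ * (A (n + 1) * S.c n * S.Q n + B (n + 1) * S.Q₂ n))) *ᵥ ρ := fun x ρ => by
    simp only [L, q, neg_mulVec, smul_mulVec, mulVec_add, smul_add, neg_add, mulVec_mulVec]
  simp only [e]
  exact h

/-- Expanding the form at `α x + b u`, symmetry of `A (n + 1)` merges the two cross terms; together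
with the mean terms they make up `-2 uᵀ L`. -/
lemma bellmanForm_eq {A : ℕ → Matrix (Fin m) (Fin m) ℝ} (B C : ℕ → Matrix (Fin m) (Fin m) ℝ)
    {n : ℕ} (hA : (A (n + 1)).IsSymm) (x ρ u : Fin m → ℝ) :
    S.bellmanForm A B C n x ρ u = S.stageForm n x ρ + u ⬝ᵥ (S.κ n *ᵥ u)
      + S.φ (n + 1) / S.φ n * S.nextForm n (A (n + 1)) (B (n + 1)) (C (n + 1))
        (S.α n *ᵥ x + S.b n *ᵥ u) ρ := by
  let D := A (n + 1) * S.c n * S.Q n + B (n + 1) * S.Q₂ n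
  have hb : ∀ w : Fin m → ℝ, u ⬝ᵥ ((S.b n)ᵀ *ᵥ w) = (S.b n *ᵥ u) ⬝ᵥ w := fun w => by
    rw [dotProduct_mulVec_transpose, dotProduct_comm]
  have h1 : (S.α n *ᵥ x) ⬝ᵥ (A (n + 1) *ᵥ (S.b n *ᵥ u))
      = (S.b n *ᵥ u) ⬝ᵥ (A (n + 1) *ᵥ (S.α n *ᵥ x)) := hA.dotProduct_mulVec_comm _ _
  simp only [bellmanForm, bellmanConst, K, L, nextForm, add_mulVec, smul_mulVec, dotProduct_add,
    dotProduct_neg, dotProduct_smul, smul_eq_mul, ← mulVec_mulVec, hb, mulVec_add, add_dotProduct,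
    h1]
  ring

variable {S}

lemma IsValid.isSymm_K (hS : S.IsValid) {A : ℕ → Matrix (Fin m) (Fin m) ℝ} {n : ℕ} (hn : n ≤ S.M)
    (hA : (A (n + 1)).IsSymm) : (S.K A n).IsSymm := by
  refine (hS.κ_symm n hn).add (IsSymm.smul ?_ _)
  rw [IsSymm, transpose_mul, transpose_mul, transpose_transpose, hA.eq, Matrix.mul_assoc]

/-- The cost of following `U` at time `n` and acting optimally afterwards. The sign of `J` is read
off from expected losses and risks, not from the matrices; solvability of `K u = L` rests on it. -/
lemma IsValid.bellman (hS : S.IsValid) {A B C : ℕ → Matrix (Fin m) (Fin m) ℝ} {n : ℕ}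
    (hn : n ≤ S.M) (hABC : S.IsRiskFormAt (n + 1) (A (n + 1)) (B (n + 1)) (C (n + 1)))
    {r : Fin k → ℝ} (hr : ∀ i, 0 < r i) (x0 : Fin m → ℝ) (us : ℕ → Fin m → ℝ)
    {vs : ℕ → Fin k → ℝ} (hvs : ∀ j i, 0 ≤ vs j i) (U : Policy m) :
    let J := S.bellmanForm A B C n (S.state (.openLoop us) x0 vs n) (pad m (scale r vs n))
      (S.nextControl U x0 n us vs)
    S.expCost r x0 n us vs U n + ENNReal.ofReal (S.φ (n + 1) / S.φ n) *
      ∫⁻ v, S.W r x0 (n + 1) (Function.update us n (S.nextControl U x0 n us vs))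
        (Function.update vs n v) ∂(pred (S.shape n) (scale r vs n)) = ENNReal.ofReal J ∧ 0 ≤ J := by
  intro J
  obtain ⟨h1, h2⟩ := hS.expCost_self r x0 hn us vs U
  obtain ⟨h3, h4⟩ := hS.lintegral_W_next hABC hr x0 us hvs (S.nextControl U x0 n us vs)
  have hq : 0 ≤ S.φ (n + 1) / S.φ n := div_nonneg (hS.φ_nonneg _) (hS.φ_nonneg _)
  have hJ := S.bellmanForm_eq B C hABC.1 (S.state (.openLoop us) x0 vs n) (pad m (scale r vs n))
    (S.nextControl U x0 n us vs)
  rw [h1, h3, ← ENNReal.ofReal_mul hq, ← ENNReal.ofReal_add h2 (mul_nonneg hq h4), ← hJ]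
  exact ⟨rfl, hJ.ge.trans' (add_nonneg h2 (mul_nonneg hq h4))⟩

lemma IsValid.bellmanForm_nonneg (hS : S.IsValid) {A B C : ℕ → Matrix (Fin m) (Fin m) ℝ} {n : ℕ}
    (hn : n ≤ S.M) (hABC : S.IsRiskFormAt (n + 1) (A (n + 1)) (B (n + 1)) (C (n + 1)))
    {r : Fin k → ℝ} (hr : ∀ i, 0 < r i) (x0 : Fin m → ℝ) (us : ℕ → Fin m → ℝ)
    {vs : ℕ → Fin k → ℝ} (hvs : ∀ j i, 0 ≤ vs j i) (u : Fin m → ℝ) :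
    0 ≤ S.bellmanForm A B C n (S.state (.openLoop us) x0 vs n) (pad m (scale r vs n)) u :=
  -- The constant policy makes the next control an arbitrary `u`.
  (hS.bellman hn hABC hr x0 us hvs fun _ _ => u).2

lemma IsValid.exists_control (hS : S.IsValid) {A B C : ℕ → Matrix (Fin m) (Fin m) ℝ} {n : ℕ}
    (hn : n ≤ S.M) (hABC : S.IsRiskFormAt (n + 1) (A (n + 1)) (B (n + 1)) (C (n + 1)))
    {r : Fin k → ℝ} (hr : ∀ i, 0 < r i) (x0 : Fin m → ℝ) (us : ℕ → Fin m → ℝ)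
    {vs : ℕ → Fin k → ℝ} (hvs : ∀ j i, 0 ≤ vs j i) :
    ∃ u, S.K A n *ᵥ u
      = S.L A B n (S.state (.openLoop us) x0 vs n) (pad m (scale r vs n)) :=
  exists_critical_point (hS.isSymm_K hn hABC.1)
    fun u => hS.bellmanForm_nonneg hn hABC hr x0 us hvs u

/-- Boundedness below makes `K` positive semidefinite. Then `J u - J u' = (u - u')ᵀ K (u - u')` is
nonnegative and vanishes only if `K (u - u') = 0`. -/
lemma IsValid.bellmanForm_min (hS : S.IsValid) {A B C : ℕ → Matrix (Fin m) (Fin m) ℝ} {n : ℕ}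
    (hn : n ≤ S.M) (hABC : S.IsRiskFormAt (n + 1) (A (n + 1)) (B (n + 1)) (C (n + 1)))
    {r : Fin k → ℝ} (hr : ∀ i, 0 < r i) (x0 : Fin m → ℝ) (us : ℕ → Fin m → ℝ)
    {vs : ℕ → Fin k → ℝ} (hvs : ∀ j i, 0 ≤ vs j i) {u' : Fin m → ℝ}
    (hu' : S.K A n *ᵥ u'
      = S.L A B n (S.state (.openLoop us) x0 vs n) (pad m (scale r vs n))) (u : Fin m → ℝ) :
    let J := S.bellmanForm A B C n (S.state (.openLoop us) x0 vs n) (pad m (scale r vs n))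
    J u' ≤ J u ∧ (J u = J u' ↔ S.K A n *ᵥ u
      = S.L A B n (S.state (.openLoop us) x0 vs n) (pad m (scale r vs n))) := by
  intro J
  have hK := hS.isSymm_K hn hABC.1
  have hpos : ∀ w, 0 ≤ w ⬝ᵥ (S.K A n *ᵥ w) :=
    quadratic_part_nonneg fun u => hS.bellmanForm_nonneg hn hABC hr x0 us hvs u
  have h : ∀ u, J u = _ := fun u => quadratic_eq_add_sq hK hu' u _
  have h' := h u'
  rw [sub_self, mulVec_zero, dotProduct_zero, add_zero] at h'
  have h'' : J u = J u' + (u - u') ⬝ᵥ (S.K A n *ᵥ (u - u')) := by rw [h u, h']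
  refine ⟨by rw [h'']; linarith [hpos (u - u')], fun e => ?_, fun e => ?_⟩
  · have h0 := mulVec_eq_zero_of_dotProduct_eq_zero hK hpos (w := u - u') (by linarith)
    rw [mulVec_sub, sub_eq_zero] at h0
    rw [h0, hu']
  · rw [h'', mulVec_sub, e, hu', sub_self, dotProduct_zero, add_zero]

lemma W_le (S : LinSystem m k) (r : Fin k → ℝ) (x0 : Fin m → ℝ) (n : ℕ) (us : ℕ → Fin m → ℝ)
    (vs : ℕ → Fin k → ℝ) {U : Policy m} (hU : U.IsAdmissible) :
    S.W r x0 n us vs ≤ S.condRisk r x0 n us vs U :=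
  iInf₂_le U hU

lemma IsValid.bellmanForm_le_condRisk (hS : S.IsValid) {A B C : ℕ → Matrix (Fin m) (Fin m) ℝ}
    {n : ℕ} (hn : n ≤ S.M) (hABC : S.IsRiskFormAt (n + 1) (A (n + 1)) (B (n + 1)) (C (n + 1)))
    {r : Fin k → ℝ} (hr : ∀ i, 0 < r i) (x0 : Fin m → ℝ) (us : ℕ → Fin m → ℝ)
    {vs : ℕ → Fin k → ℝ} (hvs : ∀ j i, 0 ≤ vs j i) {U : Policy m} (hU : U.IsAdmissible) :
    ENNReal.ofReal (S.bellmanForm A B C n (S.state (.openLoop us) x0 vs n)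
      (pad m (scale r vs n)) (S.nextControl U x0 n us vs)) ≤ S.condRisk r x0 n us vs U := by
  rw [hS.condRisk_succ hr x0 hn us hvs hU, ← (hS.bellman hn hABC hr x0 us hvs U).1]
  gcongr
  exact S.W_le r x0 (n + 1) _ _ hU

/-- A policy sees states and controls, not disturbances; `R` recovers `r_n` from them, and one
generalized inverse then serves all histories. -/
lemma IsValid.exists_feedback (hS : S.IsValid)
    (hc : ∀ n < S.M, Function.Injective fun v : Fin k → ℝ => S.c n *ᵥ pad m v)
    {A B C : ℕ → Matrix (Fin m) (Fin m) ℝ} {n : ℕ}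
    (hn : n ≤ S.M) (hABC : S.IsRiskFormAt (n + 1) (A (n + 1)) (B (n + 1)) (C (n + 1)))
    {r : Fin k → ℝ} (hr : ∀ i, 0 < r i) :
    ∃ F : (Fin (n + 1) → Fin m → ℝ) × (Fin n → Fin m → ℝ) → Fin m → ℝ, Measurable F ∧
      ∀ (x0 : Fin m → ℝ) (us : ℕ → Fin m → ℝ) (vs : ℕ → Fin k → ℝ), (∀ j i, 0 ≤ vs j i) →
        S.K A n *ᵥ F (S.path (.openLoop us) x0 vs n)
          = S.L A B n (S.state (.openLoop us) x0 vs n) (pad m (scale r vs n)) := by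
  obtain ⟨R, hR, hR'⟩ := S.exists_scale_of_history hc r
  obtain ⟨G, hG⟩ := exists_generalized_inverse (S.K A n)
  refine ⟨fun h => G *ᵥ S.L A B n (h.1 (Fin.last n)) (pad m (R n h)), ?_, fun x0 us vs hvs => ?_⟩
  · have h1 : Measurable fun h : (Fin (n + 1) → Fin m → ℝ) × (Fin n → Fin m → ℝ) =>
        h.1 (Fin.last n) := (measurable_pi_apply _).comp measurable_fst
    have h2 : Measurable fun h : (Fin (n + 1) → Fin m → ℝ) × (Fin n → Fin m → ℝ) =>
        (S.b n)ᵀ *ᵥ ((A (n + 1) * S.α n) *ᵥ h.1 (Fin.last n)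
          + (A (n + 1) * S.c n * S.Q n + B (n + 1) * S.Q₂ n) *ᵥ pad m (R n h)) :=
      (measurable_mulVec _).comp (((measurable_mulVec _).comp h1).add
        ((measurable_mulVec _).comp ((measurable_pad m).comp (hR n))))
    exact (measurable_mulVec G).comp ((h2.const_smul (S.φ (n + 1) / S.φ n)).neg)
  · simp only [hR' n hn]
    exact hG _ (hS.exists_control hn hABC hr x0 us hvs)

lemma condRisk_congr (S : LinSystem m k) (r : Fin k → ℝ) (x0 : Fin m → ℝ) (n : ℕ)
    (us : ℕ → Fin m → ℝ) (vs : ℕ → Fin k → ℝ) {U U' : Policy m} (h : ∀ i, n ≤ i → U i = U' i) :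
    S.condRisk r x0 n us vs U = S.condRisk r x0 n us vs U' := by
  have : U.withPast n us = U'.withPast n us := by
    ext1 i
    funext hist
    unfold Policy.withPast
    by_cases hi : i < n
    · rw [if_pos hi, if_pos hi]
    · rw [if_neg hi, if_neg hi, h i (not_lt.1 hi)]
  rw [condRisk, condRisk, this]

/-- Extension of an optimal policy by one step back in time, and the value of the Bayes risk. -/
lemma IsValid.exists_optimal_succ (hS : S.IsValid)
    (hc : ∀ n < S.M, Function.Injective fun v : Fin k → ℝ => S.c n *ᵥ pad m v)
    {A B C : ℕ → Matrix (Fin m) (Fin m) ℝ} {n : ℕ}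
    (hn : n ≤ S.M) (hABC : S.IsRiskFormAt (n + 1) (A (n + 1)) (B (n + 1)) (C (n + 1)))
    {r : Fin k → ℝ} (hr : ∀ i, 0 < r i)
    (hopt : ∃ U : Policy m, U.IsAdmissible ∧ ∀ x0 us vs, (∀ j i, 0 ≤ vs j i) →
      S.IsBayesFrom r x0 (n + 1) us vs U) :
    (∃ U : Policy m, U.IsAdmissible ∧ ∀ x0 us vs, (∀ j i, 0 ≤ vs j i) →
      S.IsBayesFrom r x0 n us vs U) ∧
    ∀ x0 us vs, (∀ j i, 0 ≤ vs j i) → ∀ u, S.K A n *ᵥ u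
      = S.L A B n (S.state (.openLoop us) x0 vs n) (pad m (scale r vs n)) →
      S.W r x0 n us vs = ENNReal.ofReal (S.bellmanForm A B C n (S.state (.openLoop us) x0 vs n)
        (pad m (scale r vs n)) u) := by
  obtain ⟨U, hU, hUopt⟩ := hopt
  obtain ⟨F, hF, hFK⟩ := hS.exists_feedback hc hn hABC hr
  -- Changing the control rule at time `n` alone leaves the problem from `n + 1` on untouched,
  -- because there the control at time `n` belongs to the given past.
  let U' : Policy m := Function.update U n F
  have hU' : U'.IsAdmissible := fun i => by
    by_cases h : i = n
    · subst h; simpa [U'] using hF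
    · simpa [U', Function.update_of_ne h] using hU i
  have hnext : ∀ x0 us vs, S.nextControl U' x0 n us vs = F (S.path (.openLoop us) x0 vs n) :=
    fun x0 us vs => by simp [nextControl, U']
  have hlower : ∀ x0 us vs, (∀ j i, 0 ≤ vs j i) → ∀ u, S.K A n *ᵥ u
      = S.L A B n (S.state (.openLoop us) x0 vs n) (pad m (scale r vs n)) →
      ENNReal.ofReal (S.bellmanForm A B C n (S.state (.openLoop us) x0 vs n)
        (pad m (scale r vs n)) u) ≤ S.W r x0 n us vs := fun x0 us vs hvs u hu =>
    le_iInf₂ fun V hV => (ENNReal.ofReal_le_ofReal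
      (hS.bellmanForm_min hn hABC hr x0 us hvs hu _).1).trans
      (hS.bellmanForm_le_condRisk hn hABC hr x0 us hvs hV)
  have hrisk : ∀ x0 us vs, (∀ j i, 0 ≤ vs j i) → ∀ u, S.K A n *ᵥ u
      = S.L A B n (S.state (.openLoop us) x0 vs n) (pad m (scale r vs n)) →
      S.condRisk r x0 n us vs U' = ENNReal.ofReal (S.bellmanForm A B C n
        (S.state (.openLoop us) x0 vs n) (pad m (scale r vs n)) u) := fun x0 us vs hvs u hu => by
    have hmin := (hS.bellmanForm_min hn hABC hr x0 us hvs hu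
      (S.nextControl U' x0 n us vs)).2.2 (by rw [hnext]; exact hFK x0 us vs hvs)
    rw [hS.condRisk_succ hr x0 hn us hvs hU', ← hmin, ← (hS.bellman hn hABC hr x0 us hvs U').1]
    congr 2
    refine lintegral_congr_ae ?_
    filter_upwards [ae_pred (γ := S.shape n) (scale_pos hr vs n)] with v hv
    rw [S.condRisk_congr r x0 (n + 1) _ _ (U := U') (U' := U) fun i hi =>
      Function.update_of_ne (by omega) _ _]
    exact hUopt x0 _ _ (update_nonneg hvs n hv)
  have hW : ∀ x0 us vs, (∀ j i, 0 ≤ vs j i) → ∀ u, S.K A n *ᵥ u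
      = S.L A B n (S.state (.openLoop us) x0 vs n) (pad m (scale r vs n)) →
      S.W r x0 n us vs = ENNReal.ofReal (S.bellmanForm A B C n (S.state (.openLoop us) x0 vs n)
        (pad m (scale r vs n)) u) := fun x0 us vs hvs u hu =>
    ((S.W_le r x0 n us vs hU').trans (hrisk x0 us vs hvs u hu).le).antisymm
      (hlower x0 us vs hvs u hu)
  refine ⟨⟨U', hU', fun x0 us vs hvs => ?_⟩, hW⟩
  obtain ⟨u, hu⟩ := hS.exists_control hn hABC hr x0 us hvs
  rw [IsBayesFrom, hrisk x0 us vs hvs u hu, hW x0 us vs hvs u hu]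

lemma condRisk_succ_last (S : LinSystem m k) (r : Fin k → ℝ) (x0 : Fin m → ℝ)
    (us : ℕ → Fin m → ℝ) (vs : ℕ → Fin k → ℝ) (U : Policy m) :
    S.condRisk r x0 (S.M + 1) us vs U = 0 := by
  simp [condRisk]

lemma W_succ_last (S : LinSystem m k) (r : Fin k → ℝ) (x0 : Fin m → ℝ)
    (us : ℕ → Fin m → ℝ) (vs : ℕ → Fin k → ℝ) : S.W r x0 (S.M + 1) us vs = 0 :=
  le_antisymm ((S.W_le r x0 _ us vs (U := fun _ _ => 0) fun _ => measurable_const).trans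
    (S.condRisk_succ_last r x0 us vs _).le) bot_le

/-- Starting the induction past the horizon, with an empty sum of costs, spares a separate treatment
of the last stage. -/
lemma isRiskFormAt_succ_last (S : LinSystem m k) : S.IsRiskFormAt (S.M + 1) 0 0 0 :=
  ⟨isSymm_zero, fun r x0 us vs _ _ => by simp [W_succ_last]⟩

/-- The minimum of the Bellman form is `bellmanConst - Lᵀ G L`. Since `G` depends only on `K`, the
new coefficients are the same for all priors and histories. -/
lemma IsValid.isRiskFormAt_of_succ (hS : S.IsValid)
    (hc : ∀ n < S.M, Function.Injective fun v : Fin k → ℝ => S.c n *ᵥ pad m v)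
    {A B C : ℕ → Matrix (Fin m) (Fin m) ℝ} {n : ℕ}
    (hn : n ≤ S.M) (hABC : S.IsRiskFormAt (n + 1) (A (n + 1)) (B (n + 1)) (C (n + 1)))
    (hopt : ∀ r : Fin k → ℝ, (∀ i, 0 < r i) → ∃ U : Policy m, U.IsAdmissible ∧
      ∀ x0 us vs, (∀ j i, 0 ≤ vs j i) → S.IsBayesFrom r x0 (n + 1) us vs U) :
    ∃ A' B' C', S.IsRiskFormAt n A' B' C' := by
  obtain ⟨G, hG⟩ := exists_generalized_inverse (S.K A n)
  obtain ⟨A', B', C', hA', hQ⟩ := (S.isQuadForm_bellmanConst A B C n).add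
    ((S.isQuadForm_dotProduct_L A B n G).const_mul (-1))
  refine ⟨A', B', C', hA', fun r x0 us vs hr hvs => ?_⟩
  set x := S.state (.openLoop us) x0 vs n
  set ρ := pad m (scale r vs n)
  have hu := hG _ (hS.exists_control hn hABC hr x0 us hvs)
  have hW := (hS.exists_optimal_succ hc hn hABC hr (hopt r hr)).2 x0 us vs hvs _ hu
  have hnn := hS.bellmanForm_nonneg hn hABC hr x0 us hvs (G *ᵥ S.L A B n x ρ)
  have hval : S.bellmanForm A B C n x ρ (G *ᵥ S.L A B n x ρ)
      = S.bellmanConst A B C n x ρ + -1 * (S.L A B n x ρ ⬝ᵥ (G *ᵥ S.L A B n x ρ)) := by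
    rw [bellmanForm, hu, dotProduct_comm (S.L A B n x ρ)]
    ring
  rw [hW]
  refine ⟨ENNReal.ofReal_ne_top, ?_⟩
  rw [ENNReal.toReal_ofReal hnn, ← hQ]
  exact hval

/-- Both claims are needed together: the coefficients at `n + 1` give the feedback at `n`, and an
optimal policy from `n + 1` on shows that the Bellman minimum is attained. The policy may depend on
`r`, the coefficients may not. -/
lemma IsValid.exists_riskForm_and_optimal (hS : S.IsValid)
    (hc : ∀ n < S.M, Function.Injective fun v : Fin k → ℝ => S.c n *ᵥ pad m v) (d : ℕ) :
    ∀ n, n + d = S.M + 1 → (∃ A B C, S.IsRiskFormAt n A B C) ∧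
      ∀ r : Fin k → ℝ, (∀ i, 0 < r i) → ∃ U : Policy m, U.IsAdmissible ∧
        ∀ x0 us vs, (∀ j i, 0 ≤ vs j i) → S.IsBayesFrom r x0 n us vs U := by
  induction d with
  | zero =>
    rintro n hn
    obtain rfl : n = S.M + 1 := hn
    refine ⟨⟨0, 0, 0, S.isRiskFormAt_succ_last⟩, fun r _ => ⟨fun _ _ => 0, fun _ =>
      measurable_const, fun x0 us vs _ => ?_⟩⟩
    rw [IsBayesFrom, condRisk_succ_last, W_succ_last]
  | succ d ih =>
    intro n hn
    obtain ⟨⟨A, B, C, hABC⟩, hopt⟩ := ih (n + 1) (by omega)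
    -- Only the entries with index `n + 1` are used, so constant sequences suffice.
    exact ⟨hS.isRiskFormAt_of_succ (A := fun _ => A) (B := fun _ => B) (C := fun _ => C) hc
      (by omega) hABC hopt, fun r hr => (hS.exists_optimal_succ (A := fun _ => A)
      (B := fun _ => B) (C := fun _ => C) hc (by omega) hABC hr (hopt r hr)).1⟩

lemma IsValid.exists_isRiskForm (hS : S.IsValid)
    (hc : ∀ n < S.M, Function.Injective fun v : Fin k → ℝ => S.c n *ᵥ pad m v) :
    ∃ A B C, S.IsRiskForm A B C := by
  have h : ∀ n, ∃ A B C, n ≤ S.M → S.IsRiskFormAt n A B C := fun n => by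
    by_cases hn : n ≤ S.M
    · obtain ⟨⟨A, B, C, h⟩, -⟩ :=
        hS.exists_riskForm_and_optimal hc (S.M + 1 - n) n (by omega)
      exact ⟨A, B, C, fun _ => h⟩
    · exact ⟨0, 0, 0, fun h => absurd h hn⟩
  choose A B C h using h
  exact ⟨A, B, C, h⟩

/-! ### Characterization of the Bayes policies -/

/-- A policy is a Bayes policy for the problem truncated at `n` if and only if its control at time
`n` solves the linear system and it is a Bayes policy from time `n + 1` on, almost surely. -/
lemma IsValid.isBayesFrom_iff_succ (hS : S.IsValid)
    (hc : ∀ n < S.M, Function.Injective fun v : Fin k → ℝ => S.c n *ᵥ pad m v)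
    {A B C : ℕ → Matrix (Fin m) (Fin m) ℝ} {n : ℕ}
    (hn : n ≤ S.M) (hABC : S.IsRiskFormAt (n + 1) (A (n + 1)) (B (n + 1)) (C (n + 1)))
    {r : Fin k → ℝ} (hr : ∀ i, 0 < r i) (x0 : Fin m → ℝ) (us : ℕ → Fin m → ℝ)
    {vs : ℕ → Fin k → ℝ} (hvs : ∀ j i, 0 ≤ vs j i) {U : Policy m} (hU : U.IsAdmissible) :
    S.IsBayesFrom r x0 n us vs U ↔
      S.K A n *ᵥ S.nextControl U x0 n us vs
        = S.L A B n (S.state (.openLoop us) x0 vs n) (pad m (scale r vs n)) ∧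
      ∀ᵐ v ∂(pred (S.shape n) (scale r vs n)), S.IsBayesFrom r x0 (n + 1)
        (Function.update us n (S.nextControl U x0 n us vs)) (Function.update vs n v) U := by
  have hopt := (hS.exists_riskForm_and_optimal hc (S.M + 1 - (n + 1)) (n + 1) (by omega)).2 r hr
  obtain ⟨u, hu⟩ := hS.exists_control hn hABC hr x0 us hvs
  have hW := (hS.exists_optimal_succ hc hn hABC hr hopt).2 x0 us vs hvs u hu
  obtain ⟨hJ, hJ0⟩ := hS.bellman hn hABC hr x0 us hvs U
  have hu0 := hS.bellmanForm_nonneg hn hABC hr x0 us hvs u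
  have hmin := (hS.bellmanForm_min hn hABC hr x0 us hvs hu (S.nextControl U x0 n us vs)).2
  have hrisk := hS.condRisk_succ hr x0 hn us hvs hU
  have hle := hS.bellmanForm_le_condRisk hn hABC hr x0 us hvs hU
  constructor
  · intro hB
    rw [IsBayesFrom] at hB
    -- For a Bayes policy, `J(u_n) ≤ condRisk = W = J(u)` with `u` a minimizer.
    have hle' : S.bellmanForm A B C n (S.state (.openLoop us) x0 vs n) (pad m (scale r vs n))
        (S.nextControl U x0 n us vs) ≤ S.bellmanForm A B C n (S.state (.openLoop us) x0 vs n)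
        (pad m (scale r vs n)) u := by
      rw [hB, hW] at hle
      exact (ENNReal.ofReal_le_ofReal_iff hu0).1 hle
    have heq := hle'.antisymm (hS.bellmanForm_min hn hABC hr x0 us hvs hu _).1
    refine ⟨hmin.1 heq, ?_⟩
    rcases hn.lt_or_eq with hn' | rfl
    -- Cancelling the finite stage cost and the positive factor `φ_{n+1} / φ_n` leaves equal
    -- integrals of `W` and `condRisk`. As `W ≤ condRisk` and the integral is finite, they agree
    -- almost everywhere.
    · have hq : ENNReal.ofReal (S.φ (n + 1) / S.φ n) ≠ 0 :=
        (ENNReal.ofReal_pos.2 (div_pos (hS.φ_pos hn') (hS.φ_pos hn))).ne'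
      rw [hB, hW, ← heq, ← hJ] at hrisk
      have hfin : S.expCost r x0 n us vs U n ≠ ∞ := by
        rw [(hS.expCost_self r x0 hn us vs U).1]
        exact ENNReal.ofReal_ne_top
      have hint := (ENNReal.mul_right_inj hq ENNReal.ofReal_ne_top).1
        ((ENNReal.add_right_inj hfin).1 hrisk)
      have hWfin : ∫⁻ v, S.W r x0 (n + 1) (Function.update us n (S.nextControl U x0 n us vs))
          (Function.update vs n v) ∂(pred (S.shape n) (scale r vs n)) ≠ ∞ := by
        rw [(hS.lintegral_W_next hABC hr x0 us hvs _).1]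
        exact ENNReal.ofReal_ne_top
      have := ae_eq_of_ae_le_of_lintegral_le
        (Filter.Eventually.of_forall fun v => S.W_le r x0 (n + 1) _ _ hU) hWfin
        (hS.aemeasurable_condRisk_next hr x0 hn' us hvs hU) hint.ge
      filter_upwards [this] with v hv using hv.symm
    · exact Filter.Eventually.of_forall fun v => by
        rw [IsBayesFrom, condRisk_succ_last, W_succ_last]
  · rintro ⟨h1, h2⟩
    rw [IsBayesFrom, hW, ← hmin.2 h1, ← hJ, hrisk]
    congr 2
    exact lintegral_congr_ae h2

lemma eventually_forall_mem_Icc {α : Type*} {l : Filter α} [CountableInterFilter l]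
    {p : ℕ → α → Prop} (n M : ℕ) :
    (∀ᶠ a in l, ∀ i, n ≤ i → i ≤ M → p i a) ↔ ∀ i, n ≤ i → i ≤ M → ∀ᶠ a in l, p i a := by
  simp only [eventually_countable_forall]

lemma solves_iff (S : LinSystem m k) (A B : ℕ → Matrix (Fin m) (Fin m) ℝ) (r : Fin k → ℝ)
    (x0 : Fin m → ℝ) (n : ℕ) (us : ℕ → Fin m → ℝ) (vs : ℕ → Fin k → ℝ) (U : Policy m)
    {v : ℕ → Fin k → ℝ} (hv : ∀ j < n, v j = vs j) :
    S.Solves A B r x0 (U.withPast n us) v n ↔ S.K A n *ᵥ S.nextControl U x0 n us vs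
      = S.L A B n (S.state (.openLoop us) x0 vs n) (pad m (scale r vs n)) := by
  have h1 : S.path (U.withPast n us) x0 v n = S.path (.openLoop us) x0 vs n :=
    S.path_congr x0 hv fun i hi _ => by simp [Policy.withPast, Policy.openLoop, hi]
  have h2 : S.state (U.withPast n us) x0 v n = S.state (.openLoop us) x0 vs n := by
    simp only [state, h1]
  have h3 : S.control (U.withPast n us) x0 v n = S.nextControl U x0 n us vs := by
    simp only [control, h1, Policy.withPast, lt_irrefl, if_false, nextControl]
  rw [Solves, h2, h3, scale_congr r hv]

/-- Iteration of the one-step characterization: the equation at time `n` is deterministic given the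
history, and the later ones pass through the disintegration with respect to `v_n`. -/
lemma IsValid.isBayesFrom_iff_ae_joint (hS : S.IsValid)
    (hc : ∀ n < S.M, Function.Injective fun v : Fin k → ℝ => S.c n *ᵥ pad m v)
    {A B C : ℕ → Matrix (Fin m) (Fin m) ℝ}
    (hABC : ∀ n ≤ S.M, S.IsRiskFormAt (n + 1) (A (n + 1)) (B (n + 1)) (C (n + 1)))
    {r : Fin k → ℝ} (hr : ∀ i, 0 < r i) (x0 : Fin m → ℝ) {U : Policy m} (hU : U.IsAdmissible)
    (d : ℕ) : ∀ n, n + d = S.M + 1 → ∀ (us : ℕ → Fin m → ℝ) (vs : ℕ → Fin k → ℝ),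
      (∀ j i, 0 ≤ vs j i) → (S.IsBayesFrom r x0 n us vs U ↔ ∀ l, n ≤ l → l ≤ S.M →
        ∀ᵐ z ∂(S.joint (S.shape n) (scale r vs n)),
          S.Solves A B r x0 (U.withPast n us) (S.splice n vs z.2) l) := by
  induction d with
  | zero =>
    intro n hn us vs _
    obtain rfl : n = S.M + 1 := hn
    refine iff_of_true ?_ fun l h1 h2 => absurd h2 (by omega)
    rw [IsBayesFrom, condRisk_succ_last, W_succ_last]
  | succ d ih =>
    intro n hd us vs hvs
    have hn : n ≤ S.M := by omega
    -- Makes the measure nonzero, so that an almost sure statement independent of `z` is a true one.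
    have hprob := S.isProbabilityMeasure_joint (hS.shape_pos n) (scale r vs n)
    have hself : (∀ᵐ z ∂(S.joint (S.shape n) (scale r vs n)),
        S.Solves A B r x0 (U.withPast n us) (S.splice n vs z.2) n) ↔
        S.K A n *ᵥ S.nextControl U x0 n us vs
          = S.L A B n (S.state (.openLoop us) x0 vs n) (pad m (scale r vs n)) := by
      have h : ∀ z : (Fin k → ℝ) × (Fin S.M → Fin k → ℝ), S.Solves A B r x0 (U.withPast n us)
          (S.splice n vs z.2) n ↔ _ := fun z =>
        S.solves_iff A B r x0 n us vs U fun j hj => by simp [splice, hj]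
      simp only [h, Filter.eventually_const]
    have hnext : (∀ᵐ v ∂(pred (S.shape n) (scale r vs n)), S.IsBayesFrom r x0 (n + 1)
        (Function.update us n (S.nextControl U x0 n us vs)) (Function.update vs n v) U) ↔
        ∀ l, n + 1 ≤ l → l ≤ S.M → ∀ᵐ z ∂(S.joint (S.shape n) (scale r vs n)),
          S.Solves A B r x0 (U.withPast n us) (S.splice n vs z.2) l := by
      rcases hn.lt_or_eq with hn' | rfl
      · have hm : ∀ l, MeasurableSet {z : (Fin k → ℝ) × (Fin S.M → Fin k → ℝ) |
            S.Solves A B r x0 (U.withPast n us) (S.splice n vs z.2) l} := fun l =>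
          ((S.measurable_splice n vs).comp measurable_snd)
            (S.measurableSet_solves A B r x0 (hU.withPast n us) l)
        simp only [fun l => S.ae_joint_iff_ae_pred (hS.shape_pos n) (scale_pos hr vs n) ⟨n, hn'⟩
          (hm l)]
        rw [← eventually_forall_mem_Icc]
        refine Filter.eventually_congr ?_
        filter_upwards [ae_pred (γ := S.shape n) (scale_pos hr vs n)] with v hv
        rw [ih (n + 1) (by omega) _ _ (update_nonneg hvs n hv), scale_update, shape_succ]
        refine forall_congr' fun l => forall_congr' fun hl => forall_congr' fun _ => ?_
        refine Filter.eventually_congr (Filter.Eventually.of_forall fun z => ?_)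
        rw [Solves, Solves, S.control_withPast_succ U x0 hn' us vs z.2 v hl,
          S.state_withPast_succ U x0 hn' us vs z.2 v l, splice_update]
      · refine iff_of_true (Filter.Eventually.of_forall fun v => ?_)
          fun l h1 h2 => absurd h2 (by omega)
        rw [IsBayesFrom, condRisk_succ_last, W_succ_last]
    rw [hS.isBayesFrom_iff_succ hc hn (hABC n hn) hr x0 us hvs hU, ← hself, hnext]
    constructor
    · rintro ⟨h1, h2⟩ l hl
      rcases hl.eq_or_lt with rfl | hl
      · exact fun _ => h1
      · exact h2 l hl
    · exact fun h => ⟨h n le_rfl hn, fun l hl => h l (by omega)⟩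

/-- Coefficient matrices with index larger than the horizon are irrelevant. -/
lemma solves_truncate (S : LinSystem m k) (A B : ℕ → Matrix (Fin m) (Fin m) ℝ) (r : Fin k → ℝ)
    (x0 : Fin m → ℝ) (U : Policy m) (v : ℕ → Fin k → ℝ) {n : ℕ} (hn : n ≤ S.M) :
    S.Solves (fun i => if i ≤ S.M then A i else 0) (fun i => if i ≤ S.M then B i else 0)
      r x0 U v n ↔ S.Solves A B r x0 U v n := by
  rcases hn.lt_or_eq with hn | rfl
  · simp [Solves, K, L, Nat.succ_le_of_lt hn]
  · simp [Solves, K, L, φ_succ_last]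

/-- `IsRiskForm` says nothing at index `M + 1`; setting the matrices to zero there agrees with the
vanishing risk beyond the horizon. -/
lemma isRiskFormAt_truncate {A B C : ℕ → Matrix (Fin m) (Fin m) ℝ} (h : S.IsRiskForm A B C)
    (n : ℕ) (hn : n ≤ S.M) :
    S.IsRiskFormAt (n + 1) (if n + 1 ≤ S.M then A (n + 1) else 0)
      (if n + 1 ≤ S.M then B (n + 1) else 0) (if n + 1 ≤ S.M then C (n + 1) else 0) := by
  rcases hn.lt_or_eq with hn | rfl
  · simp only [Nat.succ_le_of_lt hn, if_true]
    exact h (n + 1) hn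
  · simp only [show ¬ S.M + 1 ≤ S.M by omega, if_false]
    exact S.isRiskFormAt_succ_last

lemma IsValid.isBayesFrom_iff (hS : S.IsValid)
    (hc : ∀ n < S.M, Function.Injective fun v : Fin k → ℝ => S.c n *ᵥ pad m v)
    {A B C : ℕ → Matrix (Fin m) (Fin m) ℝ} (hABC : S.IsRiskForm A B C)
    {r : Fin k → ℝ} (hr : ∀ i, 0 < r i) {n : ℕ} (hn : n ≤ S.M) (x0 : Fin m → ℝ)
    (us : ℕ → Fin m → ℝ) {vs : ℕ → Fin k → ℝ} (hvs : ∀ j i, 0 ≤ vs j i) {U : Policy m}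
    (hU : U.IsAdmissible) :
    S.IsBayesFrom r x0 n us vs U ↔ ∀ l, n ≤ l → l ≤ S.M →
      ∀ᵐ lam ∂(S.posterior r n vs), ∀ᵐ w ∂(S.disturbLaw lam),
        S.Solves A B r x0 (U.withPast n us) (S.splice n vs w) l := by
  rw [hS.isBayesFrom_iff_ae_joint (A := fun i => if i ≤ S.M then A i else 0)
    (B := fun i => if i ≤ S.M then B i else 0) (C := fun i => if i ≤ S.M then C i else 0) hc
    (isRiskFormAt_truncate hABC) hr x0 hU (S.M + 1 - n) n (by omega) us vs hvs]
  refine forall_congr' fun l => forall_congr' fun _ => forall_congr' fun hl => ?_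
  simp only [S.solves_truncate A B r x0 _ _ hl]
  rw [S.posterior_eq hS.shape_gt_two hr n hvs]
  exact S.ae_joint_iff (scale_pos hr vs n) (p := fun z => S.Solves A B r x0 (U.withPast n us)
    (S.splice n vs z.2) l) (((S.measurable_splice n vs).comp measurable_snd)
    (S.measurableSet_solves A B r x0 (hU.withPast n us) l))

lemma IsValid.exists_solving_policy (hS : S.IsValid)
    (hc : ∀ n < S.M, Function.Injective fun v : Fin k → ℝ => S.c n *ᵥ pad m v)
    {A B C : ℕ → Matrix (Fin m) (Fin m) ℝ} (hABC : S.IsRiskForm A B C)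
    {r : Fin k → ℝ} (hr : ∀ i, 0 < r i) :
    ∃ U : Policy m, U.IsAdmissible ∧ ∀ n ≤ S.M, ∀ (x0 : Fin m → ℝ) (us : ℕ → Fin m → ℝ)
      (vs : ℕ → Fin k → ℝ), (∀ j i, 0 ≤ vs j i) →
        S.Solves A B r x0 (U.withPast n us) vs n := by
  have h : ∀ n, ∃ F : (Fin (n + 1) → Fin m → ℝ) × (Fin n → Fin m → ℝ) → Fin m → ℝ,
      Measurable F ∧ (n ≤ S.M → ∀ (x0 : Fin m → ℝ) (us : ℕ → Fin m → ℝ) (vs : ℕ → Fin k → ℝ),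
        (∀ j i, 0 ≤ vs j i) →
        S.K (fun i => if i ≤ S.M then A i else 0) n *ᵥ F (S.path (.openLoop us) x0 vs n)
          = S.L (fun i => if i ≤ S.M then A i else 0) (fun i => if i ≤ S.M then B i else 0) n
            (S.state (.openLoop us) x0 vs n) (pad m (scale r vs n))) := fun n => by
    by_cases hn : n ≤ S.M
    · obtain ⟨F, h1, h2⟩ := hS.exists_feedback (A := fun i => if i ≤ S.M then A i else 0)
        (B := fun i => if i ≤ S.M then B i else 0) (C := fun i => if i ≤ S.M then C i else 0) hc hn
        (isRiskFormAt_truncate hABC n hn) hr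
      exact ⟨F, h1, fun _ => h2⟩
    · exact ⟨0, measurable_const, fun h => absurd h hn⟩
  choose U hU hUs using h
  refine ⟨U, hU, fun n hn x0 us vs hvs => ?_⟩
  rw [← S.solves_truncate A B r x0 _ _ hn, S.solves_iff _ _ r x0 n us vs U fun _ _ => rfl]
  exact hUs n hn x0 us vs hvs

/-! ### The untruncated problem -/

lemma posterior_zero (hS : S.IsValid) {r : Fin k → ℝ} (hr : ∀ i, 0 < r i)
    {vs : ℕ → Fin k → ℝ} (hvs : ∀ j i, 0 ≤ vs j i) : S.posterior r 0 vs = S.prior r := by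
  rw [S.posterior_eq hS.shape_gt_two hr 0 hvs, prior, paretoPi]
  simp [shape, scale]

lemma splice_zero (S : LinSystem m k) (vs : ℕ → Fin k → ℝ) (w : Fin S.M → Fin k → ℝ) :
    S.splice 0 vs w = S.extend w := by
  ext1 j; simp [splice, extend]

lemma _root_.Policy.withPast_zero (U : Policy m) (us : ℕ → Fin m → ℝ) : U.withPast 0 us = U := by
  funext i h; exact if_neg (Nat.not_lt_zero i)

/-- The rescaled integral is measurable in every `l` and agrees with the original one for positive
`l`, that is, almost surely. -/
lemma aemeasurable_lintegral_disturbLaw (S : LinSystem m k) {γ ρ : Fin k → ℝ} (hρ : ∀ i, 0 < ρ i)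
    {F : (Fin k → ℝ) × (Fin S.M → Fin k → ℝ) → ℝ≥0∞} (hF : Measurable F) :
    AEMeasurable (fun l => ∫⁻ w, F (l, w) ∂(S.disturbLaw l)) (paretoPi γ ρ) := by
  refine ⟨fun l => ∫⁻ ξ, F (l, fun j => l * ξ j) ∂(S.disturbLaw 1),
    Measurable.lintegral_prod_right' (f := fun z : (Fin k → ℝ) × (Fin S.M → Fin k → ℝ) =>
      F (z.1, fun j => z.1 * z.2 j)) (hF.comp (by fun_prop)), ?_⟩
  filter_upwards [ae_paretoPi γ ρ] with l hl
  rw [← S.map_mul_disturbLaw fun i => (hρ i).trans_le (hl i),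
    lintegral_map (hF.fun_comp measurable_prodMk_left) (by fun_prop)]

lemma measurable_extend (S : LinSystem m k) : Measurable S.extend := by
  have h := S.measurable_splice 0 0
  simpa only [splice_zero] using h

lemma measurable_stageCost_extend (S : LinSystem m k) {U : Policy m} (hU : U.IsAdmissible)
    (x0 : Fin m → ℝ) (i : ℕ) :
    Measurable fun z : (Fin k → ℝ) × (Fin S.M → Fin k → ℝ) =>
      S.stageCost U x0 z.1 (S.extend z.2) i := by
  have h : Measurable fun z : (Fin k → ℝ) × (Fin S.M → Fin k → ℝ) => (z.1, S.extend z.2) :=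
    measurable_fst.prodMk (S.measurable_extend.comp measurable_snd)
  have h' := (S.measurable_stageCost hU x0 i).comp h
  exact h'

lemma measurable_sum_stageCost_extend (S : LinSystem m k) {U : Policy m} (hU : U.IsAdmissible)
    (x0 : Fin m → ℝ) (j : ℕ) :
    Measurable fun z : (Fin k → ℝ) × (Fin S.M → Fin k → ℝ) => ENNReal.ofReal
      (∑ i ∈ Finset.range (j + 1), S.stageCost U x0 z.1 (S.extend z.2) i) := by
  refine Measurable.ennreal_ofReal ?_
  exact Finset.measurable_fun_sum _ fun i _ => S.measurable_stageCost_extend hU x0 i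

lemma risk_eq_sum (S : LinSystem m k) {r : Fin k → ℝ} (hr : ∀ i, 0 < r i)
    (x0 : Fin m → ℝ) {U : Policy m} (hU : U.IsAdmissible) :
    S.risk r x0 U = ∑ j ∈ Finset.range (S.M + 1), ENNReal.ofReal (S.p j) *
      ∫⁻ lam, ∫⁻ w, ENNReal.ofReal
        (∑ i ∈ Finset.range (j + 1), S.stageCost U x0 lam (S.extend w) i)
        ∂(S.disturbLaw lam) ∂(S.prior r) := by
  have hm : ∀ j, AEMeasurable (fun lam => ∫⁻ w, ENNReal.ofReal
      (∑ i ∈ Finset.range (j + 1), S.stageCost U x0 lam (S.extend w) i)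
      ∂(S.disturbLaw lam)) (S.prior r) := fun j =>
    S.aemeasurable_lintegral_disturbLaw hr (S.measurable_sum_stageCost_extend hU x0 j)
  rw [risk, lintegral_finsetSum' _ fun j _ => (hm j).const_mul _]
  exact Finset.sum_congr rfl fun j _ => lintegral_const_mul'' _ (hm j)

/-- At time 0 nothing has been observed: `φ_0 = 1`, the posterior is the prior, and `us`, `vs` play
no role. -/
lemma IsValid.risk_eq_condRisk (hS : S.IsValid)
    (hp1 : ∑ j ∈ Finset.range (S.M + 1), S.p j = 1) {r : Fin k → ℝ} (hr : ∀ i, 0 < r i)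
    (x0 : Fin m → ℝ) (us : ℕ → Fin m → ℝ) {vs : ℕ → Fin k → ℝ} (hvs : ∀ j i, 0 ≤ vs j i)
    {U : Policy m} (hU : U.IsAdmissible) :
    S.risk r x0 U = S.condRisk r x0 0 us vs U := by
  have hφ : S.φ 0 = 1 := by rw [φ, ← hp1, Finset.range_eq_Ico]; rfl
  have hIcc : ∀ j : ℕ, Finset.Icc 0 j = Finset.range (j + 1) := fun j => by ext; simp
  simp only [S.risk_eq_sum hr x0 hU, condRisk, posterior_zero hS hr hvs, hφ, hIcc, div_one,
    Policy.withPast_zero, splice_zero]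

lemma IsValid.isBayes_iff (hS : S.IsValid)
    (hc : ∀ n < S.M, Function.Injective fun v : Fin k → ℝ => S.c n *ᵥ pad m v)
    (hp1 : ∑ j ∈ Finset.range (S.M + 1), S.p j = 1)
    {A B C : ℕ → Matrix (Fin m) (Fin m) ℝ} (hABC : S.IsRiskForm A B C)
    {r : Fin k → ℝ} (hr : ∀ i, 0 < r i) (x0 : Fin m → ℝ) {U : Policy m} (hU : U.IsAdmissible) :
    S.IsBayes r x0 U ↔ ∀ n ≤ S.M, ∀ᵐ lam ∂(S.prior r), ∀ᵐ w ∂(S.disturbLaw lam),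
      S.Solves A B r x0 U (S.extend w) n := by
  have hvs : ∀ (j : ℕ) (i : Fin k), (0 : ℝ) ≤ (0 : ℕ → Fin k → ℝ) j i := fun _ _ => le_rfl
  have h := hS.isBayesFrom_iff hc hABC hr (Nat.zero_le _) x0 0 hvs hU
  simp only [posterior_zero hS hr hvs, splice_zero, Policy.withPast_zero, Nat.zero_le,
    forall_true_left] at h
  rw [← h, IsBayes, IsBayesFrom, W, hS.risk_eq_condRisk hp1 hr x0 0 hvs hU]
  have : (⨅ (U' : Policy m) (_ : U'.IsAdmissible), S.risk r x0 U')
      = ⨅ (U' : Policy m) (_ : U'.IsAdmissible), S.condRisk r x0 0 0 0 U' :=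
    iInf_congr fun U' => iInf_congr fun hU' => hS.risk_eq_condRisk hp1 hr x0 0 hvs hU'
  rw [this]

/-! ### The posterior moments -/

lemma integral_disturbLaw {l : Fin k → ℝ} (hl : ∀ i, 0 < l i) (n : Fin S.M) (i : Fin k)
    {f : ℝ → ℝ} (hf : Measurable f) :
    ∫ w, f (w n i) ∂(S.disturbLaw l) = ∫ v, f v ∂(unifMeasure (l i)) := by
  have := isProbabilityMeasure_unifPi hl
  rw [disturbLaw_eq, ← integral_comp_eval_unifPi hl i hf]
  exact integral_comp_eval (μ := fun _ : Fin S.M => unifPi l) (i := n)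
    (f := fun v : Fin k → ℝ => f (v i)) (hf.comp (measurable_pi_apply i)).aestronglyMeasurable

/-- Given `λ`, the inner integrals are uniform means, and the outer ones are Pareto moments of
orders 1 and -1. The entries of `vs` before `n` fix `r_n`, so only `v_n` is random. -/
lemma IsValid.posterior_moments (hS : S.IsValid) {r : Fin k → ℝ} (hr : ∀ i, 0 < r i)
    {vs : ℕ → Fin k → ℝ} (hvs : ∀ j i, 0 ≤ vs j i) {n : ℕ} (hn : n < S.M) :
    pad m (fun i => ∫ lam, ∫ w, S.splice n vs w n i ∂(S.disturbLaw lam)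
      ∂(S.posterior r n vs)) = S.Q n *ᵥ pad m (scale r vs n) ∧
    pad m (fun i => ∫ lam, ∫ w, scale r (S.splice n vs w) (n + 1) i ∂(S.disturbLaw lam)
      ∂(S.posterior r n vs)) = S.Q₂ n *ᵥ pad m (scale r vs n) := by
  have hρ := scale_pos hr vs n
  have h1 : ∀ w : Fin S.M → Fin k → ℝ, S.splice n vs w n = w ⟨n, hn⟩ := fun w => by
    simp [splice, hn]
  have h2 : ∀ w : Fin S.M → Fin k → ℝ, scale r (S.splice n vs w) n = scale r vs n := fun w =>
    scale_congr r fun j hj => by simp [splice, hj]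
  rw [S.posterior_eq hS.shape_gt_two hr n hvs, Q, Q₂, diagonal_pad_mulVec, diagonal_pad_mulVec]
  constructor
  · congr 1
    ext i
    rw [Pi.mul_apply]
    refine Eq.trans ?_ (integral_half_paretoPi (hS.shape_gt n) hρ i)
    refine integral_congr_ae ?_
    filter_upwards [ae_paretoPi (S.shape n) (scale r vs n)] with l hl
    have hl0 : ∀ i, 0 < l i := fun i => (hρ i).trans_le (hl i)
    simp only [h1]
    rw [S.integral_disturbLaw hl0 ⟨n, hn⟩ i (f := fun x => x) measurable_id,
      integral_id_unifMeasure (hl0 i)]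
  · congr 1
    ext i
    rw [Pi.mul_apply]
    refine Eq.trans ?_ (integral_half_add_inv_paretoPi (hS.shape_gt n) hρ i)
    refine integral_congr_ae ?_
    filter_upwards [ae_paretoPi (S.shape n) (scale r vs n)] with l hl
    have hl0 : ∀ i, 0 < l i := fun i => (hρ i).trans_le (hl i)
    have h3 : ∀ w : Fin S.M → Fin k → ℝ, scale r (S.splice n vs w) (n + 1) i
        = max (scale r vs n i) (w ⟨n, hn⟩ i) := fun w => by
      rw [scale_succ, h1, h2]; rfl
    simp only [h3]
    rw [S.integral_disturbLaw hl0 ⟨n, hn⟩ i (f := fun x => max (scale r vs n i) x) (by fun_prop),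
      integral_max_unifMeasure (hρ i).le (hl i) (hl0 i)]

end LinSystem
end

/-! ### The main theorem. -/

theorem theorem3p1 {m k : ℕ} (hkm : k ≤ m) (S : LinSystem m k)
    (hβ : ∀ i, 2 < S.β i)
    (hp : ∀ j ≤ S.M, 0 ≤ S.p j) (hp1 : ∑ j ∈ Finset.range (S.M + 1), S.p j = 1) (hpM : S.p S.M ≠ 0)
    (hκs : ∀ n ≤ S.M, (S.κ n).IsSymm) (hκ : ∀ n ≤ S.M, ∀ u, 0 ≤ u ⬝ᵥ (S.κ n *ᵥ u))
    (hs : ∀ n ≤ S.M, ∀ y, 0 ≤ y ⬝ᵥ (S.s n *ᵥ y))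
    (hc : ∀ n < S.M, Function.Injective fun v : Fin k → ℝ => S.c n *ᵥ pad m v) :
    -- the Bayes risk is a quadratic form
    (∃ A B C, S.IsRiskForm A B C) ∧
    -- the posterior moment formulas `E(v_n | ·) = Q^n r_n`, `E(r_{n+1} | ·) = Q_2^n r_n`
    (∀ (r : Fin k → ℝ) (vs : ℕ → Fin k → ℝ), (∀ i, 0 < r i) → (∀ j i, 0 ≤ vs j i) →
      ∀ n < S.M,
        pad m (fun i => ∫ lam, ∫ w, S.splice n vs w n i ∂(S.disturbLaw lam)
            ∂(S.posterior r n vs)) = S.Q n *ᵥ pad m (scale r vs n) ∧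
        pad m (fun i => ∫ lam, ∫ w, scale r (S.splice n vs w) (n + 1) i ∂(S.disturbLaw lam)
            ∂(S.posterior r n vs)) = S.Q₂ n *ᵥ pad m (scale r vs n)) ∧
    ∀ A B C, S.IsRiskForm A B C → ∀ r : Fin k → ℝ, (∀ i, 0 < r i) →
      -- a policy is Bayes iff its controls solve the linear systems almost surely
      (∀ (x0 : Fin m → ℝ) (U : Policy m), U.IsAdmissible →
        (S.IsBayes r x0 U ↔ ∀ n ≤ S.M, ∀ᵐ lam ∂(S.prior r), ∀ᵐ w ∂(S.disturbLaw lam),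
          S.Solves A B r x0 U (S.extend w) n)) ∧
      -- the same for the problem truncated at `n`, given any history
      (∀ n ≤ S.M, ∀ (x0 : Fin m → ℝ) (us : ℕ → Fin m → ℝ) (vs : ℕ → Fin k → ℝ) (U : Policy m),
        (∀ j i, 0 ≤ vs j i) → U.IsAdmissible →
        (S.IsBayesFrom r x0 n us vs U ↔ ∀ l, n ≤ l → l ≤ S.M →
          ∀ᵐ lam ∂(S.posterior r n vs), ∀ᵐ w ∂(S.disturbLaw lam),
            S.Solves A B r x0 (U.withPast n us) (S.splice n vs w) l)) ∧
      -- the linear systems are solvable, by one policy for all histories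
      (∃ U : Policy m, U.IsAdmissible ∧ ∀ n ≤ S.M, ∀ (x0 : Fin m → ℝ) (us : ℕ → Fin m → ℝ)
        (vs : ℕ → Fin k → ℝ), (∀ j i, 0 ≤ vs j i) →
          S.Solves A B r x0 (U.withPast n us) vs n) := by
  have hS : S.IsValid := ⟨hβ, hp, hpM, hκs, hκ, hs⟩
  exact ⟨hS.exists_isRiskForm hc,
    fun r vs hr hvs n hn => hS.posterior_moments hr hvs hn,
    fun A B C hABC r hr => ⟨fun x0 U hU => hS.isBayes_iff hc hp1 hABC hr x0 hU,
      fun n hn x0 us vs U hvs hU => hS.isBayesFrom_iff hc hABC hr hn x0 us hvs hU,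
      hS.exists_solving_policy hc hABC hr⟩⟩
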